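/- Let $N\ge 2$, $\ell>0$, $\Sigma=\mathbb R^{N-1}$, $\Omega=\Sigma\times(0,\ell)$ with points $z=(x,y)$, and let $g,\sigma>0$, $0\le r\le 1$, $\lambda\ge 0$. Hats denote the Fourier transform in $x$ only, $\hat f(\xi)=\int_\Sigma f(x)e^{-2\pi i\xi\cdot x}\,dx$, extended to $L^2$. Let $\mu(\xi)=g+\sigma(2\pi|\xi|)^{2r}$ and let $M=g+\sigma(-\Delta)^r$ be the Fourier multiplier with symbol $\mu$. Put $$\mathcal H=\{v\in H^1(\Omega;\mathbb R^N): v=0\text{ on }\{y=0\},\ \operatorname{div}v=0\},\qquad (\mathbb D u)_{ij}=\partial_iu_j+\partial_ju_i ,$$ with $\mathcal H$ embedded in $\mathcal H^*$ through the $L^2(\Omega)$ inner product. Given $u_0\in L^2(\Omega;\mathbb R^N)$ and $h_0\in L^2(\Sigma)$ (real valued), a weak solution with initial data $(u_0,h_0)$ is a pair $(u,h)$ with $u\in L^2_{loc}([0,\infty);\mathcal H)$, $\partial_tu\in L^2_{loc}([0,\infty);\mathcal H^*)$, $h,M(h)\in L^2_{loc}([0,\infty);L^2(\Sigma))$, $\partial_th\in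 L^2_{loc}([0,\infty);H^{1/2}(\Sigma))$, such that for every $T>0$ and every $v\in L^2((0,T);\mathcal H)$ $$[\partial_tu,v]_{\mathcal H^*,\mathcal H}+\tfrac12(\mathbb Du,\mathbb Dv)_{L^2(\Omega)}+\int_{\{y=\ell\}}M(h)\,v_N\,dx=0\quad\text{for a.e. }t\in(0,T),$$ $\partial_th=u_N$ on $\{y=\ell\}$ in the sense of traces for a.e. $t>0$, and $u=u_0$, $h=h_0$ at $t=0$. Define $$\|f\|_{H^s(\Sigma)}^2=\int(1+|\xi|^2)^s|\hat f(\xi)|^2d\xi,\qquad \|w\|_{H^s_x(L^2_y)}^2=\int_0^\ell\!\int(1+|\xi|^2)^s|\hat w(\xi,y)|^2d\xi\,dy,$$ $$\|I_\lambda f\|_{L^2(\Sigma)}^2=\int_{\xi\ne0}|\xi|^{-2\lambda}|\hat f(\xi)|^2d\xi,\qquad \|I_\lambda w\|_{L^2(\Omega)}^2=\int_0^\ell\!\int_{\xi\ne0}|\xi|^{-2\lambda}|\hat w(\xi,y)|^2d\xi\,dy .$$ Assume $\|I_\lambda u_0\|_{L^2(\Omega)}<\infty$ and $\|I_\lambda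 h_0\|_{L^2(\Sigma)}<\infty$. Assume further that $h_0\in H^r(\Sigma)$ if $r\ge\frac12$, and that $u_0\in H_x^{\lambda(\frac12-r)}(L^2_y)$ and $h_0\in H^{\frac\lambda2+r(1-\lambda)}(\Sigma)$ if $0\le r<\frac12$. Then there is a constant $K>0$, depending only on the initial data $(u_0,h_0)$ and on $N,\ell,g,\sigma,r,\lambda$, such that for every weak solution $(u,h)$ with these data, the functions $u$ and $h$ have (after modification on a null set of times) representatives in $C([0,\infty);L^2(\Omega))$ and $C([0,\infty);L^2(\Sigma))$ with values $u_0$, $h_0$ at $t=0$, and for these representatives the energy $$\mathcal E(t)=\frac12\int_\Omega|u(z,t)|^2dz+\frac12\int_\Sigma M(h)\,h\,dx=\frac12\int_\Omega|u(z,t)|^2dz+\frac12\int_{\mathbb R^{N-1}}\mu(\xi)|\hat h(\xi,t)|^2d\xi$$ satisfies $$\mathcal E(t)\le K(1+t)^{-\lambda}\qquad\text{for all }t\ge0 .$$ -/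

import Mathlib

open MeasureTheory Set Filter Topology
open scoped ENNReal FourierTransform ContDiff

noncomputable section

namespace FracBoundaryNS

/-! ## The domain

The space dimension is `N = d + 1`.  Points of `Σ × ℝ = ℝ^{N-1} × ℝ` are pairs `z = (x, y)`.  The
coordinates of `ℝ^N` are indexed by `Fin (d + 1)`; `Fin.last d` is the vertical one. -/

/-- The horizontal cross section `Σ = ℝ^{N-1}`; it is its own dual group. -/
abbrev Cross (d : ℕ) : Type := EuclideanSpace ℝ (Fin d)

/-- Lebesgue measure on the slab `Ω = Σ × (0, ℓ)`. -/
def slab (d : ℕ) (ℓ : ℝ) : Measure (Cross d × ℝ) :=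
  (volume : Measure (Cross d × ℝ)).restrict (univ ×ˢ Ioo 0 ℓ)

/-- The `i`-th coordinate direction `e_i` of `Σ × ℝ`. -/
def dir (d : ℕ) (i : Fin (d + 1)) : Cross d × ℝ :=
  Fin.lastCases (motive := fun _ => Cross d × ℝ) ((0 : Cross d), (1 : ℝ))
    (fun j => (EuclideanSpace.single j (1 : ℝ), (0 : ℝ))) i

/-- `L²(Σ)`, real valued. -/
abbrev SurfL2 (d : ℕ) : Type := Lp ℝ 2 (volume : Measure (Cross d))

/-- `L²(Ω; ℝ^N)`. -/
abbrev VecL2 (d : ℕ) (ℓ : ℝ) : Type := Lp (EuclideanSpace ℝ (Fin (d + 1))) 2 (slab d ℓ)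

/-- `L²(Ω; ℝ^{N × N})`; the entry `(i, j)` of a gradient is `∂_i u_j`. -/
abbrev MatL2 (d : ℕ) (ℓ : ℝ) : Type :=
  Lp (EuclideanSpace ℝ (Fin (d + 1) × Fin (d + 1))) 2 (slab d ℓ)

/-! ## Weak derivatives and traces -/

/-- Integration by parts without boundary contribution: `∫_Ω (w ∂_i φ + g φ) = 0` for every test
function `φ ∈ C_c^∞(Σ × ℝ)` whose support lies in `Σ × I`. -/
def PartsOn (d : ℕ) (ℓ : ℝ) (I : Set ℝ) (i : Fin (d + 1)) (w g : Cross d × ℝ → ℝ) : Prop :=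
  ∀ φ : Cross d × ℝ → ℝ, ContDiff ℝ ∞ φ → HasCompactSupport φ → tsupport φ ⊆ univ ×ˢ I →
    ∫ z, (w z * fderiv ℝ φ z (dir d i) + g z * φ z) ∂(slab d ℓ) = 0

/-- `g` is the weak derivative `∂_i w` in `Ω` (test functions with compact support in `Ω`). -/
def HasWeakPartial (d : ℕ) (ℓ : ℝ) (i : Fin (d + 1)) (w g : Cross d × ℝ → ℝ) : Prop :=
  PartsOn d ℓ (Ioo 0 ℓ) i w g

/-- The trace on `{y = 0}` of a function `w ∈ H¹(Ω)` with `∂_y w = g` vanishes: integration by parts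
in `y` against test functions that vanish near `{y = ℓ}`, but not necessarily near `{y = 0}`, gives
no boundary term. -/
def VanishesAtBottom (d : ℕ) (ℓ : ℝ) (w g : Cross d × ℝ → ℝ) : Prop :=
  PartsOn d ℓ (Iio ℓ) (Fin.last d) w g

/-- `τ` is the trace on `{y = ℓ}` of a function `w ∈ H¹(Ω)` with `∂_y w = g`: the integration by
parts formula `∫_Ω (w ∂_y φ + φ ∂_y w) = ∫_Σ φ(x, ℓ) τ(x) dx` holds for all test functions that
vanish near `{y = 0}`. -/
def IsTopTrace (d : ℕ) (ℓ : ℝ) (w g : Cross d × ℝ → ℝ) (τ : Cross d → ℝ) : Prop :=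
  ∀ φ : Cross d × ℝ → ℝ, ContDiff ℝ ∞ φ → HasCompactSupport φ → tsupport φ ⊆ univ ×ˢ Ioi 0 →
    ∫ z, (w z * fderiv ℝ φ z (dir d (Fin.last d)) + g z * φ z) ∂(slab d ℓ)
      = ∫ x, φ (x, ℓ) * τ x

/-! ## The space of divergence free `H¹` fields vanishing on the bottom -/

/-- A pair `(u, G)` consists of `u ∈ H¹(Ω; ℝ^N)` and `G = ∇u`, where `u = 0` on `{y = 0}` and
`div u = 0`. -/
structure IsHelField (d : ℕ) (ℓ : ℝ) (p : WithLp 2 (VecL2 d ℓ × MatL2 d ℓ)) : Prop where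
  weakGrad : ∀ i j, HasWeakPartial d ℓ i (fun z => p.fst z j) (fun z => p.snd z (i, j))
  bottom : ∀ j, VanishesAtBottom d ℓ (fun z => p.fst z j) (fun z => p.snd z (Fin.last d, j))
  divFree : ∀ᵐ z ∂(slab d ℓ), ∑ i, p.snd z (i, i) = 0

lemma memLp_test {d : ℕ} {ℓ : ℝ} {ψ : Cross d × ℝ → ℝ} (hc : Continuous ψ)
    (hs : HasCompactSupport ψ) : MemLp ψ 2 (slab d ℓ) :=
  (hc.memLp_of_hasCompactSupport (μ := (volume : Measure (Cross d × ℝ))) hs).restrict _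

lemma integrable_parts {d : ℕ} {ℓ : ℝ} (i : Fin (d + 1)) {w g φ : Cross d × ℝ → ℝ}
    (hw : MemLp w 2 (slab d ℓ)) (hg : MemLp g 2 (slab d ℓ))
    (hφ : ContDiff ℝ ∞ φ) (hs : HasCompactSupport φ) :
    Integrable (fun z => w z * fderiv ℝ φ z (dir d i) + g z * φ z) (slab d ℓ) := by
  have h1 : MemLp (fun z => fderiv ℝ φ z (dir d i)) 2 (slab d ℓ) := by
    refine memLp_test ?_ ?_
    · exact (hφ.continuous_fderiv (by simp)).clm_apply continuous_const
    · exact hs.fderiv_apply (𝕜 := ℝ) (dir d i)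
  exact (hw.integrable_mul h1).add (hg.integrable_mul (memLp_test hφ.continuous hs))

lemma memLp_coord {ι : Type*} [Fintype ι] {d : ℕ} {ℓ : ℝ}
    (f : Lp (EuclideanSpace ℝ ι) 2 (slab d ℓ)) (j : ι) : MemLp (fun z => f z j) 2 (slab d ℓ) :=
  (EuclideanSpace.proj (𝕜 := ℝ) j : EuclideanSpace ℝ ι →L[ℝ] ℝ).comp_memLp' (Lp.memLp f)

lemma PartsOn.lin {d : ℕ} {ℓ : ℝ} {I : Set ℝ} {i : Fin (d + 1)} {w g w' g' W G : Cross d × ℝ → ℝ}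
    (c : ℝ) (h : PartsOn d ℓ I i w g) (h' : PartsOn d ℓ I i w' g')
    (hw : MemLp w 2 (slab d ℓ)) (hg : MemLp g 2 (slab d ℓ))
    (hw' : MemLp w' 2 (slab d ℓ)) (hg' : MemLp g' 2 (slab d ℓ))
    (hW : ∀ᵐ z ∂(slab d ℓ), W z = w z + c * w' z)
    (hG : ∀ᵐ z ∂(slab d ℓ), G z = g z + c * g' z) : PartsOn d ℓ I i W G := by
  intro φ hφ hs hI
  have e : (fun z => W z * fderiv ℝ φ z (dir d i) + G z * φ z) =ᵐ[slab d ℓ]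
      fun z => (w z * fderiv ℝ φ z (dir d i) + g z * φ z)
        + c * (w' z * fderiv ℝ φ z (dir d i) + g' z * φ z) := by
    filter_upwards [hW, hG] with z h1 h2
    rw [h1, h2]; ring
  rw [integral_congr_ae e, integral_add (integrable_parts i hw hg hφ hs)
    ((integrable_parts i hw' hg' hφ hs).const_mul c), integral_const_mul, h φ hφ hs hI,
    h' φ hφ hs hI]
  simp

lemma coord_lin {ι : Type*} [Fintype ι] {d : ℕ} {ℓ : ℝ} (c : ℝ)
    (f f' : Lp (EuclideanSpace ℝ ι) 2 (slab d ℓ)) :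
    ∀ᵐ z ∂(slab d ℓ), ∀ j, (f + c • f') z j = f z j + c * f' z j := by
  filter_upwards [Lp.coeFn_add f (c • f'), Lp.coeFn_smul c f'] with z h1 h2 j
  rw [h1, Pi.add_apply, h2]; simp

lemma IsHelField.lin {d : ℕ} {ℓ : ℝ} {p q : WithLp 2 (VecL2 d ℓ × MatL2 d ℓ)} (c : ℝ)
    (hp : IsHelField d ℓ p) (hq : IsHelField d ℓ q) : IsHelField d ℓ (p + c • q) where
  weakGrad i j := (hp.weakGrad i j).lin c (hq.weakGrad i j) (memLp_coord _ _) (memLp_coord _ _)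
    (memLp_coord _ _) (memLp_coord _ _)
    ((coord_lin c p.fst q.fst).mono fun _ h => h _) ((coord_lin c p.snd q.snd).mono fun _ h => h _)
  bottom j := (hp.bottom j).lin c (hq.bottom j) (memLp_coord _ _) (memLp_coord _ _)
    (memLp_coord _ _) (memLp_coord _ _)
    ((coord_lin c p.fst q.fst).mono fun _ h => h _) ((coord_lin c p.snd q.snd).mono fun _ h => h _)
  divFree := by
    filter_upwards [hp.divFree, hq.divFree, coord_lin c p.snd q.snd] with z h1 h2 h3
    have : ∀ i, (p + c • q).snd z (i, i) = p.snd z (i, i) + c * q.snd z (i, i) := fun i => h3 _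
    rw [Finset.sum_congr rfl fun i _ => this i, Finset.sum_add_distrib, ← Finset.mul_sum, h1, h2]
    simp

lemma isHelField_zero (d : ℕ) (ℓ : ℝ) : IsHelField d ℓ 0 := by
  have e : ∀ {ι : Type} [Fintype ι] (j : ι),
      ∀ᵐ z ∂(slab d ℓ), (0 : Lp (EuclideanSpace ℝ ι) 2 (slab d ℓ)) z j = 0 := by
    intro ι _ j
    filter_upwards [Lp.coeFn_zero (EuclideanSpace ℝ ι) 2 (slab d ℓ)] with z h
    rw [h]; simp
  have key : ∀ I (i : Fin (d + 1)) j, PartsOn d ℓ I i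
      (fun z => (0 : VecL2 d ℓ) z j) (fun z => (0 : MatL2 d ℓ) z (i, j)) := by
    intro I i j φ _ _ _
    refine integral_eq_zero_of_ae ?_
    filter_upwards [e j, e (i, j)] with z h1 h2
    change _ * _ + _ * _ = (0 : ℝ)
    rw [h1, h2]; simp
  refine ⟨fun i j => key _ i j, fun j => key _ _ j, ?_⟩
  filter_upwards [Lp.coeFn_zero (EuclideanSpace ℝ (Fin (d + 1) × Fin (d + 1))) 2 (slab d ℓ)] with z h
  have : ∀ i, (0 : WithLp 2 (VecL2 d ℓ × MatL2 d ℓ)).snd z (i, i) = 0 := fun i => by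
    rw [WithLp.zero_snd, h]; simp
  exact Finset.sum_eq_zero fun i _ => this i

/-- The Hilbert space of fields `u ∈ H¹(Ω; ℝ^N)` with `u = 0` on `{y = 0}` and `div u = 0`, realised
as the graph of `u ↦ (u, ∇u)` in `L² × L²`.  It carries the `H¹` norm, which on this space is
equivalent to `‖∇u‖_{L²}` by the Poincaré inequality; only the topology matters below. -/
def Hel (d : ℕ) (ℓ : ℝ) : Submodule ℝ (WithLp 2 (VecL2 d ℓ × MatL2 d ℓ)) where
  carrier := {p | IsHelField d ℓ p}
  zero_mem' := isHelField_zero d ℓ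
  add_mem' := fun {p q} hp hq => by simpa using hp.lin 1 hq
  smul_mem' := fun c p hp => by simpa using (isHelField_zero d ℓ).lin c hp

/-- The field `v` as an element of `L²(Ω; ℝ^N)`. -/
def Hel.field {d : ℕ} {ℓ : ℝ} (v : Hel d ℓ) : VecL2 d ℓ := v.1.fst

/-- The gradient of `v` as an element of `L²(Ω; ℝ^{N × N})`. -/
def Hel.grad {d : ℕ} {ℓ : ℝ} (v : Hel d ℓ) : MatL2 d ℓ := v.1.snd

/-- The vertical component `v_N` has trace `τ` on `{y = ℓ}`. -/
def Hel.IsNormalTrace {d : ℕ} {ℓ : ℝ} (v : Hel d ℓ) (τ : SurfL2 d) : Prop :=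
  IsTopTrace d ℓ (fun z => Hel.field v z (Fin.last d)) (fun z => Hel.grad v z (Fin.last d, Fin.last d)) τ

/-- `(𝔻u, 𝔻v)` in `L²(Ω)`, with `(𝔻u)_{ij} = ∂_i u_j + ∂_j u_i`. -/
def symGradInner {d : ℕ} {ℓ : ℝ} (u v : Hel d ℓ) : ℝ :=
  ∑ i, ∑ j, ∫ z, (Hel.grad u z (i, j) + Hel.grad u z (j, i)) * (Hel.grad v z (i, j) + Hel.grad v z (j, i))
    ∂(slab d ℓ)

/-! ## Fourier transform and Fourier based norms -/

open Classical in
/-- The `L²(Σ)` Fourier transform, `∫ f(x) e^{-2πi ξ·x} dx` on integrable `f ∈ L²`, of a real valued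
square integrable function. -/
def hat {d : ℕ} (f : Cross d → ℝ) : Cross d → ℂ :=
  if hf : MemLp (fun x => (f x : ℂ)) 2 volume then
    ((𝓕 (hf.toLp) : Lp ℂ 2 (volume : Measure (Cross d))) : Cross d → ℂ)
  else 0

/-- `‖f‖²_{H^s(Σ)} = ∫ (1 + |ξ|²)^s |f̂(ξ)|² dξ`, for `f ∈ L²(Σ)`. -/
def sobolevSq {d : ℕ} (s : ℝ) (f : Cross d → ℝ) : ℝ≥0∞ :=
  ∫⁻ ξ, ENNReal.ofReal ((1 + ‖ξ‖ ^ 2) ^ s) * ‖hat f ξ‖ₑ ^ 2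

/-- `‖I_λ f‖²_{L²(Σ)} = ∫_{ξ ≠ 0} |ξ|^{-2λ} |f̂(ξ)|² dξ`, for `f ∈ L²(Σ)`. -/
def rieszSq {d : ℕ} (lam : ℝ) (f : Cross d → ℝ) : ℝ≥0∞ :=
  ∫⁻ ξ in {0}ᶜ, ENNReal.ofReal (‖ξ‖ ^ (-2 * lam)) * ‖hat f ξ‖ₑ ^ 2

/-- `‖u‖²_{H^s_x(L²_y)} = ∫_0^ℓ ∫ (1 + |ξ|²)^s |û(ξ, y)|² dξ dy`, for `u ∈ L²(Ω; ℝ^N)`. -/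
def vecSobolevSq {d : ℕ} {ℓ : ℝ} (s : ℝ) (u : VecL2 d ℓ) : ℝ≥0∞ :=
  ∑ j, ∫⁻ y in Ioo 0 ℓ, sobolevSq s (fun x => u (x, y) j)

/-- `‖I_λ u‖²_{L²(Ω)} = ∫_0^ℓ ∫_{ξ ≠ 0} |ξ|^{-2λ} |û(ξ, y)|² dξ dy`, for `u ∈ L²(Ω; ℝ^N)`. -/
def vecRieszSq {d : ℕ} {ℓ : ℝ} (lam : ℝ) (u : VecL2 d ℓ) : ℝ≥0∞ :=
  ∑ j, ∫⁻ y in Ioo 0 ℓ, rieszSq lam (fun x => u (x, y) j)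

/-- The symbol `μ(ξ) = g + σ (2π|ξ|)^{2r}` of `M = g + σ (-Δ)^r`. -/
def symbol {d : ℕ} (g σ r : ℝ) (ξ : Cross d) : ℝ := g + σ * (2 * Real.pi * ‖ξ‖) ^ (2 * r)

/-- `m = M(h)` for `h, m ∈ L²(Σ)`, where `M` is the Fourier multiplier with symbol `μ`. -/
def IsMultiplier {d : ℕ} (μ : Cross d → ℝ) (h m : SurfL2 d) : Prop :=
  ∀ᵐ ξ, hat m ξ = (μ ξ : ℂ) * hat h ξ

/-- The full energy `½ ∫_Ω |u|² + ½ ∫_Σ M(h) h`.  The second term is the quadratic form of `M`,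
`½ ∫ μ(ξ) |ĥ(ξ)|² dξ`; the value is `∞` if `h` is not in its form domain. -/
def energy {d : ℕ} {ℓ : ℝ} (μ : Cross d → ℝ) (u : VecL2 d ℓ) (h : SurfL2 d) : ℝ≥0∞ :=
  (∫⁻ z, ‖u z‖ₑ ^ 2 ∂(slab d ℓ)) / 2 + (∫⁻ ξ, ENNReal.ofReal (μ ξ) * ‖hat h ξ‖ₑ ^ 2) / 2

/-! ## Weak solutions -/

/-- `(u, h)` is a weak solution with initial data `(u₀, h₀)`, where `u'`, `h'` are the time
derivatives and `m = M(h)`.  As usual `u`, `h`, `u'`, `h'`, `m` are only determined for almost every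
time `t > 0`. -/
structure IsWeakSolutionWith (d : ℕ) (ℓ : ℝ) (μ : Cross d → ℝ) (u₀ : VecL2 d ℓ) (h₀ : SurfL2 d)
    (u : ℝ → Hel d ℓ) (h : ℝ → SurfL2 d)
    (u' : ℝ → (Hel d ℓ →L[ℝ] ℝ)) (h' m : ℝ → SurfL2 d) : Prop where
  /-- `u ∈ L²_loc([0,∞); Hel)` -/
  u_mem : ∀ T > 0, MemLp u 2 (volume.restrict (Ioo 0 T))
  /-- `∂_t u ∈ L²_loc([0,∞); Hel*)` -/
  u'_mem : ∀ T > 0, MemLp u' 2 (volume.restrict (Ioo 0 T))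
  /-- `h ∈ L²_loc([0,∞); L²(Σ))` -/
  h_mem : ∀ T > 0, MemLp h 2 (volume.restrict (Ioo 0 T))
  /-- `M(h) ∈ L²_loc([0,∞); L²(Σ))` -/
  m_mem : ∀ T > 0, MemLp m 2 (volume.restrict (Ioo 0 T))
  m_eq : ∀ᵐ t ∂(volume.restrict (Ioi (0 : ℝ))), IsMultiplier μ (h t) (m t)
  /-- `∂_t h ∈ L²_loc([0,∞); H^{1/2}(Σ))` -/
  h'_mem : ∀ T > 0, MemLp h' 2 (volume.restrict (Ioo 0 T)) ∧
    ∫⁻ t in Ioo 0 T, sobolevSq (1 / 2) (h' t) < ⊤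
  /-- `u'` is the weak time derivative of `u` under the embedding of `L²` fields into `Hel*` given by
  the `L²(Ω)` inner product, and the initial value of `u` is `u₀`. -/
  u_deriv : ∀ v : Hel d ℓ, ∀ᵐ t ∂(volume.restrict (Ioi (0 : ℝ))),
    inner ℝ (Hel.field (u t)) (Hel.field v) = inner ℝ u₀ (Hel.field v) + ∫ s in (0 : ℝ)..t, u' s v
  /-- The initial velocity, an `L²` limit of elements of `Hel`, lies in the `L²` closure of `Hel`. -/
  u₀_mem : u₀ ∈ closure (Set.range fun v : Hel d ℓ => Hel.field v)
  /-- `h'` is the weak time derivative of `h`, and the initial value of `h` is `h₀`. -/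
  h_deriv : ∀ᵐ t ∂(volume.restrict (Ioi (0 : ℝ))), h t = h₀ + ∫ s in (0 : ℝ)..t, h' s
  /-- `∂_t h = u_N` on `{y = ℓ}` -/
  kinematic : ∀ᵐ t ∂(volume.restrict (Ioi (0 : ℝ))), Hel.IsNormalTrace (u t) (h' t)
  /-- `[∂_t u, v] + ½ (𝔻u, 𝔻v) + ∫_{y = ℓ} M(h) v_N = 0` for all `v ∈ L²_T(Hel)` and a.e. `t`; in it
  `τ` is the trace of `v_N(t)` on `{y = ℓ}`. -/
  momentum : ∀ T > 0, ∀ v : ℝ → Hel d ℓ, MemLp v 2 (volume.restrict (Ioo 0 T)) →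
    ∀ᵐ t ∂(volume.restrict (Ioo 0 T)), ∀ τ : SurfL2 d, Hel.IsNormalTrace (v t) τ →
      u' t (v t) + (1 / 2) * symGradInner (u t) (v t) + ∫ x, m t x * τ x = 0

/-- `(u, h)` is a weak solution of the linearised problem in `Ω` with boundary operator `M` of symbol
`μ` and initial data `(u₀, h₀)`. -/
def IsWeakSolution (d : ℕ) (ℓ : ℝ) (μ : Cross d → ℝ) (u₀ : VecL2 d ℓ) (h₀ : SurfL2 d)
    (u : ℝ → Hel d ℓ) (h : ℝ → SurfL2 d) : Prop :=
  ∃ u' h' m, IsWeakSolutionWith d ℓ μ u₀ h₀ u h u' h' m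

end FracBoundaryNS

end

open scoped LineDeriv

noncomputable section

namespace FracBoundaryNS

/-! ### Product rule for indefinite Bochner integrals -/

section ProductRule

variable {V : Type*} [NormedAddCommGroup V] [InnerProductSpace ℝ V] [CompleteSpace V]

/-! The slab and the operator `M` are invariant under horizontal translations, so convolution in `x`
with an even kernel `k` maps solutions to solutions. The decay is proved separately in each dyadic
band `|ξ| ~ R = 2^j`, with constants uniform in `R`, and the bands are then summed.

In one band put `v = k * u` and let `J h` be the function `√μ φ ĥ`, where `φ = k̂`. The band energy
`(‖v‖² + ‖J h‖²) / 2` has derivative `-‖𝔻v‖² / 2`. A Korn–Poincaré inequality (`exists_korn`) bounds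
`‖v‖²` by this dissipation, but the surface part is not dissipated directly. It is recovered by
testing the equation with the solenoidal field `(χ' ∇f, -χ Δf)`, where `f = k * h` and the profile
`χ` equals `1` at the top and lives in a layer of width `ℓ / R'`, with `R' = max 1 R`
(`exists_testField`). Its normal trace `-Δf` turns the surface integral into a term bounded below by
`R² ‖J h‖²`. Adding a small multiple of the inner product of `v` with this field, scaled by `R'⁻²`,
to the energy gives a Lyapunov functional `L`, comparable with the energy, such that `L' ≤ -c ρ L`,
where `ρ = min(1, R'^(2r-1)) (R/R')²` is `rate r R` (`lyapunov_pointwise`, `exists_band_decay`).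

Thus `ρ = R²` for low frequencies, and `ρ = R^(-(1-2r)₊)` for high ones. The differential inequality
yields decay by `(1 + cρt/n)^(-n)` for every `n`, hence by a constant times `ρ^(-λ) (1+t)^(-λ)` as
soon as `n ≥ λ`. It remains to sum `ρ^(-λ)` times the initial band energies: below frequency one the
weight is dominated by `|ξ|^(-2λ)`, which is the hypothesis on `I_λ`, and above it by
`(1+|ξ|²)^(λ(1/2-r)₊)`, with an additional order `r` for `h₀` coming from the symbol `μ` in the
energy; these are the Sobolev hypotheses (`tsum_weighted_lt_top`).

Since `∂_t u` takes values only in a dual space, testing with the solution itself is justified by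
the Lions–Magenes theorem (`exists_continuous_representative`). It also gives the continuous
representative of `u`; that of `h` is the primitive of `∂_t h`. -/

theorem inner_integral_integral {f g : ℝ → V} {t : ℝ} (ht : 0 ≤ t)
    (hf : IntegrableOn f (Ioc 0 t)) (hg : IntegrableOn g (Ioc 0 t)) :
    inner ℝ (∫ s in (0 : ℝ)..t, f s) (∫ s in (0 : ℝ)..t, g s) =
      ∫ s in (0 : ℝ)..t, (inner ℝ (f s) (∫ τ in (0 : ℝ)..s, g τ)
        + inner ℝ (∫ τ in (0 : ℝ)..s, f τ) (g s)) := by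
  set μ := (volume : Measure ℝ).restrict (Ioc 0 t) with hμ
  have hK : Integrable (fun p : ℝ × ℝ => inner ℝ (f p.1) (g p.2)) (μ.prod μ) := by
    have h1 : AEStronglyMeasurable (fun p : ℝ × ℝ => inner ℝ (f p.1) (g p.2)) (μ.prod μ) :=
      hf.aestronglyMeasurable.comp_fst.inner hg.aestronglyMeasurable.comp_snd
    refine Integrable.mono' (hf.norm.mul_prod hg.norm) h1 (ae_of_all _ fun p => ?_)
    exact norm_inner_le_norm _ _
  -- The product of the integrals is a double integral over the square `(0, t]²`. Cut along the
  -- diagonal, its two triangles give the two summands.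
  have hm1 : MeasurableSet {p : ℝ × ℝ | p.2 ≤ p.1} := measurableSet_le measurable_snd measurable_fst
  have hm2 : MeasurableSet {p : ℝ × ℝ | p.1 < p.2} := measurableSet_lt measurable_fst measurable_snd
  have hK1 := hK.indicator hm1
  have hK2 := hK.indicator hm2
  have e0 : inner ℝ (∫ s, f s ∂μ) (∫ s, g s ∂μ) = ∫ p, inner ℝ (f p.1) (g p.2) ∂(μ.prod μ) := by
    rw [integral_prod _ hK]
    have : ∀ x, ∫ y, inner ℝ (f x) (g y) ∂μ = inner ℝ (f x) (∫ y, g y ∂μ) := fun x =>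
      integral_inner hg (f x)
    simp only [this]
    have h2 := integral_inner (𝕜 := ℝ) hf (∫ y, g y ∂μ)
    simp only [real_inner_comm] at h2 ⊢
    exact h2.symm
  have split : ∀ p : ℝ × ℝ, inner ℝ (f p.1) (g p.2)
      = {p : ℝ × ℝ | p.2 ≤ p.1}.indicator (fun p => inner ℝ (f p.1) (g p.2)) p
      + {p : ℝ × ℝ | p.1 < p.2}.indicator (fun p => inner ℝ (f p.1) (g p.2)) p := by
    intro p
    rcases le_or_gt p.2 p.1 with h | h
    · rw [indicator_of_mem (by exact h), indicator_of_notMem (by simpa using h), add_zero]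
    · rw [indicator_of_notMem (by simpa using h), indicator_of_mem (by exact h), zero_add]
  have c1 : ∀ᵐ s ∂μ, ∫ y, {p : ℝ × ℝ | p.2 ≤ p.1}.indicator (fun p => inner ℝ (f p.1) (g p.2)) (s, y) ∂μ
      = inner ℝ (f s) (∫ τ in (0 : ℝ)..s, g τ) := by
    filter_upwards [ae_restrict_mem measurableSet_Ioc] with s hs
    have : ∀ y, {p : ℝ × ℝ | p.2 ≤ p.1}.indicator (fun p => inner ℝ (f p.1) (g p.2)) (s, y)
        = inner ℝ (f s) ((Iic s).indicator g y) := by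
      intro y
      by_cases h : y ≤ s
      · rw [indicator_of_mem (by exact h), indicator_of_mem (by exact h)]
      · rw [indicator_of_notMem (by exact h), indicator_of_notMem (by exact h), inner_zero_right]
    simp only [this]
    rw [integral_inner (hg.indicator measurableSet_Iic), integral_indicator measurableSet_Iic,
      Measure.restrict_restrict measurableSet_Iic, intervalIntegral.integral_of_le hs.1.le]
    congr 3
    ext y; simp only [mem_inter_iff, mem_Iic, mem_Ioc]
    constructor
    · rintro ⟨a, b, c⟩; exact ⟨b, a⟩
    · rintro ⟨a, b⟩; exact ⟨b, a, b.trans hs.2⟩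
  have c2 : ∀ᵐ s ∂μ, ∫ y, {p : ℝ × ℝ | p.1 < p.2}.indicator (fun p => inner ℝ (f p.1) (g p.2)) (y, s) ∂μ
      = inner ℝ (∫ τ in (0 : ℝ)..s, f τ) (g s) := by
    filter_upwards [ae_restrict_mem measurableSet_Ioc] with s hs
    have : ∀ y, {p : ℝ × ℝ | p.1 < p.2}.indicator (fun p => inner ℝ (f p.1) (g p.2)) (y, s)
        = inner ℝ (g s) ((Iio s).indicator f y) := by
      intro y
      by_cases h : y < s
      · rw [indicator_of_mem (by exact h), indicator_of_mem (by exact h), real_inner_comm]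
      · rw [indicator_of_notMem (by exact h), indicator_of_notMem (by exact h), inner_zero_right]
    simp only [this]
    rw [integral_inner (hf.indicator measurableSet_Iio), integral_indicator measurableSet_Iio,
      Measure.restrict_restrict measurableSet_Iio, intervalIntegral.integral_of_le hs.1.le,
      real_inner_comm, integral_Ioc_eq_integral_Ioo]
    congr 3
    ext y; simp only [mem_inter_iff, mem_Iio, mem_Ioc, mem_Ioo]
    constructor
    · rintro ⟨a, b, c⟩; exact ⟨b, a⟩
    · rintro ⟨a, b⟩; exact ⟨b, a, b.le.trans hs.2⟩
  have i1 := (integral_prod _ hK1).trans (integral_congr_ae c1)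
  have i2 := (integral_prod_symm _ hK2).trans (integral_congr_ae c2)
  have j1 := hK1.integral_prod_left.congr c1
  have j2 := hK2.integral_prod_right.congr c2
  rw [intervalIntegral.integral_of_le ht, intervalIntegral.integral_of_le ht,
    intervalIntegral.integral_of_le ht, ← hμ, e0, integral_congr_ae (ae_of_all _ split),
    integral_add hK1 hK2, i1, i2, integral_add j1 j2]

/-- The product rule for two indefinite integrals. -/
theorem intervalIntegrable_inner {V : Type*} [NormedAddCommGroup V] [InnerProductSpace ℝ V] {f g : ℝ → V} {t : ℝ} (ht : 0 ≤ t) (hf : IntegrableOn f (Ioc 0 t))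
    (hg : ContinuousOn g (Icc 0 t)) :
    IntervalIntegrable (fun s => (inner ℝ (f s) (g s) : ℝ)) volume 0 t := by
  rw [intervalIntegrable_iff_integrableOn_Ioc_of_le ht]
  obtain ⟨C, hC⟩ := isCompact_Icc.exists_bound_of_continuousOn hg
  refine Integrable.mono' (hf.norm.mul_const C) (hf.aestronglyMeasurable.inner
    ((hg.mono Ioc_subset_Icc_self).aestronglyMeasurable measurableSet_Ioc)) ?_
  filter_upwards [ae_restrict_mem measurableSet_Ioc] with s hs
  exact (norm_inner_le_norm _ _).trans
    (mul_le_mul_of_nonneg_left (hC s (Ioc_subset_Icc_self hs)) (norm_nonneg _))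

/-- The genuinely bilinear part is `inner_integral_integral`; the initial values contribute only
terms linear in one integral. -/
theorem inner_add_integral {f g : ℝ → V} (a₀ b₀ : V) {t : ℝ} (ht : 0 ≤ t)
    (hf : IntegrableOn f (Ioc 0 t)) (hg : IntegrableOn g (Ioc 0 t)) :
    inner ℝ (a₀ + ∫ s in (0 : ℝ)..t, f s) (b₀ + ∫ s in (0 : ℝ)..t, g s) = inner ℝ a₀ b₀ +
      ∫ s in (0 : ℝ)..t, (inner ℝ (f s) (b₀ + ∫ τ in (0 : ℝ)..s, g τ)
        + inner ℝ (a₀ + ∫ τ in (0 : ℝ)..s, f τ) (g s)) := by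
  have cont : ∀ {f : ℝ → V}, IntegrableOn f (Ioc 0 t) →
      ContinuousOn (fun s => ∫ τ in (0 : ℝ)..s, f τ) (Icc 0 t) := by
    intro f hf
    have h1 : IntegrableOn f (uIcc 0 t) := by
      rw [uIcc_of_le ht, integrableOn_Icc_iff_integrableOn_Ioc]; exact hf
    simpa [uIcc_of_le ht] using intervalIntegral.continuousOn_primitive_interval h1
  have hf0 : IntervalIntegrable f volume 0 t := (intervalIntegrable_iff_integrableOn_Ioc_of_le ht).2 hf
  have hg0 : IntervalIntegrable g volume 0 t := (intervalIntegrable_iff_integrableOn_Ioc_of_le ht).2 hg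
  have e1 : ∫ s in (0 : ℝ)..t, inner ℝ (f s) b₀ = inner ℝ (∫ s in (0 : ℝ)..t, f s) b₀ := by
    have := ((innerSL ℝ b₀).intervalIntegral_comp_comm hf0)
    simp only [innerSL_apply_apply] at this
    simp only [real_inner_comm b₀]
    exact this
  have e2 : ∫ s in (0 : ℝ)..t, inner ℝ a₀ (g s) = inner ℝ a₀ (∫ s in (0 : ℝ)..t, g s) := by
    have := ((innerSL ℝ a₀).intervalIntegral_comp_comm hg0)
    simpa only [innerSL_apply_apply] using this
  have k1 := intervalIntegrable_inner ht hf (continuousOn_const (c := b₀))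
  have k2 := intervalIntegrable_inner ht hf (cont hg)
  have k3 : IntervalIntegrable (fun s => inner ℝ a₀ (g s)) volume 0 t := by
    simpa only [real_inner_comm] using intervalIntegrable_inner ht hg (continuousOn_const (c := a₀))
  have k4 : IntervalIntegrable (fun s => inner ℝ (∫ τ in (0 : ℝ)..s, f τ) (g s)) volume 0 t := by
    simpa only [real_inner_comm] using intervalIntegrable_inner ht hg (cont hf)
  have expand : ∀ s, (inner ℝ (f s) (b₀ + ∫ τ in (0 : ℝ)..s, g τ)
        + inner ℝ (a₀ + ∫ τ in (0 : ℝ)..s, f τ) (g s))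
      = (inner ℝ (f s) b₀ + inner ℝ a₀ (g s)) + (inner ℝ (f s) (∫ τ in (0 : ℝ)..s, g τ)
        + inner ℝ (∫ τ in (0 : ℝ)..s, f τ) (g s)) := by
    intro s; rw [inner_add_right, inner_add_left]; ring
  simp only [expand]
  rw [intervalIntegral.integral_add (k1.add k3) (k2.add k4),
    intervalIntegral.integral_add k1 k3, e1, e2, ← inner_integral_integral ht hf hg,
    inner_add_left, inner_add_right, inner_add_right]
  ring

end ProductRule

/-! ### Decay from an integrated differential inequality -/

section Decay

/-- An implicit Euler argument: `L` is nonincreasing, so its integral over a step of length `t / n`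
is at least `t / n` times the final value, and each of the `n` steps divides `L` by at least `1 + c
t / n`. Polynomial decay of arbitrary order suffices later, so no exponential is needed. -/
theorem le_div_pow_of_le_sub_integral {L : ℝ → ℝ} {c : ℝ} (hc : 0 ≤ c)
    (hcont : ContinuousOn L (Ici 0)) (hpos : ∀ t, 0 ≤ t → 0 ≤ L t)
    (h : ∀ s t, 0 ≤ s → s ≤ t → L t ≤ L s - c * ∫ τ in s..t, L τ) {t : ℝ} (ht : 0 ≤ t) {n : ℕ}
    (hn : 0 < n) : L t ≤ L 0 / (1 + c * t / n) ^ n := by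
  have anti : ∀ s t, 0 ≤ s → s ≤ t → L t ≤ L s := by
    intro s t hs hst
    have : 0 ≤ ∫ τ in s..t, L τ := intervalIntegral.integral_nonneg hst fun τ hτ =>
      hpos τ (hs.trans hτ.1)
    nlinarith [h s t hs hst, mul_nonneg hc this]
  have step : ∀ s t, 0 ≤ s → s ≤ t → L t * (1 + c * (t - s)) ≤ L s := by
    intro s t hs hst
    have h1 : (t - s) * L t ≤ ∫ τ in s..t, L τ := by
      have h2 : IntervalIntegrable L volume s t := by
        refine ContinuousOn.intervalIntegrable (hcont.mono ?_)
        rw [uIcc_of_le hst]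
        exact fun x hx => hs.trans hx.1
      have := intervalIntegral.integral_mono_on hst (intervalIntegrable_const (c := L t)) h2
        fun x hx => anti x t (hs.trans hx.1) hx.2
      simpa using this
    nlinarith [h s t hs hst, mul_le_mul_of_nonneg_left h1 hc]
  have hn' : (0 : ℝ) < n := by exact_mod_cast hn
  have hpos1 : 0 < 1 + c * t / n := by positivity
  have key : ∀ k : ℕ, L (k * (t / n)) * (1 + c * t / n) ^ k ≤ L 0 := by
    intro k
    induction k with
    | zero => simp
    | succ k ih =>
      have h0 : 0 ≤ (k : ℝ) * (t / n) := by positivity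
      have := step (k * (t / n)) ((k + 1 : ℕ) * (t / n)) h0
        (by push_cast; nlinarith [div_nonneg ht hn'.le])
      have e : 1 + c * (((k + 1 : ℕ) : ℝ) * (t / n) - k * (t / n)) = 1 + c * t / n := by
        push_cast; ring
      rw [e] at this
      calc _ = (L ((k + 1 : ℕ) * (t / n)) * (1 + c * t / n)) * (1 + c * t / n) ^ k := by ring
        _ ≤ L (k * (t / n)) * (1 + c * t / n) ^ k := by gcongr
        _ ≤ L 0 := ih
  have := key n
  rw [mul_div_cancel₀ _ hn'.ne'] at this
  rwa [le_div_iff₀ (by positivity)]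

end Decay

/-! ### The Lions–Magenes theorem by resolvent regularisation -/

section LionsMagenes

variable {V H : Type*} [NormedAddCommGroup V] [InnerProductSpace ℝ V] [CompleteSpace V]
  [NormedAddCommGroup H] [InnerProductSpace ℝ H] [CompleteSpace H]

local postfix:max "†" => ContinuousLinearMap.adjoint

/-- Lax–Milgram: positivity of `A` makes `A + ε` coercive with constant `ε`. -/
theorem exists_resolvent (A : V →L[ℝ] V) (hsym : ∀ v w, inner ℝ (A v) w = inner ℝ v (A w))
    (hpos : ∀ v, 0 ≤ inner ℝ (A v) v) {ε : ℝ} (hε : 0 < ε) :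
    ∃ S : V →L[ℝ] V, (∀ v, A (S v) + ε • S v = v) ∧ (∀ v, S (A v) + ε • S v = v) ∧
      ∀ v w, inner ℝ (S v) w = inner ℝ v (S w) := by
  set B : V →L[ℝ] V →L[ℝ] ℝ := (innerSL ℝ).comp (A + ε • ContinuousLinearMap.id ℝ V) with hB
  have hBapp : ∀ v w, B v w = inner ℝ (A v + ε • v) w := fun v w => rfl
  have hco : IsCoercive B := by
    refine ⟨ε, hε, fun u => ?_⟩
    rw [hBapp, inner_add_left, real_inner_smul_left, real_inner_self_eq_norm_sq]
    nlinarith [hpos u]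
  set T := hco.continuousLinearEquivOfBilin with hT
  have hTapp : ∀ v, T v = A v + ε • v := fun v => by
    refine ext_inner_right ℝ fun w => ?_
    rw [hT, IsCoercive.continuousLinearEquivOfBilin_apply, hBapp]
  have h1 : ∀ v, A (T.symm v) + ε • T.symm v = v := fun v => by
    rw [← hTapp, T.apply_symm_apply]
  have h2 : ∀ v, T.symm (A v) + ε • T.symm v = v := fun v => by
    rw [← map_smul, ← map_add, ← hTapp, T.symm_apply_apply]
  refine ⟨T.symm, h1, h2, fun v w => ?_⟩
  change inner ℝ (T.symm v) w = inner ℝ v (T.symm w)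
  conv_lhs => rw [← h1 w]
  conv_rhs => rw [← h1 v]
  rw [inner_add_left, inner_add_right, hsym, real_inner_smul_left, real_inner_smul_right]

/-- `S n` is the resolvent `(A + ε n)⁻¹` of `A = ι† ι` with `ε n = 1 / (n + 1)`. It is symmetric and
commutes with `A`; moreover `S n A` is an approximate identity on `V`, and `ι S n ι†` is one on the
closure of `range ι`. These are the mollifiers for the chain rule. -/
theorem exists_approx_inverse (ι : V →L[ℝ] H) (hι : Function.Injective ι) :
    ∃ S : ℕ → V →L[ℝ] V, (∀ n v w, inner ℝ (S n v) w = inner ℝ v (S n w)) ∧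
      (∀ n v, S n (ι† (ι v)) = ι† (ι (S n v))) ∧
      (∀ n v, ‖v - S n (ι† (ι v))‖ ≤ ‖v‖) ∧
      (∀ v, Tendsto (fun n => S n (ι† (ι v))) atTop (𝓝 v)) ∧
      ∀ h ∈ closure (range ι), Tendsto (fun n => ι (S n (ι† h))) atTop (𝓝 h) := by
  set A : V →L[ℝ] V := ι†.comp ι with hA
  have hAapp : ∀ v, A v = ι† (ι v) := fun v => rfl
  have hAin : ∀ v w, inner ℝ (A v) w = inner ℝ (ι v) (ι w) := fun v w => by
    rw [hAapp, ContinuousLinearMap.adjoint_inner_left]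
  have hsym : ∀ v w, inner ℝ (A v) w = inner ℝ v (A w) := fun v w => by
    rw [hAin, hAapp, ContinuousLinearMap.adjoint_inner_right]
  have hpos : ∀ v, 0 ≤ inner ℝ (A v) v := fun v => by
    rw [hAin]; exact real_inner_self_nonneg
  set ε : ℕ → ℝ := fun n => 1 / ((n : ℝ) + 1) with hεdef
  have hε : ∀ n, 0 < ε n := fun n => by positivity
  have hε0 : Tendsto ε atTop (𝓝 0) := tendsto_one_div_add_atTop_nhds_zero_nat
  choose S hS1 hS2 hS3 using fun n => exists_resolvent A hsym hpos (hε n)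
  have hpsd : ∀ n v, 0 ≤ inner ℝ (A (S n v)) (S n v) := fun n v => hpos _
  have hbound : ∀ n v, ε n * ‖S n v‖ ≤ ‖v‖ := by
    intro n v
    have h1 : ε n * (‖S n v‖ * ‖S n v‖) ≤ ‖v‖ * ‖S n v‖ := by
      calc _ ≤ inner ℝ (A (S n v)) (S n v) + ε n * (‖S n v‖ * ‖S n v‖) := by
            linarith [hpsd n v]
        _ = inner ℝ (A (S n v) + ε n • S n v) (S n v) := by
            rw [inner_add_left, real_inner_smul_left, real_inner_self_eq_norm_mul_norm]
        _ = inner ℝ v (S n v) := by rw [hS1]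
        _ ≤ _ := real_inner_le_norm _ _
    rcases (norm_nonneg (S n v)).eq_or_lt with h | h
    · rw [← h]; simp
    · nlinarith
  have hK : ∀ n v, v - S n (A v) = ε n • S n v := fun n v => by
    rw [sub_eq_iff_eq_add']; exact (hS2 n v).symm
  have hKle : ∀ n v, ‖v - S n (A v)‖ ≤ ‖v‖ := fun n v => by
    rw [hK, norm_smul, Real.norm_of_nonneg (hε n).le]; exact hbound n v
  -- A vector orthogonal to `range A` satisfies `‖ι x‖² = 0`, hence vanishes by injectivity.
  have hdense : Dense (range A) := by
    have h1 : ((LinearMap.range (A : V →ₗ[ℝ] V)).topologicalClosure) = ⊤ := by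
      rw [Submodule.topologicalClosure_eq_top_iff, Submodule.eq_bot_iff]
      intro x hx
      have h2 := (Submodule.mem_orthogonal _ _).1 hx (A x) ⟨x, rfl⟩
      have h5 : inner ℝ (ι x) (ι x) = (0 : ℝ) := by rw [← hAin]; exact h2
      exact hι (by rw [inner_self_eq_zero.1 h5, map_zero])
    have h2 := congrArg (fun K : Submodule ℝ V => (K : Set V)) h1
    rw [dense_iff_closure_eq]
    exact h2
  have hconv : ∀ v, Tendsto (fun n => S n (A v)) atTop (𝓝 v) := by
    intro v
    rw [Metric.tendsto_atTop]
    intro δ hδ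
    obtain ⟨_, hw, ⟨w, rfl⟩⟩ := Metric.dense_iff.1 hdense v (δ / 2) (by positivity)
    obtain ⟨N, hN⟩ := (Metric.tendsto_atTop.1 (hε0.mul_const ‖w‖)) (δ / 2) (by positivity)
    refine ⟨N, fun n hn => ?_⟩
    have hN' := hN n hn
    rw [zero_mul, Real.dist_eq, sub_zero, abs_of_nonneg (by have := hε n; positivity)] at hN'
    rw [Metric.mem_ball, dist_comm, dist_eq_norm] at hw
    rw [dist_comm, dist_eq_norm]
    -- The error operator `v ↦ v - S n (A v)` is a contraction, and on `A w` it equals `ε n • A (S n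
    -- w)`, of norm at most `ε n ‖w‖`. Density of `range A` then gives convergence everywhere.
    have e : v - S n (A v) = ((v - A w) - S n (A (v - A w))) + ε n • (w - ε n • S n w) := by
      have h1 : A w - S n (A (A w)) = ε n • (w - ε n • S n w) := by
        rw [hK]
        congr 1
        rw [eq_sub_iff_add_eq]; exact hS2 n w
      rw [← h1]; simp only [map_sub]; abel
    have h2 : ‖w - ε n • S n w‖ ≤ ‖w‖ := by
      have h3 : w - ε n • S n w = A (S n w) := by
        rw [sub_eq_iff_eq_add]; exact (hS1 n w).symm
      have h4 : inner ℝ (A (S n w)) (A (S n w)) ≤ ‖w‖ * ‖A (S n w)‖ := by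
        have h5 : inner ℝ (A (S n w)) (A (S n w)) + ε n * inner ℝ (A (S n w)) (S n w)
            = inner ℝ w (A (S n w)) := by
          conv_rhs => rw [← hS1 n w]
          rw [inner_add_left, real_inner_smul_left]
          rw [hS1 n w, real_inner_comm (S n w) (A (S n w))]
        have h6 := real_inner_le_norm w (A (S n w))
        nlinarith [mul_nonneg (hε n).le (hpsd n w)]
      rw [h3]
      rw [real_inner_self_eq_norm_mul_norm] at h4
      rcases (norm_nonneg (A (S n w))).eq_or_lt with h | h
      · rw [← h]; positivity
      · nlinarith
    calc ‖v - S n (A v)‖ ≤ ‖v - A w‖ + ε n * ‖w‖ := by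
          rw [e]
          refine (norm_add_le _ _).trans (add_le_add (hKle n _) ?_)
          rw [norm_smul, Real.norm_of_nonneg (hε n).le]
          exact mul_le_mul_of_nonneg_left h2 (hε n).le
      _ < δ := by linarith
  have hcomm : ∀ n v, S n (A v) = A (S n v) := fun n v => by
    have := (hS2 n v).trans (hS1 n v).symm
    exact add_right_cancel this
  -- Pairing the resolvent equation for `ι† h` with its solution shows that `ι S n ι†` is a
  -- contraction of `H`.
  have hQ : ∀ n h, ‖ι (S n (ι† h))‖ ≤ ‖h‖ := by
    intro n h
    have h1 : ‖ι (S n (ι† h))‖ * ‖ι (S n (ι† h))‖ ≤ ‖h‖ * ‖ι (S n (ι† h))‖ := by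
      rw [← real_inner_self_eq_norm_mul_norm, ← hAin]
      have h2 : inner ℝ (A (S n (ι† h))) (S n (ι† h)) + ε n * (‖S n (ι† h)‖ * ‖S n (ι† h)‖)
          = inner ℝ h (ι (S n (ι† h))) := by
        rw [← ContinuousLinearMap.adjoint_inner_left ι (S n (ι† h)), ← real_inner_self_eq_norm_mul_norm,
          ← real_inner_smul_left, ← inner_add_left, hS1]
      have h3 := real_inner_le_norm h (ι (S n (ι† h)))
      nlinarith [mul_nonneg (hε n).le (mul_self_nonneg ‖S n (ι† h)‖)]
    rcases (norm_nonneg (ι (S n (ι† h)))).eq_or_lt with h' | h'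
    · rw [← h']; positivity
    · nlinarith
  refine ⟨S, hS3, hcomm, hKle, hconv, fun h hh => ?_⟩
  rw [Metric.tendsto_atTop]
  intro δ hδ
  obtain ⟨_, ⟨v, rfl⟩, hv⟩ := Metric.mem_closure_iff.1 hh (δ / 3) (by positivity)
  have hc := ((ι.continuous.tendsto v).comp (hconv v))
  obtain ⟨N, hN⟩ := Metric.tendsto_atTop.1 hc (δ / 3) (by positivity)
  refine ⟨N, fun n hn => ?_⟩
  have h1 := hN n hn
  have h2 : dist (ι (S n (ι† h))) (ι (S n (ι† (ι v)))) ≤ dist h (ι v) := by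
    rw [dist_eq_norm, dist_eq_norm, ← map_sub, ← map_sub, ← map_sub]
    exact hQ n _
  have h3 : dist (ι (S n (ι† (ι v)))) (ι v) < δ / 3 := h1
  calc _ ≤ dist (ι (S n (ι† h))) (ι (S n (ι† (ι v)))) + dist (ι (S n (ι† (ι v)))) (ι v)
        + dist (ι v) h := dist_triangle4 _ _ _ _
    _ < δ := by rw [dist_comm (ι v) h]; linarith

theorem memLp_Ioc {E : Type*} [NormedAddCommGroup E] {f : ℝ → E}
    (hf : ∀ T > 0, MemLp f 2 (volume.restrict (Ioo 0 T))) {T : ℝ} (hT : 0 ≤ T) :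
    MemLp f 2 (volume.restrict (Ioc 0 T)) :=
  (hf (T + 1) (by linarith)).mono_measure
    (Measure.restrict_mono (fun x (hx : x ∈ Ioc 0 T) => show x ∈ Ioo 0 (T + 1) from
      ⟨hx.1, hx.2.trans_lt (by linarith)⟩) le_rfl)

theorem integrableOn_Ioc {E : Type*} [NormedAddCommGroup E] {f : ℝ → E}
    (hf : ∀ T > 0, MemLp f 2 (volume.restrict (Ioo 0 T))) {T : ℝ} (hT : 0 ≤ T) :
    IntegrableOn f (Ioc 0 T) :=
  (memLp_Ioc hf hT).integrable one_le_two

theorem continuousOn_primitive {E : Type*} [NormedAddCommGroup E] [NormedSpace ℝ E] [CompleteSpace E]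
    {f : ℝ → E} (hf : ∀ T > 0, MemLp f 2 (volume.restrict (Ioo 0 T))) :
    ContinuousOn (fun t => ∫ s in (0 : ℝ)..t, f s) (Ici 0) := by
  intro t ht
  have ht' : (0 : ℝ) ≤ t + 1 := by have : (0 : ℝ) ≤ t := ht; linarith
  have h1 : IntegrableOn f (uIcc 0 (t + 1)) := by
    rw [uIcc_of_le ht', integrableOn_Icc_iff_integrableOn_Ioc]; exact integrableOn_Ioc hf ht'
  have h2 := intervalIntegral.continuousOn_primitive_interval h1
  rw [uIcc_of_le ht'] at h2
  refine (h2 t ⟨ht, by linarith⟩).mono_of_mem_nhdsWithin ?_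
  rw [← Ici_inter_Iic]
  exact inter_mem self_mem_nhdsWithin (mem_nhdsWithin_of_mem_nhds (Iic_mem_nhds (by linarith)))

theorem ae_uIoc_of_ae_Ioi {p : ℝ → Prop} (h : ∀ᵐ t ∂(volume.restrict (Ioi (0 : ℝ))), p t) {t : ℝ}
    (ht : 0 ≤ t) : ∀ᵐ s, s ∈ Set.uIoc 0 t → p s := by
  rw [ae_restrict_iff' measurableSet_Ioi] at h
  filter_upwards [h] with s hs hst
  rw [uIoc_of_le ht] at hst
  exact hs hst.1

/-- Lions–Magenes: a function `u ∈ L²_loc(V)` whose image under `ι : V → H` has a weak time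
derivative in `L²_loc(V*)` (here represented by `f`) has a representative in `C([0,∞); H)`. -/
theorem exists_continuous_representative (ι : V →L[ℝ] H) (hι : Function.Injective ι)
    {u f : ℝ → V} {u₀ : H} (hu : ∀ T > 0, MemLp u 2 (volume.restrict (Ioo 0 T)))
    (hf : ∀ T > 0, MemLp f 2 (volume.restrict (Ioo 0 T))) (hu₀ : u₀ ∈ closure (range ι))
    (heq : ∀ᵐ t ∂(volume.restrict (Ioi (0 : ℝ))), ι† (ι (u t)) = ι† u₀ + ∫ s in (0 : ℝ)..t, f s) :
    ∃ U : ℝ → H, ContinuousOn U (Ici 0) ∧ U 0 = u₀ ∧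
      (∀ᵐ t ∂(volume.restrict (Ioi (0 : ℝ))), U t = ι (u t)) ∧
      (∀ t, 0 ≤ t → ι† (U t) = ι† u₀ + ∫ s in (0 : ℝ)..t, f s) ∧
      ∀ t, 0 ≤ t → ‖U t‖ ^ 2 = ‖u₀‖ ^ 2 + 2 * ∫ s in (0 : ℝ)..t, inner ℝ (f s) (u s) := by
  obtain ⟨S, hSsym, hScomm, hSle, hSlim, hSclos⟩ := exists_approx_inverse ι hι
  -- The path `a` is continuous in `V` and equals `ι† ι u` almost everywhere. The representative `U`
  -- is to solve `ι† U = a`; it is built as the limit of `ι (S n a)`.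
  set a : ℝ → V := fun t => ι† u₀ + ∫ s in (0 : ℝ)..t, f s with ha
  have ha0 : a 0 = ι† u₀ := by simp [ha]
  have hacont : ContinuousOn a (Ici 0) := continuousOn_const.add (continuousOn_primitive hf)
  have hquad : ∀ D : V →L[ℝ] V, (∀ v w, inner ℝ (D v) w = inner ℝ v (D w)) → ∀ t, 0 ≤ t →
      inner ℝ (a t) (D (a t)) = inner ℝ (a 0) (D (a 0))
        + 2 * ∫ s in (0 : ℝ)..t, inner ℝ (f s) (D (ι† (ι (u s)))) := by
    intro D hD t ht
    have hfi := integrableOn_Ioc hf ht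
    have hDa : ∀ s, 0 ≤ s → D (ι† u₀) + ∫ τ in (0 : ℝ)..s, D (f τ) = D (a s) := by
      intro s hs
      rw [D.intervalIntegral_comp_comm
        ((intervalIntegrable_iff_integrableOn_Ioc_of_le hs).2 (integrableOn_Ioc hf hs)), ← map_add]
    have h1 := inner_add_integral (ι† u₀) (D (ι† u₀)) ht hfi (D.integrable_comp hfi)
    rw [hDa t ht] at h1
    rw [ha0]
    refine h1.trans ?_
    rw [← intervalIntegral.integral_const_mul]
    congr 1
    refine intervalIntegral.integral_congr_ae ?_
    filter_upwards [ae_uIoc_of_ae_Ioi heq ht] with s hs hst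
    have hs0 : 0 ≤ s := by rw [uIoc_of_le ht] at hst; exact hst.1.le
    rw [hDa s hs0, hs hst]
    change inner ℝ (f s) (D (a s)) + inner ℝ (a s) (D (f s)) = 2 * inner ℝ (f s) (D (a s))
    rw [← hD, real_inner_comm]; ring
  set k : ℕ → ℝ → ℝ := fun n s => ‖u s - S n (ι† (ι (u s)))‖ with hk
  have hfk : ∀ n t, 0 ≤ t → IntegrableOn (fun s => ‖f s‖ * k n s) (Ioc 0 t) := by
    intro n t ht
    have h1 : MemLp (fun s => u s - S n (ι† (ι (u s)))) 2 (volume.restrict (Ioc 0 t)) :=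
      (ContinuousLinearMap.id ℝ V - (S n).comp ((ι†).comp ι)).comp_memLp' (memLp_Ioc hu ht)
    exact (memLp_Ioc hf ht).norm.integrable_mul h1.norm
  set r : ℕ → ℝ → ℝ := fun n t => ∫ s in (0 : ℝ)..t, ‖f s‖ * k n s with hr
  have hfu : ∀ t, 0 ≤ t → IntegrableOn (fun s => ‖f s‖ * ‖u s‖) (Ioc 0 t) := fun t ht =>
    (memLp_Ioc hf ht).norm.integrable_mul (memLp_Ioc hu ht).norm
  have hr0 : ∀ t, 0 ≤ t → Tendsto (fun n => r n t) atTop (𝓝 0) := by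
    intro t ht
    have := tendsto_integral_of_dominated_convergence (μ := volume.restrict (Ioc 0 t))
      (F := fun n s => ‖f s‖ * k n s) (f := fun _ => (0 : ℝ)) (fun s => ‖f s‖ * ‖u s‖)
      (fun n => (hfk n t ht).aestronglyMeasurable) (hfu t ht)
      (fun n => ae_of_all _ fun s => by
        rw [Real.norm_of_nonneg (by positivity)]
        exact mul_le_mul_of_nonneg_left (hSle n _) (norm_nonneg _))
      (ae_of_all _ fun s => by
        have h1 := ((tendsto_const_nhds (x := u s)).sub (hSlim (u s))).norm.const_mul ‖f s‖
        simpa using h1)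
    simpa [hr, intervalIntegral.integral_of_le ht] using this
  have hrmono : ∀ n s t, 0 ≤ s → s ≤ t → r n s ≤ r n t := by
    intro n s t hs hst
    simp only [hr, intervalIntegral.integral_of_le hs, intervalIntegral.integral_of_le (hs.trans hst)]
    exact setIntegral_mono_set (hfk n t (hs.trans hst)) (ae_of_all _ fun x => by positivity)
      (Ioc_subset_Ioc_right hst).eventuallyLE
  set q : ℕ → ℝ := fun n => ‖ι (S n (ι† u₀)) - u₀‖ with hq
  have hq0 : Tendsto q atTop (𝓝 0) := by
    have := (hSclos u₀ hu₀).sub_const u₀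
    simpa using this.norm
  set δ : ℕ → ℝ → ℝ := fun n t => 2 * q n ^ 2 + 4 * r n t with hδ
  have hδ0 : ∀ t, 0 ≤ t → Tendsto (fun n => δ n t) atTop (𝓝 0) := by
    intro t ht
    have := ((hq0.pow 2).const_mul 2).add ((hr0 t ht).const_mul 4)
    simpa using this
  -- The product rule is applied to `⟨a, D a⟩` with `D = E ι† ι E` and `E = S n - S m`, a form equal
  -- to `‖ι (E a)‖²`. The integrand is small because `E ι† ι u` is a difference of two approximation
  -- errors. As `r n` is monotone in time, the resulting convergence is locally uniform.
  have hdiff : ∀ n m t, 0 ≤ t → ‖ι (S n (a t)) - ι (S m (a t))‖ ^ 2 ≤ δ n t + δ m t := by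
    intro n m t ht
    set E : V →L[ℝ] V := S n - S m with hE
    have hEsym : ∀ v w, inner ℝ (E v) w = inner ℝ v (E w) := fun v w => by
      simp only [hE, sub_apply, inner_sub_left, inner_sub_right, hSsym]
    have hA : ∀ v w : V, inner ℝ (ι† (ι v)) w = inner ℝ v (ι† (ι w)) := fun v w => by
      rw [ContinuousLinearMap.adjoint_inner_left, ContinuousLinearMap.adjoint_inner_right]
    set D : V →L[ℝ] V := E.comp ((ι†).comp (ι.comp E)) with hD
    have hDapp : ∀ v, D v = E (ι† (ι (E v))) := fun v => rfl
    have hDsym : ∀ v w, inner ℝ (D v) w = inner ℝ v (D w) := fun v w => by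
      rw [hDapp, hDapp, hEsym, hA, hEsym]
    have hDq : ∀ v, inner ℝ v (D v) = ‖ι (S n v) - ι (S m v)‖ ^ 2 := fun v => by
      rw [hDapp, ← hEsym, ContinuousLinearMap.adjoint_inner_right, real_inner_self_eq_norm_sq,
        hE, sub_apply, map_sub]
    have h1 := hquad D hDsym t ht
    rw [hDq, hDq, ha0] at h1
    rw [h1]
    have hb1 : ‖ι (S n (ι† u₀)) - ι (S m (ι† u₀))‖ ^ 2 ≤ 2 * q n ^ 2 + 2 * q m ^ 2 := by
      have h2 : ‖ι (S n (ι† u₀)) - ι (S m (ι† u₀))‖ ≤ q n + q m := by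
        rw [hq]
        exact (norm_sub_le_norm_sub_add_norm_sub _ u₀ _).trans (by rw [norm_sub_rev u₀])
      nlinarith [norm_nonneg (ι (S n (ι† u₀)) - ι (S m (ι† u₀))), sq_nonneg (q n - q m)]
    have hEA : ∀ v, ‖E (ι† (ι v))‖ ≤ ‖v - S n (ι† (ι v))‖ + ‖v - S m (ι† (ι v))‖ := by
      intro v
      have : E (ι† (ι v)) = (v - S m (ι† (ι v))) - (v - S n (ι† (ι v))) := by
        simp [hE]
      rw [this, add_comm]; exact norm_sub_le _ _
    have hb2 : ∫ s in (0 : ℝ)..t, inner ℝ (f s) (D (ι† (ι (u s)))) ≤ 2 * (r n t + r m t) := by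
      have hDu : ∀ s, D (ι† (ι (u s))) = E (ι† (ι (E (ι† (ι (u s)))))) := fun s => rfl
      have hpt : ∀ s, inner ℝ (f s) (D (ι† (ι (u s)))) ≤ 2 * (‖f s‖ * k n s + ‖f s‖ * k m s) := by
        intro s
        have h3 : ‖D (ι† (ι (u s)))‖ ≤ 2 * (k n s + k m s) := by
          rw [hDu]
          have h4 := hEA (E (ι† (ι (u s))))
          have h5 := hSle n (E (ι† (ι (u s))))
          have h6 := hSle m (E (ι† (ι (u s))))
          have h7 := hEA (u s)
          simp only [hk]; linarith
        calc _ ≤ ‖f s‖ * ‖D (ι† (ι (u s)))‖ := real_inner_le_norm _ _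
          _ ≤ ‖f s‖ * (2 * (k n s + k m s)) := mul_le_mul_of_nonneg_left h3 (norm_nonneg _)
          _ = _ := by ring
      have hint : IntegrableOn (fun s => inner ℝ (f s) (D (ι† (ι (u s))))) (Ioc 0 t) := by
        have : MemLp (fun s => D (ι† (ι (u s)))) 2 (volume.restrict (Ioc 0 t)) :=
          (D.comp ((ι†).comp ι)).comp_memLp' (memLp_Ioc hu ht)
        refine Integrable.mono' ((memLp_Ioc hf ht).norm.integrable_mul this.norm)
          ((memLp_Ioc hf ht).aestronglyMeasurable.inner this.aestronglyMeasurable)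
          (ae_of_all _ fun s => norm_inner_le_norm _ _)
      simp only [hr, intervalIntegral.integral_of_le ht]
      rw [← integral_add (hfk n t ht) (hfk m t ht), ← integral_const_mul]
      exact integral_mono hint (((hfk n t ht).add (hfk m t ht)).const_mul 2) hpt
    simp only [hδ]; linarith
  have hcau : ∀ t, 0 ≤ t → CauchySeq fun n => ι (S n (a t)) := by
    intro t ht
    rw [Metric.cauchySeq_iff']
    intro ε hε
    have h1 := (hδ0 t ht).eventually (gt_mem_nhds (show (0 : ℝ) < ε ^ 2 / 2 by positivity))
    obtain ⟨N, hN⟩ := eventually_atTop.1 h1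
    refine ⟨N, fun n hn => ?_⟩
    rw [dist_eq_norm]
    refine lt_of_pow_lt_pow_left₀ 2 hε.le ?_
    linarith [hdiff n N t ht, hN n hn, hN N le_rfl]
  have hex : ∀ t, ∃ x : H, 0 ≤ t → Tendsto (fun n => ι (S n (a t))) atTop (𝓝 x) := by
    intro t
    by_cases ht : 0 ≤ t
    · obtain ⟨x, hx⟩ := cauchySeq_tendsto_of_complete (hcau t ht)
      exact ⟨x, fun _ => hx⟩
    · exact ⟨0, fun h => absurd h ht⟩
  choose U hU using hex
  have hunif : ∀ n t, 0 ≤ t → ‖ι (S n (a t)) - U t‖ ^ 2 ≤ δ n t := by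
    intro n t ht
    have h1 : Tendsto (fun m => ‖ι (S n (a t)) - ι (S m (a t))‖ ^ 2) atTop
        (𝓝 (‖ι (S n (a t)) - U t‖ ^ 2)) := ((tendsto_const_nhds.sub (hU t ht)).norm).pow 2
    have h2 : Tendsto (fun m => δ n t + δ m t) atTop (𝓝 (δ n t)) := by
      simpa using (tendsto_const_nhds (x := δ n t)).add (hδ0 t ht)
    exact le_of_tendsto_of_tendsto' h1 h2 fun m => hdiff n m t ht
  refine ⟨U, ?_, ?_, ?_, ?_, ?_⟩
  · intro t ht
    have ht0 : (0 : ℝ) ≤ t := ht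
    have hsub : Icc 0 (t + 1) ∈ 𝓝[Ici 0] t := by
      rw [← Ici_inter_Iic]
      exact inter_mem self_mem_nhdsWithin (mem_nhdsWithin_of_mem_nhds (Iic_mem_nhds (by linarith)))
    have hun : TendstoUniformlyOn (fun n s => ι (S n (a s))) U atTop (Icc 0 (t + 1)) := by
      rw [Metric.tendstoUniformlyOn_iff]
      intro ε hε
      filter_upwards [(hδ0 (t + 1) (by linarith)).eventually
        (gt_mem_nhds (show (0 : ℝ) < ε ^ 2 by positivity))] with n hn s hs
      rw [dist_comm, dist_eq_norm]
      refine lt_of_pow_lt_pow_left₀ 2 hε.le ?_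
      have h1 := hunif n s hs.1
      have h2 := hrmono n s (t + 1) hs.1 hs.2
      simp only [hδ] at h1 hn; linarith
    have hc : ContinuousOn U (Icc 0 (t + 1)) := hun.continuousOn (Frequently.of_forall fun n =>
      ι.continuous.comp_continuousOn ((S n).continuous.comp_continuousOn
        (hacont.mono fun x hx => hx.1)))
    exact (hc t ⟨ht, by linarith⟩).mono_of_mem_nhdsWithin hsub
  · refine tendsto_nhds_unique (hU 0 le_rfl) ?_
    rw [ha0]; exact hSclos u₀ hu₀
  · filter_upwards [heq, ae_restrict_mem measurableSet_Ioi] with t h1 h2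
    have h3 : a t = ι† (ι (u t)) := h1.symm
    refine tendsto_nhds_unique (hU t (le_of_lt h2)) ?_
    rw [h3]
    exact (ι.continuous.tendsto _).comp (hSlim (u t))
  · intro t ht
    -- Closedness holds because `v - A (S n v) = v - S n (A v)` is a contraction in `v`. The set
    -- contains `range A`, hence `a s` for almost every `s`, and so `a t` for every `t > 0` by
    -- continuity.
    have hclosed : IsClosed {v : V | Tendsto (fun n => ι† (ι (S n v))) atTop (𝓝 v)} := by
      rw [← isSeqClosed_iff_isClosed]
      intro x y hx hxy
      rw [mem_ofPred_eq, Metric.tendsto_atTop]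
      intro ε hε
      obtain ⟨N, hN⟩ := Metric.tendsto_atTop.1 hxy (ε / 3) (by positivity)
      obtain ⟨M, hM⟩ := Metric.tendsto_atTop.1 (hx N) (ε / 3) (by positivity)
      refine ⟨M, fun n hn => ?_⟩
      have h1 := hM n hn
      have h2 := hN N le_rfl
      have h3 := hSle n (y - x N)
      rw [hScomm, map_sub, map_sub, map_sub] at h3
      rw [dist_eq_norm] at h1 ⊢
      rw [dist_comm, dist_eq_norm] at h2
      have e : ι† (ι (S n y)) - y = (ι† (ι (S n (x N))) - x N)
          - (y - x N - (ι† (ι (S n y)) - ι† (ι (S n (x N))))) := by abel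
      rw [e]
      exact (norm_sub_le _ _).trans_lt (by linarith)
    have hrange : ∀ v, Tendsto (fun n => ι† (ι (S n (ι† (ι v))))) atTop (𝓝 (ι† (ι v))) := fun v =>
      ((ι†).continuous.tendsto _).comp ((ι.continuous.tendsto _).comp (hSlim v))
    have hmem : a t ∈ {v : V | Tendsto (fun n => ι† (ι (S n v))) atTop (𝓝 v)} := by
      have h0 : ι† u₀ ∈ {v : V | Tendsto (fun n => ι† (ι (S n v))) atTop (𝓝 v)} :=
        ((ι†).continuous.tendsto _).comp (hSclos u₀ hu₀)
      rcases ht.eq_or_lt with rfl | ht'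
      · rw [ha0]; exact h0
      have hacl : a t ∈ closure {v : V | Tendsto (fun n => ι† (ι (S n v))) atTop (𝓝 v)} := by
        have hev : ∀ᵐ s ∂(volume.restrict (Ioi (0 : ℝ))),
            a s ∈ {v : V | Tendsto (fun n => ι† (ι (S n v))) atTop (𝓝 v)} := by
          filter_upwards [heq] with s hs
          have h3 : a s = ι† (ι (u s)) := hs.symm
          rw [h3]; exact hrange _
        rw [mem_closure_iff_nhds]
        intro W hW
        have h4 : a ⁻¹' W ∈ 𝓝 t := (hacont.continuousAt (Ici_mem_nhds ht')).preimage_mem_nhds hW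
        have h5 : a ⁻¹' W ∩ Ioi 0 ∈ 𝓝 t := inter_mem h4 (Ioi_mem_nhds ht')
        rw [ae_restrict_iff' measurableSet_Ioi] at hev
        obtain ⟨s, h9, h7, h8⟩ := (Measure.dense_of_ae hev).inter_nhds_nonempty h5
        exact ⟨a s, h7, h9 h8⟩
      rwa [hclosed.closure_eq] at hacl
    exact tendsto_nhds_unique (((ι†).continuous.tendsto _).comp (hU t ht)) hmem
  · intro t ht
    have h1 : Tendsto (fun n => ‖ι (S n (a t))‖ ^ 2) atTop (𝓝 (‖U t‖ ^ 2)) := (hU t ht).norm.pow 2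
    have h2 : ∀ n, ‖ι (S n (a t))‖ ^ 2 = ‖ι (S n (ι† u₀))‖ ^ 2 + 2 * ∫ s in (0 : ℝ)..t,
        inner ℝ (f s) (S n (ι† (ι (S n (ι† (ι (u s))))))) := by
      intro n
      -- With `D = S n ι† ι S n` the quadratic form is `‖ι (S n a)‖²`; the limit in `n` is the
      -- energy identity.
      have h3 := hquad ((S n).comp ((ι†).comp (ι.comp (S n)))) (fun v w => by
        simp only [ContinuousLinearMap.comp_apply]
        rw [hSsym, ContinuousLinearMap.adjoint_inner_left, ← ContinuousLinearMap.adjoint_inner_right,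
          hSsym]) t ht
      have h4 : ∀ v, inner ℝ v (((S n).comp ((ι†).comp (ι.comp (S n)))) v) = ‖ι (S n v)‖ ^ 2 :=
        fun v => by
          simp only [ContinuousLinearMap.comp_apply]
          rw [← hSsym, ContinuousLinearMap.adjoint_inner_right, real_inner_self_eq_norm_sq]
      rw [h4, h4, ha0] at h3
      exact h3
    have h5 : Tendsto (fun n => ∫ s in (0 : ℝ)..t,
        inner ℝ (f s) (S n (ι† (ι (S n (ι† (ι (u s)))))))) atTop
        (𝓝 (∫ s in (0 : ℝ)..t, inner ℝ (f s) (u s))) := by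
      simp only [intervalIntegral.integral_of_le ht]
      have hle2 : ∀ n v, ‖S n (ι† (ι v))‖ ≤ 2 * ‖v‖ := fun n v => by
        have e : S n (ι† (ι v)) = v - (v - S n (ι† (ι v))) := by abel
        rw [e]
        exact (norm_sub_le _ _).trans (by linarith [hSle n v])
      refine tendsto_integral_of_dominated_convergence (fun s => 4 * (‖f s‖ * ‖u s‖))
        (fun n => ?_) ((hfu t ht).const_mul 4) (fun n => ae_of_all _ fun s => ?_)
        (ae_of_all _ fun s => ?_)
      · exact (memLp_Ioc hf ht).aestronglyMeasurable.inner
          (((S n).comp ((ι†).comp (ι.comp ((S n).comp ((ι†).comp ι))))).comp_memLp'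
            (memLp_Ioc hu ht)).aestronglyMeasurable
      · calc _ ≤ ‖f s‖ * ‖S n (ι† (ι (S n (ι† (ι (u s))))))‖ := norm_inner_le_norm _ _
          _ ≤ ‖f s‖ * (4 * ‖u s‖) := by
            refine mul_le_mul_of_nonneg_left ?_ (norm_nonneg _)
            linarith [hle2 n (u s), hle2 n (S n (ι† (ι (u s))))]
          _ = _ := by ring
      · refine tendsto_const_nhds.inner ?_
        rw [tendsto_iff_norm_sub_tendsto_zero]
        have h6 : Tendsto (fun n => 3 * ‖u s - S n (ι† (ι (u s)))‖) atTop (𝓝 0) := by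
          simpa using ((tendsto_const_nhds (x := u s)).sub (hSlim (u s))).norm.const_mul 3
        refine squeeze_zero (fun _ => norm_nonneg _) (fun n => ?_) h6
        set w := u s - S n (ι† (ι (u s))) with hw
        have e : S n (ι† (ι (S n (ι† (ι (u s)))))) - u s = -(S n (ι† (ι w))) - w := by
          rw [hw]; simp only [map_sub]; abel
        rw [e]
        calc _ ≤ ‖-(S n (ι† (ι w)))‖ + ‖w‖ := norm_sub_le _ _
          _ ≤ _ := by rw [norm_neg]; linarith [hle2 n w]
    have h6 : Tendsto (fun n => ‖ι (S n (ι† u₀))‖ ^ 2) atTop (𝓝 (‖u₀‖ ^ 2)) :=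
      (hSclos u₀ hu₀).norm.pow 2
    refine tendsto_nhds_unique h1 ?_
    simp only [h2]
    exact h6.add (h5.const_mul 2)

end LionsMagenes

/-! ### Pointwise evaluation of Bochner integrals in `L²` -/

section Bochner

variable {A X 𝕜 : Type*} [RCLike 𝕜] [MeasurableSpace A] [MeasurableSpace X] {ρ : Measure A}
  {μ : Measure X} [SigmaFinite ρ] [SigmaFinite μ]

theorem setIntegral_norm_le_norm {f : X → 𝕜} (hf : MemLp f 2 μ) {s : Set X} (hs : MeasurableSet s)
    (hμs : μ s ≠ ⊤) : ∫ x in s, ‖f x‖ ∂μ ≤ ‖indicatorConstLp 2 hs hμs (1 : ℝ)‖ * ‖hf.toLp f‖ := by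
  have h1 := L2.inner_indicatorConstLp_one (𝕜 := ℝ) hs hμs (hf.norm.toLp)
  have h2 : ∫ x in s, ‖f x‖ ∂μ = ∫ x in s, (hf.norm.toLp) x ∂μ :=
    integral_congr_ae ((ae_restrict_of_ae hf.norm.coeFn_toLp).mono fun x hx => hx.symm)
  rw [h2, ← h1]
  refine (real_inner_le_norm _ _).trans_eq ?_
  rw [Lp.norm_toLp, Lp.norm_toLp, eLpNorm_norm]

/-- A Bochner integral of `L²` functions is computed pointwise. -/
theorem coeFn_integral_Lp {Φ : A → Lp 𝕜 2 μ} (hΦ : Integrable Φ ρ) {Ψ : A → X → 𝕜}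
    (hΨ : AEStronglyMeasurable (Function.uncurry Ψ) (ρ.prod μ)) (h : ∀ a, Φ a =ᵐ[μ] Ψ a) :
    (∫ a, Φ a ∂ρ : Lp 𝕜 2 μ) =ᵐ[μ] fun x => ∫ a, Ψ a x ∂ρ := by
  -- Square integrable functions need not be integrable, so Fubini is used only over sets of finite
  -- measure; by sigma-finiteness these determine the function.
  have hint : ∀ s, MeasurableSet s → μ s < ⊤ →
      Integrable (Function.uncurry Ψ) (ρ.prod (μ.restrict s)) := by
    intro s hs hμs
    have hm : AEStronglyMeasurable (Function.uncurry Ψ) (ρ.prod (μ.restrict s)) :=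
      hΨ.mono_ac (Measure.AbsolutelyContinuous.rfl.prod Measure.absolutelyContinuous_restrict)
    have hΨa : ∀ a, MemLp (Ψ a) 2 μ := fun a => (memLp_congr_ae (h a)).1 (Lp.memLp _)
    rw [integrable_prod_iff hm]
    refine ⟨ae_of_all _ fun a => ?_, ?_⟩
    · exact (integrableOn_Lp_of_measure_ne_top (Φ a) one_le_two hμs.ne).congr
        (ae_restrict_of_ae (h a))
    · refine Integrable.mono' (hΦ.norm.const_mul ‖indicatorConstLp 2 hs hμs.ne (1 : ℝ)‖)
        hm.norm.integral_prod_right' (ae_of_all _ fun a => ?_)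
      rw [Real.norm_of_nonneg (integral_nonneg fun _ => norm_nonneg _)]
      refine (setIntegral_norm_le_norm (hΨa a) hs hμs.ne).trans_eq ?_
      congr 2
      rw [← Lp.toLp_coeFn (Φ a) (Lp.memLp _)]
      exact MemLp.toLp_congr _ _ (h a).symm
  refine ae_eq_of_forall_setIntegral_eq_of_sigmaFinite
    (fun s _ hμs => integrableOn_Lp_of_measure_ne_top _ one_le_two hμs.ne)
    (fun s hs hμs => (hint s hs hμs).integral_prod_right) fun s hs hμs => ?_
  rw [← L2.inner_indicatorConstLp_one (𝕜 := 𝕜) hs hμs.ne, ← integral_inner hΦ]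
  simp only [L2.inner_indicatorConstLp_one]
  rw [← integral_integral_swap (hint s hs hμs)]
  exact integral_congr_ae (ae_of_all _ fun a => integral_congr_ae (ae_restrict_of_ae (h a)))

end Bochner

/-- A continuous measure preserving action of the group of horizontal translations. -/
structure Shift (d : ℕ) {X : Type*} [TopologicalSpace X] [MeasurableSpace X] (μ : Measure X) where
  toFun : Cross d → X → X
  cont : Continuous (Function.uncurry toFun)
  meas : Measurable (Function.uncurry toFun)
  mp : ∀ a, MeasurePreserving (toFun a) μ μ
  add : ∀ a b x, toFun a (toFun b x) = toFun (a + b) x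
  zero : ∀ x, toFun 0 x = x

/-! ### Averaging over horizontal translations -/

section Averaging

variable {d : ℕ} {X : Type*} [TopologicalSpace X] [MeasurableSpace X]
  {μ : Measure X}

/-- The translation `w ↦ w ∘ S_a` on `L²`. -/
def Shift.transl (S : Shift d μ) (a : Cross d) : Lp ℝ 2 μ →ₗᵢ[ℝ] Lp ℝ 2 μ :=
  Lp.compMeasurePreservingₗᵢ ℝ (S.toFun a) (S.mp a)

theorem Shift.coeFn_transl (S : Shift d μ) (a : Cross d) (w : Lp ℝ 2 μ) :
    S.transl a w =ᵐ[μ] fun x => w (S.toFun a x) :=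
  Lp.coeFn_compMeasurePreserving w (S.mp a)

theorem Shift.inner_transl (S : Shift d μ) (a : Cross d) (w v : Lp ℝ 2 μ) :
    inner ℝ (S.transl a w) v = inner ℝ w (S.transl (-a) v) := by
  have h : S.transl a (S.transl (-a) v) = v := by
    refine Lp.ext ?_
    filter_upwards [S.coeFn_transl a (S.transl (-a) v),
      (S.mp a).quasiMeasurePreserving.ae_eq_comp (S.coeFn_transl (-a) v)] with x h1 h2
    rw [h1]
    refine h2.trans ?_
    simp only [Function.comp, S.add, neg_add_cancel, S.zero]
  conv_lhs => rw [← h]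
  exact LinearIsometry.inner_map_map _ _ _

variable [BorelSpace X] [R1Space X] [μ.InnerRegularCompactLTTop] [IsLocallyFiniteMeasure μ]

theorem Shift.continuous_transl (S : Shift d μ) (w : Lp ℝ 2 μ) :
    Continuous fun a => S.transl a w :=
  Continuous.compMeasurePreservingLp (g := fun a => ⟨S.toFun a, S.cont.comp (continuous_const.prodMk continuous_id)⟩)
    continuous_const (ContinuousMap.continuous_of_continuous_uncurry _ S.cont) S.mp (by norm_num)

theorem Shift.integrable_smul_transl (S : Shift d μ) {k : Cross d → ℝ} (hk : Integrable k)
    (w : Lp ℝ 2 μ) : Integrable fun a => k a • S.transl a w := by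
  refine Integrable.mono' (hk.norm.mul_const ‖w‖)
    (hk.aestronglyMeasurable.smul (S.continuous_transl w).aestronglyMeasurable)
    (ae_of_all _ fun a => ?_)
  rw [norm_smul, LinearIsometry.norm_map]

/-- The average of the translates of `w` against the kernel `k`. -/
def Shift.avg (S : Shift d μ) (k : SchwartzMap (Cross d) ℝ) : Lp ℝ 2 μ →L[ℝ] Lp ℝ 2 μ :=
  LinearMap.mkContinuous
    { toFun := fun w => ∫ a, k a • S.transl a w
      map_add' := fun w v => by
        simp only [map_add, smul_add]
        exact integral_add (S.integrable_smul_transl k.integrable w)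
          (S.integrable_smul_transl k.integrable v)
      map_smul' := fun c w => by
        simp only [map_smul, RingHom.id_apply, smul_comm _ c]
        exact integral_smul c _ }
    (∫ a, ‖k a‖) fun w => by
      refine (norm_integral_le_integral_norm _).trans_eq ?_
      rw [← integral_mul_const]
      exact integral_congr_ae (ae_of_all _ fun a => by
        simp only [norm_smul, LinearIsometry.norm_map])

theorem Shift.avg_apply (S : Shift d μ) (k : SchwartzMap (Cross d) ℝ) (w : Lp ℝ 2 μ) :
    S.avg k w = ∫ a, k a • S.transl a w := rfl

theorem Shift.map_avg {E : Type*} [NormedAddCommGroup E] [NormedSpace ℝ E] [CompleteSpace E]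
    (S : Shift d μ) (k : SchwartzMap (Cross d) ℝ) (L : Lp ℝ 2 μ →L[ℝ] E) (w : Lp ℝ 2 μ) :
    L (S.avg k w) = ∫ a, k a • L (S.transl a w) := by
  rw [S.avg_apply, ← L.integral_comp_comm (S.integrable_smul_transl k.integrable w)]
  simp only [map_smul]

theorem Shift.inner_avg (S : Shift d μ) (k : SchwartzMap (Cross d) ℝ) (w v : Lp ℝ 2 μ) :
    inner ℝ (S.avg k w) v = ∫ a, k a * inner ℝ (S.transl a w) v := by
  rw [real_inner_comm]
  have := S.map_avg k (innerSL ℝ v) w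
  simp only [innerSL_apply_apply, smul_eq_mul] at this
  rw [this]
  simp only [real_inner_comm]

/-- Translation by `a` has adjoint translation by `-a`, so evenness of the kernel makes the average
symmetric. This is what allows a kernel to be moved between the two factors of an energy pairing. -/
theorem Shift.inner_avg_comm (S : Shift d μ) {k : SchwartzMap (Cross d) ℝ}
    (hk : ∀ a, k (-a) = k a) (w v : Lp ℝ 2 μ) :
    inner ℝ (S.avg k w) v = inner ℝ w (S.avg k v) := by
  rw [real_inner_comm (S.avg k v), S.inner_avg, S.inner_avg, ← integral_neg_eq_self]
  congr 1; ext a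
  rw [hk, S.inner_transl, neg_neg, real_inner_comm]

theorem Shift.coeFn_avg [SigmaFinite μ] (S : Shift d μ) (k : SchwartzMap (Cross d) ℝ)
    (w : Lp ℝ 2 μ) : S.avg k w =ᵐ[μ] fun x => ∫ a, k a * w (S.toFun a x) := by
  rw [S.avg_apply]
  refine coeFn_integral_Lp (S.integrable_smul_transl k.integrable w)
    (Ψ := fun a x => k a * w (S.toFun a x)) ?_ fun a => ?_
  · have h1 : StronglyMeasurable fun p : Cross d × X => w (Function.uncurry S.toFun p) := by
      exact (Lp.stronglyMeasurable w).comp_measurable S.meas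
    exact ((k.continuous.stronglyMeasurable.comp_measurable measurable_fst).mul
      h1).aestronglyMeasurable
  · filter_upwards [Lp.coeFn_smul (k a) (S.transl a w), S.coeFn_transl a w] with x h1 h2
    rw [h1, Pi.smul_apply, h2, smul_eq_mul]

end Averaging

/-! ### Bounded multipliers -/

section Multiplication

variable {X : Type*} [MeasurableSpace X] {μ : Measure X}

theorem memLp_mul_of_bound {m : X → ℂ} (hm : Measurable m) {C : ℝ} (hC : ∀ x, ‖m x‖ ≤ C)
    {f : X → ℂ} (hf : MemLp f 2 μ) : MemLp (fun x => m x * f x) 2 μ :=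
  hf.of_le_mul (c := C) (hm.aestronglyMeasurable.mul hf.aestronglyMeasurable) (ae_of_all _ fun x => by
    rw [norm_mul]; exact mul_le_mul_of_nonneg_right (hC x) (norm_nonneg _))

/-- Multiplication by a bounded function on `L²`. -/
def mulL {m : X → ℂ} (hm : Measurable m) {C : ℝ} (hC : ∀ x, ‖m x‖ ≤ C) :
    Lp ℂ 2 μ →L[ℂ] Lp ℂ 2 μ :=
  LinearMap.mkContinuous
    { toFun := fun f => (memLp_mul_of_bound hm hC (Lp.memLp f)).toLp
      map_add' := fun f g => by
        rw [← MemLp.toLp_add]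
        refine MemLp.toLp_congr _ _ ?_
        filter_upwards [Lp.coeFn_add f g] with x hx
        rw [hx, Pi.add_apply, Pi.add_apply, mul_add]
      map_smul' := fun c f => by
        rw [RingHom.id_apply, ← MemLp.toLp_const_smul]
        refine MemLp.toLp_congr _ _ ?_
        filter_upwards [Lp.coeFn_smul c f] with x hx
        rw [hx, Pi.smul_apply, Pi.smul_apply, smul_eq_mul, smul_eq_mul]; ring }
    C fun f => by
      refine Lp.norm_le_mul_norm_of_ae_le_mul ?_
      filter_upwards [(memLp_mul_of_bound hm hC (Lp.memLp f)).coeFn_toLp] with x hx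
      change ‖((memLp_mul_of_bound hm hC (Lp.memLp f)).toLp : X → ℂ) x‖ ≤ _
      rw [hx, norm_mul]
      exact mul_le_mul_of_nonneg_right (hC x) (norm_nonneg _)

theorem coeFn_mulL {m : X → ℂ} (hm : Measurable m) {C : ℝ} (hC : ∀ x, ‖m x‖ ≤ C) (f : Lp ℂ 2 μ) :
    mulL hm hC f =ᵐ[μ] fun x => m x * f x :=
  (memLp_mul_of_bound hm hC (Lp.memLp f)).coeFn_toLp

end Multiplication

/-! ### The Fourier transform on `Σ` and convolution -/

section Fourier

variable {d : ℕ}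

/-- The action of horizontal translations on `Σ`. -/
def surfShift (d : ℕ) : Shift d (volume : Measure (Cross d)) where
  toFun a x := x - a
  cont := by simp only [Function.uncurry_def]; fun_prop
  meas := by simp only [Function.uncurry_def]; fun_prop
  mp a := measurePreserving_sub_right volume a
  add a b x := by abel
  zero x := sub_zero x

/-- The character `ξ ↦ e^{-2πi a·ξ}`. -/
def chr (a ξ : Cross d) : ℂ := (Real.fourierChar (-(inner ℝ a ξ)) : ℂ)

theorem continuous_chr : Continuous (Function.uncurry (chr (d := d))) := by
  unfold chr Function.uncurry
  exact continuous_subtype_val.comp (Real.continuous_fourierChar.comp (by fun_prop))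

theorem norm_chr (a ξ : Cross d) : ‖chr a ξ‖ ≤ 1 := (Circle.norm_coe _).le

theorem measurable_chr (a : Cross d) : Measurable (chr a) :=
  (continuous_chr.comp (continuous_const.prodMk continuous_id)).measurable

theorem fourier_schwartz_translate (f : SchwartzMap (Cross d) ℂ) (a ξ : Cross d) :
    (𝓕 (f.compSubConstCLM ℂ a)) ξ = chr a ξ * (𝓕 f) ξ := by
  rw [SchwartzMap.fourier_coe, SchwartzMap.fourier_coe, Real.fourier_eq, Real.fourier_eq,
    ← integral_const_mul, ← integral_add_right_eq_self _ a]
  congr 1; ext v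
  rw [SchwartzMap.compSubConstCLM_apply, add_sub_cancel_right, inner_add_left, neg_add,
    AddChar.map_add_eq_mul, chr, Circle.smul_def, Circle.smul_def, Circle.coe_mul, smul_eq_mul,
    smul_eq_mul]
  ring

/-- Both sides are continuous in `f`, so it suffices to treat Schwartz functions, where the Fourier
integral can be computed. -/
theorem fourier_Lp_translate (a : Cross d) (f : Lp ℂ 2 (volume : Measure (Cross d))) :
    𝓕 (Lp.compMeasurePreservingₗᵢ ℂ ((surfShift d).toFun a) ((surfShift d).mp a) f) =
      mulL (measurable_chr a) (norm_chr a) (𝓕 f) := by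
  refine DenseRange.induction_on (p := fun f : Lp ℂ 2 (volume : Measure (Cross d)) =>
    𝓕 (Lp.compMeasurePreservingₗᵢ ℂ ((surfShift d).toFun a) ((surfShift d).mp a) f) =
      mulL (measurable_chr a) (norm_chr a) (𝓕 f))
    (SchwartzMap.denseRange_toLpCLM (p := 2) ENNReal.ofNat_ne_top) f ?_ ?_
  · refine isClosed_eq ?_ ?_
    · exact (FourierTransform.fourierCLM ℂ (Lp ℂ 2 (volume : Measure (Cross d)))).continuous.comp
        (LinearIsometry.continuous _)
    · exact (mulL (measurable_chr a) (norm_chr a)).continuous.comp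
        (FourierTransform.fourierCLM ℂ (Lp ℂ 2 (volume : Measure (Cross d)))).continuous
  · intro f
    simp only [SchwartzMap.toLpCLM_apply]
    have h1 : Lp.compMeasurePreservingₗᵢ ℂ ((surfShift d).toFun a) ((surfShift d).mp a)
        (f.toLp 2 (volume : Measure (Cross d))) = (f.compSubConstCLM ℂ a).toLp 2 := by
      refine Lp.ext ?_
      filter_upwards [Lp.coeFn_compMeasurePreserving (f.toLp 2 (volume : Measure (Cross d)))
        ((surfShift d).mp a), (f.compSubConstCLM ℂ a).coeFn_toLp 2 volume,
        ((surfShift d).mp a).quasiMeasurePreserving.ae_eq_comp (f.coeFn_toLp 2 volume)] with x h1 h2 h3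
      rw [h2]
      exact h1.trans h3
    rw [h1, SchwartzMap.toLp_fourier_eq, SchwartzMap.toLp_fourier_eq]
    refine Lp.ext ?_
    filter_upwards [(𝓕 (f.compSubConstCLM ℂ a)).coeFn_toLp 2 volume,
      coeFn_mulL (measurable_chr a) (norm_chr a) ((𝓕 f).toLp 2 (volume : Measure (Cross d))),
      (𝓕 f).coeFn_toLp 2 volume] with ξ h2 h3 h4
    rw [h2, h3, h4, fourier_schwartz_translate]

/-- Complexification of real `L²` functions. -/
def complexify {X : Type*} [MeasurableSpace X] {μ : Measure X} : Lp ℝ 2 μ →L[ℝ] Lp ℂ 2 μ :=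
  Complex.ofRealCLM.compLpL 2 μ

/-- The Fourier transform on real `L²(Σ)`. -/
def hatL (d : ℕ) : SurfL2 d →L[ℝ] Lp ℂ 2 (volume : Measure (Cross d)) :=
  ((FourierTransform.fourierCLM ℂ (Lp ℂ 2 (volume : Measure (Cross d)))).restrictScalars ℝ).comp
    complexify

theorem hatL_apply (f : SurfL2 d) : hatL d f = 𝓕 (complexify f) := rfl

theorem hat_eq {f : Cross d → ℝ} (hf : MemLp f 2 volume) : hat f = ⇑(hatL d (hf.toLp f)) := by
  have h1 : MemLp (fun x => (f x : ℂ)) 2 volume := hf.ofReal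
  rw [hat, dif_pos h1, hatL_apply]
  have : h1.toLp = complexify (hf.toLp f) := by
    refine Lp.ext ?_
    filter_upwards [h1.coeFn_toLp, Complex.ofRealCLM.coeFn_compLpL (p := 2) (hf.toLp f),
      hf.coeFn_toLp] with x h2 h3 h4
    rw [h2]
    refine Eq.trans ?_ h3.symm
    rw [h4]; rfl
  rw [this]

theorem hat_coe (f : SurfL2 d) : hat f = ⇑(hatL d f) := by
  rw [hat_eq (Lp.memLp f), Lp.toLp_coeFn]

theorem norm_complexify {X : Type*} [MeasurableSpace X] {μ : Measure X} (f : Lp ℝ 2 μ) :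
    ‖complexify f‖ = ‖f‖ := by
  have := Complex.ofRealCLM.coeFn_compLpL (p := 2) f
  rw [Lp.norm_def, Lp.norm_def]
  congr 1
  refine eLpNorm_congr_norm_ae ?_
  filter_upwards [this] with x hx
  exact (congrArg norm hx).trans (by simp)

theorem norm_hatL (f : SurfL2 d) : ‖hatL d f‖ = ‖f‖ := by
  rw [hatL_apply, Lp.norm_fourier_eq, norm_complexify]

theorem hatL_transl (a : Cross d) (f : SurfL2 d) :
    hatL d ((surfShift d).transl a f) = mulL (measurable_chr a) (norm_chr a) (hatL d f) := by
  rw [hatL_apply, hatL_apply, ← fourier_Lp_translate]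
  congr 1
  refine Lp.ext ?_
  filter_upwards [Complex.ofRealCLM.coeFn_compLpL (p := 2) ((surfShift d).transl a f),
    (surfShift d).coeFn_transl a f, Lp.coeFn_compMeasurePreserving (complexify f) ((surfShift d).mp a),
    ((surfShift d).mp a).quasiMeasurePreserving.ae_eq_comp
      (Complex.ofRealCLM.coeFn_compLpL (p := 2) f)] with x h1 h2 h3 h4
  refine h1.trans ?_
  rw [h2]
  exact (h3.trans h4).symm

/-- The symbol of the convolution with a real Schwartz kernel. -/
def khat (k : SchwartzMap (Cross d) ℝ) : SchwartzMap (Cross d) ℂ :=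
  𝓕 (k.postcompCLM Complex.ofRealCLM)

theorem khat_apply (k : SchwartzMap (Cross d) ℝ) (ξ : Cross d) :
    khat k ξ = ∫ a, (k a : ℂ) * chr a ξ := by
  rw [khat, SchwartzMap.fourier_coe, Real.fourier_eq]
  congr 1; ext a
  rw [Circle.smul_def, smul_eq_mul, mul_comm, SchwartzMap.postcompCLM_apply]
  rfl

/-- The Fourier transform passes through the Bochner integral of translates; each translate
contributes a character, and integrating the characters against `k` gives `khat k`. -/
theorem hatL_avg (k : SchwartzMap (Cross d) ℝ) (f : SurfL2 d) :
    hatL d ((surfShift d).avg k f) =ᵐ[volume] fun ξ => khat k ξ * hatL d f ξ := by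
  have hI := (hatL d).integrable_comp ((surfShift d).integrable_smul_transl k.integrable f)
  have h0 : hatL d ((surfShift d).avg k f) = ∫ a, hatL d (k a • (surfShift d).transl a f) := by
    rw [Shift.avg_apply]
    exact ((hatL d).integral_comp_comm ((surfShift d).integrable_smul_transl k.integrable f)).symm
  rw [h0]
  have h1 := coeFn_integral_Lp hI (Ψ := fun a ξ => (k a : ℂ) * chr a ξ * hatL d f ξ) ?_ ?_
  · filter_upwards [h1] with ξ hξ
    rw [hξ, integral_mul_const, khat_apply]
  · have h2 : StronglyMeasurable fun p : Cross d × Cross d => (k p.1 : ℂ) * chr p.1 p.2 := by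
      refine Continuous.stronglyMeasurable ?_
      exact (Complex.continuous_ofReal.comp (k.continuous.comp continuous_fst)).mul continuous_chr
    exact (h2.mul ((Lp.stronglyMeasurable (hatL d f)).comp_measurable
      measurable_snd)).aestronglyMeasurable
  · intro a
    simp only [map_smul, hatL_transl]
    filter_upwards [Lp.coeFn_smul (k a) (mulL (measurable_chr a) (norm_chr a) (hatL d f)),
      coeFn_mulL (measurable_chr a) (norm_chr a) (hatL d f)] with ξ h2 h3
    rw [h2, Pi.smul_apply, h3, Complex.real_smul, mul_assoc]

end Fourier

/-! ### Horizontal Fourier analysis on slices of the slab -/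

section Slab

variable {d : ℕ} {ℓ : ℝ}

theorem slab_eq_prod (d : ℕ) (ℓ : ℝ) :
    slab d ℓ = (volume : Measure (Cross d)).prod (volume.restrict (Ioo 0 ℓ)) := by
  rw [slab, Measure.volume_eq_prod, ← Measure.prod_restrict, Measure.restrict_univ]

instance (d : ℕ) (ℓ : ℝ) : SigmaFinite (slab d ℓ) := by unfold slab; infer_instance

instance (d : ℕ) (ℓ : ℝ) : IsLocallyFiniteMeasure (slab d ℓ) := by unfold slab; infer_instance

instance (d : ℕ) (ℓ : ℝ) : (slab d ℓ).InnerRegularCompactLTTop := by unfold slab; infer_instance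

/-- Real valued square integrable functions on the slab. -/
abbrev ScalL2 (d : ℕ) (ℓ : ℝ) : Type := Lp ℝ 2 (slab d ℓ)

/-- The action of horizontal translations on the slab. -/
def slabShift (d : ℕ) (ℓ : ℝ) : Shift d (slab d ℓ) where
  toFun a z := (z.1 - a, z.2)
  cont := by simp only [Function.uncurry_def]; fun_prop
  meas := by simp only [Function.uncurry_def]; fun_prop
  mp a := by
    rw [slab_eq_prod]
    exact (measurePreserving_sub_right volume a).prod (MeasurePreserving.id _)
  add a b x := by ext <;> simp; abel
  zero x := by simp

theorem hat_congr {f g : Cross d → ℝ} (h : f =ᵐ[volume] g) : hat f = hat g := by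
  by_cases hf : MemLp f 2 volume
  · have hg := (memLp_congr_ae h).1 hf
    rw [hat_eq hf, hat_eq hg, MemLp.toLp_congr hf hg h]
  · have aux : ∀ {f : Cross d → ℝ}, ¬ MemLp f 2 volume → hat f = 0 := by
      intro f hf
      rw [hat, dif_neg]
      intro h'
      exact hf (by simpa using h'.re)
    have hg : ¬ MemLp g 2 volume := fun hg => hf ((memLp_congr_ae h).2 hg)
    rw [aux hf, aux hg]

theorem lintegral_enorm_sq_eq_hat {f : Cross d → ℝ} (hf : MemLp f 2 volume) :
    ∫⁻ x, ‖f x‖ₑ ^ 2 = ∫⁻ ξ, ‖hat f ξ‖ₑ ^ 2 := by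
  have key : ∀ {𝕜 : Type} [RCLike 𝕜] (g : Lp 𝕜 2 (volume : Measure (Cross d))),
      ∫⁻ x, ‖g x‖ₑ ^ 2 = ‖g‖ₑ ^ 2 := by
    intro 𝕜 _ g
    rw [Lp.enorm_def, eLpNorm_eq_lintegral_rpow_enorm_toReal (by norm_num) (by norm_num)]
    simp only [ENNReal.toReal_ofNat, one_div]
    rw [← ENNReal.rpow_natCast, ← ENNReal.rpow_mul]
    simp
  rw [hat_eq hf, key]
  have h1 : ∫⁻ x, ‖f x‖ₑ ^ 2 = ∫⁻ x, ‖hf.toLp f x‖ₑ ^ 2 :=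
    lintegral_congr_ae (hf.coeFn_toLp.mono fun x hx => by simp only [hx])
  rw [h1, key, ← ofReal_norm, ← ofReal_norm, norm_hatL]

theorem lintegral_slab (f : Cross d × ℝ → ℝ≥0∞) (hf : Measurable f) :
    ∫⁻ z, f z ∂(slab d ℓ) = ∫⁻ y in Ioo 0 ℓ, ∫⁻ x, f (x, y) := by
  rw [slab_eq_prod, lintegral_prod_symm' _ hf]

theorem integrable_slice {f : Cross d × ℝ → ℝ} (hf : Integrable f (slab d ℓ)) :
    ∀ᵐ y ∂(volume.restrict (Ioo 0 ℓ)), Integrable fun x => f (x, y) := by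
  rw [slab_eq_prod] at hf
  exact hf.prod_left_ae

theorem memLp_slice (w : ScalL2 d ℓ) :
    ∀ᵐ y ∂(volume.restrict (Ioo 0 ℓ)), MemLp (fun x => w (x, y)) 2 volume := by
  have h1 : Integrable (fun z => w z ^ 2) (slab d ℓ) :=
    (memLp_two_iff_integrable_sq (Lp.aestronglyMeasurable w)).1 (Lp.memLp w)
  filter_upwards [integrable_slice h1] with y hy
  exact (memLp_two_iff_integrable_sq
    ((Lp.stronglyMeasurable w).comp_measurable measurable_prodMk_right).aestronglyMeasurable).2 hy

theorem ae_slice {p : Cross d × ℝ → Prop} (h : ∀ᵐ z ∂(slab d ℓ), p z) :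
    ∀ᵐ y ∂(volume.restrict (Ioo 0 ℓ)), ∀ᵐ x ∂(volume : Measure (Cross d)), p (x, y) := by
  rw [slab_eq_prod] at h
  have h2 := (Measure.measurePreserving_swap (μ := volume.restrict (Ioo 0 ℓ))
    (ν := (volume : Measure (Cross d)))).quasiMeasurePreserving.ae h
  exact Measure.ae_ae_of_ae_prod h2

theorem enorm_sq_eq_slices (w : ScalL2 d ℓ) :
    ‖w‖ₑ ^ 2 = ∫⁻ y in Ioo 0 ℓ, ∫⁻ ξ, ‖hat (fun x => w (x, y)) ξ‖ₑ ^ 2 := by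
  have h1 : ‖w‖ₑ ^ 2 = ∫⁻ z, ‖w z‖ₑ ^ 2 ∂(slab d ℓ) := by
    rw [Lp.enorm_def, eLpNorm_eq_lintegral_rpow_enorm_toReal (by norm_num) (by norm_num)]
    simp only [ENNReal.toReal_ofNat, one_div]
    rw [← ENNReal.rpow_natCast, ← ENNReal.rpow_mul]
    simp
  rw [h1, lintegral_slab _ ((Lp.stronglyMeasurable w).enorm.pow_const 2)]
  refine lintegral_congr_ae ?_
  filter_upwards [memLp_slice w] with y hy
  exact lintegral_enorm_sq_eq_hat hy

/-- Averaging acts only in `x`, so on almost every slice it is the surface convolution, and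
`hatL_avg` applies. -/
theorem hat_slice_avg (k : SchwartzMap (Cross d) ℝ) (w : ScalL2 d ℓ) :
    ∀ᵐ y ∂(volume.restrict (Ioo 0 ℓ)), hat (fun x => (slabShift d ℓ).avg k w (x, y)) =ᵐ[volume]
      fun ξ => khat k ξ * hat (fun x => w (x, y)) ξ := by
  filter_upwards [memLp_slice w, ae_slice ((slabShift d ℓ).coeFn_avg k w)] with y h1 h2
  have h3 : (fun x => (slabShift d ℓ).avg k w (x, y)) =ᵐ[volume]
      (surfShift d).avg k (h1.toLp _) := by
    filter_upwards [h2, (surfShift d).coeFn_avg k (h1.toLp _)] with x h4 h5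
    rw [h4, h5]
    refine integral_congr_ae ?_
    have h6 := h1.coeFn_toLp
    have h7 := (Measure.measurePreserving_sub_left volume x).quasiMeasurePreserving.ae_eq_comp h6
    filter_upwards [h7] with a h8
    change k a * w (x - a, y) = k a * (h1.toLp _) (x - a)
    rw [show (h1.toLp fun x => w (x, y)) (x - a) = w (x - a, y) from h8]
  rw [hat_congr h3, hat_coe, hat_eq h1]
  exact hatL_avg k _

theorem hat_slice_sum {ι : Type*} (s : Finset ι) (w : ι → ScalL2 d ℓ) :
    ∀ᵐ y ∂(volume.restrict (Ioo 0 ℓ)), hat (fun x => (∑ i ∈ s, w i) (x, y)) =ᵐ[volume]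
      fun ξ => ∑ i ∈ s, hat (fun x => w i (x, y)) ξ := by
  have h0 : ∀ᵐ y ∂(volume.restrict (Ioo 0 ℓ)), ∀ i ∈ s, MemLp (fun x => w i (x, y)) 2 volume :=
    (ae_ball_iff s.countable_toSet).2 fun i _ => memLp_slice (w i)
  filter_upwards [h0, ae_slice (Lp.coeFn_finsetSum s w)] with y h1 h2
  classical
  let W : ι → SurfL2 d := fun i => if h : i ∈ s then (h1 i h).toLp _ else 0
  have hW : ∀ i ∈ s, W i =ᵐ[volume] fun x => w i (x, y) := fun i hi => by
    simp only [W, dif_pos hi]; exact (h1 i hi).coeFn_toLp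
  have h3 : (fun x => (∑ i ∈ s, w i) (x, y)) =ᵐ[volume] (∑ i ∈ s, W i : SurfL2 d) := by
    filter_upwards [h2, Lp.coeFn_finsetSum s W,
      (ae_ball_iff s.countable_toSet).2 hW] with x h4 h5 h6
    rw [h4, h5, Finset.sum_apply, Finset.sum_apply]
    exact Finset.sum_congr rfl fun i hi => (h6 i hi).symm
  rw [hat_congr h3, hat_coe, map_sum]
  filter_upwards [Lp.coeFn_finsetSum s fun i => hatL d (W i)] with ξ h7
  rw [h7, Finset.sum_apply]
  refine Finset.sum_congr rfl fun i hi => ?_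
  rw [← hat_coe, hat_congr (hW i hi)]

theorem aemeasurable_hat (f : Cross d → ℝ) : AEMeasurable (hat f) := by
  by_cases hf : MemLp f 2 volume
  · rw [hat_eq hf]; exact (Lp.aestronglyMeasurable _).aemeasurable
  · rw [hat, dif_neg fun h' => hf (by simpa using h'.re)]
    exact aemeasurable_const

/-- The transforms of the slices are chosen separately for each `y`, with no joint measurability in
`(ξ, y)`. Plancherel replaces them by the slices themselves, for which measurability in `y` is
clear. -/
theorem aemeasurable_slice_norm (w : ScalL2 d ℓ) :
    AEMeasurable (fun y => ∫⁻ ξ, ‖hat (fun x => w (x, y)) ξ‖ₑ ^ 2) (volume.restrict (Ioo 0 ℓ)) := by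
  have h1 : Measurable fun z : Cross d × ℝ => ‖w z‖ₑ ^ 2 :=
    (Lp.stronglyMeasurable w).enorm.pow_const 2
  refine ⟨fun y => ∫⁻ x, ‖w (x, y)‖ₑ ^ 2, h1.lintegral_prod_left', ?_⟩
  filter_upwards [memLp_slice w] with y hy
  exact (lintegral_enorm_sq_eq_hat hy).symm

theorem sum_enorm_sq_eq_slices {α : Type*} (s : Finset α) (V : α → ScalL2 d ℓ) :
    ∑ i ∈ s, ‖V i‖ₑ ^ 2
      = ∫⁻ y in Ioo 0 ℓ, ∫⁻ ξ, ∑ i ∈ s, ‖hat (fun x => V i (x, y)) ξ‖ₑ ^ 2 := by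
  simp only [enorm_sq_eq_slices]
  rw [← lintegral_finsetSum' _ fun i _ => aemeasurable_slice_norm (V i)]
  refine lintegral_congr fun y => ?_
  rw [lintegral_finsetSum' _ fun i _ => (aemeasurable_hat _).enorm.pow_const 2]

theorem hat_slice_sum_avg {ι : Type*} [Fintype ι] (w : ι → ScalL2 d ℓ)
    (k : ι → SchwartzMap (Cross d) ℝ) :
    ∀ᵐ y ∂(volume.restrict (Ioo 0 ℓ)),
      hat (fun x => (∑ j, (slabShift d ℓ).avg (k j) (w j)) (x, y)) =ᵐ[volume]
        fun ξ => ∑ j, khat (k j) ξ * hat (fun x => w j (x, y)) ξ := by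
  filter_upwards [hat_slice_sum Finset.univ fun j => (slabShift d ℓ).avg (k j) (w j),
    ae_all_iff.2 fun j => hat_slice_avg (k j) (w j)] with y h1 h2
  filter_upwards [h1, ae_all_iff.2 h2] with ξ h3 h4
  rw [h3]
  exact Finset.sum_congr rfl fun j _ => h4 j

/-- Spectral comparison of horizontal convolution operators on the slab. -/
theorem sum_norm_sq_avg_le {ι α β : Type*} [Fintype ι] [Fintype α] [Fintype β]
    (w : ι → ScalL2 d ℓ) (k : α → ι → SchwartzMap (Cross d) ℝ)
    (k' : β → ι → SchwartzMap (Cross d) ℝ)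
    (h : ∀ ξ (a : ι → ℂ), ∑ i, ‖∑ j, khat (k i j) ξ * a j‖ ^ 2
      ≤ ∑ i, ‖∑ j, khat (k' i j) ξ * a j‖ ^ 2) :
    ∑ i, ‖∑ j, (slabShift d ℓ).avg (k i j) (w j)‖ ^ 2
      ≤ ∑ i, ‖∑ j, (slabShift d ℓ).avg (k' i j) (w j)‖ ^ 2 := by
  have conv : ∀ {E : Type} [NormedAddCommGroup E] (x : E), ‖x‖ₑ ^ 2 = ENNReal.ofReal (‖x‖ ^ 2) := by
    intro E _ x
    rw [ENNReal.ofReal_pow (norm_nonneg _), ofReal_norm]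
  have hle : ∑ i, ‖∑ j, (slabShift d ℓ).avg (k i j) (w j)‖ₑ ^ 2
      ≤ ∑ i, ‖∑ j, (slabShift d ℓ).avg (k' i j) (w j)‖ₑ ^ 2 := by
    rw [sum_enorm_sq_eq_slices, sum_enorm_sq_eq_slices]
    refine lintegral_mono_ae ?_
    filter_upwards [ae_all_iff.2 fun i => hat_slice_sum_avg w (k i),
      ae_all_iff.2 fun i => hat_slice_sum_avg w (k' i)] with y h1 h2
    refine lintegral_mono_ae ?_
    filter_upwards [ae_all_iff.2 h1, ae_all_iff.2 h2] with ξ h3 h4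
    simp only [h3, h4, conv]
    rw [← ENNReal.ofReal_sum_of_nonneg fun _ _ => by positivity,
      ← ENNReal.ofReal_sum_of_nonneg fun _ _ => by positivity]
    exact ENNReal.ofReal_le_ofReal (h ξ _)
  simp only [conv] at hle
  rw [← ENNReal.ofReal_sum_of_nonneg fun _ _ => by positivity,
    ← ENNReal.ofReal_sum_of_nonneg fun _ _ => by positivity] at hle
  exact (ENNReal.ofReal_le_ofReal_iff (Finset.sum_nonneg fun _ _ => by positivity)).1 hle

theorem enorm_sq_avg (w : ScalL2 d ℓ) (k : SchwartzMap (Cross d) ℝ) :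
    ‖(slabShift d ℓ).avg k w‖ₑ ^ 2
      = ∫⁻ y in Ioo 0 ℓ, ∫⁻ ξ, ‖khat k ξ‖ₑ ^ 2 * ‖hat (fun x => w (x, y)) ξ‖ₑ ^ 2 := by
  rw [enorm_sq_eq_slices]
  refine lintegral_congr_ae ?_
  filter_upwards [hat_slice_avg k w] with y hy
  refine lintegral_congr_ae ?_
  filter_upwards [hy] with ξ h
  rw [h, enorm_mul, mul_pow]

theorem norm_avg_le {k k' : SchwartzMap (Cross d) ℝ} {C : ℝ} (hC : 0 ≤ C)
    (h : ∀ ξ, ‖khat k ξ‖ ≤ C * ‖khat k' ξ‖) (w : ScalL2 d ℓ) :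
    ‖(slabShift d ℓ).avg k w‖ ≤ C * ‖(slabShift d ℓ).avg k' w‖ := by
  have h1 : ‖(slabShift d ℓ).avg k w‖ₑ ^ 2
      ≤ ENNReal.ofReal C ^ 2 * ‖(slabShift d ℓ).avg k' w‖ₑ ^ 2 := by
    rw [enorm_sq_avg, enorm_sq_avg, ← lintegral_const_mul' _ _ (by finiteness)]
    refine lintegral_mono fun y => ?_
    rw [← lintegral_const_mul' _ _ (by finiteness)]
    refine lintegral_mono fun ξ => ?_
    have h2 : ‖khat k ξ‖ₑ ≤ ENNReal.ofReal C * ‖khat k' ξ‖ₑ := by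
      rw [← ofReal_norm, ← ofReal_norm, ← ENNReal.ofReal_mul hC]
      exact ENNReal.ofReal_le_ofReal (h ξ)
    calc _ ≤ (ENNReal.ofReal C * ‖khat k' ξ‖ₑ) ^ 2 * ‖hat (fun x => w (x, y)) ξ‖ₑ ^ 2 := by gcongr
      _ = _ := by ring
  rw [← mul_pow, ← ofReal_norm, ← ofReal_norm, ← ENNReal.ofReal_mul hC,
    ← ENNReal.ofReal_pow (norm_nonneg _), ← ENNReal.ofReal_pow (by positivity)] at h1
  have h2 := (ENNReal.ofReal_le_ofReal_iff (by positivity)).1 h1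
  exact (pow_le_pow_iff_left₀ (by positivity) (by positivity) two_ne_zero).1 h2

end Slab

/-! ### Duality with test functions -/

section TestFunctions

variable {E : Type*} [NormedAddCommGroup E] [NormedSpace ℝ E] [FiniteDimensional ℝ E]
  [MeasurableSpace E] [BorelSpace E] {ν : Measure E} [IsLocallyFiniteMeasure ν]

theorem memLp_restrict_test {U : Set E} {φ : E → ℝ} (h1 : ContDiff ℝ ∞ φ)
    (h2 : HasCompactSupport φ) : MemLp φ 2 (ν.restrict U) :=
  (h1.continuous.memLp_of_hasCompactSupport h2).restrict U

theorem inner_toLp {X : Type*} [MeasurableSpace X] {μ : Measure X} (w : Lp ℝ 2 μ) {φ : X → ℝ}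
    (hφ : MemLp φ 2 μ) : inner ℝ w (hφ.toLp φ) = ∫ z, w z * φ z ∂μ := by
  rw [L2.inner_def]
  refine integral_congr_ae ?_
  filter_upwards [hφ.coeFn_toLp] with z hz
  simp [hz, mul_comm]

/-- Test functions are dense in `L²(U)`: their orthogonal complement vanishes by the fundamental
lemma of the calculus of variations. The bound therefore extends to all of `L²(U)`, and `w` is
tested against itself. The Poincaré and trace inequalities use this to avoid approximating `w` by
smooth functions. -/
theorem norm_le_of_test {U : Set E} (hU : IsOpen U) (w : Lp ℝ 2 (ν.restrict U)) {C : ℝ} (hC : 0 ≤ C)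
    (h : ∀ φ : E → ℝ, ContDiff ℝ ∞ φ → HasCompactSupport φ → tsupport φ ⊆ U →
      ∀ hφ : MemLp φ 2 (ν.restrict U), |∫ z, w z * φ z ∂(ν.restrict U)| ≤ C * ‖hφ.toLp φ‖) :
    ‖w‖ ≤ C := by
  let K : Submodule ℝ (Lp ℝ 2 (ν.restrict U)) :=
    { carrier := {f | ∃ φ : E → ℝ, ∃ (h1 : ContDiff ℝ ∞ φ) (h2 : HasCompactSupport φ),
        tsupport φ ⊆ U ∧ f = (memLp_restrict_test h1 h2).toLp φ}
      zero_mem' := ⟨fun _ => 0, contDiff_const, HasCompactSupport.zero, by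
        rw [tsupport_eq_empty_iff.2 (show (fun _ : E => (0 : ℝ)) = 0 from rfl)]
        exact empty_subset _, (MemLp.toLp_zero _).symm⟩
      add_mem' := by
        rintro _ _ ⟨φ, h1, h2, h3, rfl⟩ ⟨ψ, g1, g2, g3, rfl⟩
        exact ⟨φ + ψ, h1.add g1, h2.add g2, (tsupport_add φ ψ).trans (union_subset h3 g3), by
          rw [← MemLp.toLp_add]⟩
      smul_mem' := by
        rintro c _ ⟨φ, h1, h2, h3, rfl⟩
        have g2 : HasCompactSupport (c • φ) := HasCompactSupport.smul_left (f := fun _ => c) h2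
        have g3 : tsupport (c • φ) ⊆ U := (tsupport_smul_subset_right (fun _ => c) φ).trans h3
        exact ⟨c • φ, h1.const_smul c, g2, g3, (MemLp.toLp_const_smul _ _).symm⟩ }
  have hK : K.topologicalClosure = ⊤ := by
    rw [Submodule.topologicalClosure_eq_top_iff, Submodule.eq_bot_iff]
    intro v hv
    have h0 : ∀ᵐ x ∂ν, x ∈ U → v x = 0 := by
      refine hU.ae_eq_zero_of_integral_contDiff_smul_eq_zero ?_ fun φ h1 h2 h3 => ?_
      · exact locallyIntegrableOn_of_locallyIntegrable_restrict
          ((Lp.memLp v).locallyIntegrable one_le_two)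
      · have h4 := (Submodule.mem_orthogonal' _ _).1 hv _ ⟨φ, h1, h2, h3, rfl⟩
        rw [inner_toLp] at h4
        rw [← h4, setIntegral_eq_integral_of_forall_compl_eq_zero]
        · simp only [smul_eq_mul, mul_comm]
        · intro x hx
          rw [image_eq_zero_of_notMem_tsupport fun hx' => hx (h3 hx'), mul_zero]
    refine Lp.ext ?_
    filter_upwards [Lp.coeFn_zero ℝ 2 (ν.restrict U),
      (ae_restrict_iff' hU.measurableSet).2 h0] with x h1 h2
    rw [h1, h2]; rfl
  have hclosed : IsClosed {f : Lp ℝ 2 (ν.restrict U) | |inner ℝ w f| ≤ C * ‖f‖} :=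
    isClosed_le (by fun_prop) (by fun_prop)
  have hsub : (K : Set (Lp ℝ 2 (ν.restrict U))) ⊆ {f | |inner ℝ w f| ≤ C * ‖f‖} := by
    rintro _ ⟨φ, h1, h2, h3, rfl⟩
    rw [mem_ofPred_eq, inner_toLp]
    exact h φ h1 h2 h3 _
  have hw : w ∈ closure (K : Set (Lp ℝ 2 (ν.restrict U))) := by
    have : w ∈ K.topologicalClosure := by rw [hK]; trivial
    exact this
  have h5 : |inner ℝ w w| ≤ C * ‖w‖ := closure_minimal hsub hclosed hw
  rw [real_inner_self_eq_norm_mul_norm, abs_mul_self] at h5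
  rcases (norm_nonneg w).eq_or_lt with h6 | h6
  · rw [← h6]; exact hC
  · nlinarith

theorem eq_of_test {U : Set E} (hU : IsOpen U) {w v : Lp ℝ 2 (ν.restrict U)}
    (h : ∀ φ : E → ℝ, ContDiff ℝ ∞ φ → HasCompactSupport φ → tsupport φ ⊆ U →
      ∫ z, w z * φ z ∂(ν.restrict U) = ∫ z, v z * φ z ∂(ν.restrict U)) : w = v := by
  rw [← sub_eq_zero, ← norm_le_zero_iff]
  refine norm_le_of_test hU _ le_rfl fun φ h1 h2 h3 hφ => ?_
  rw [← inner_toLp _ hφ, inner_sub_left, inner_toLp, inner_toLp, h φ h1 h2 h3]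
  simp

end TestFunctions

/-! ### Integrability for interchanging integrals -/

section Fubini

theorem integral_mul_le_norm {X : Type*} [MeasurableSpace X] {μ : Measure X} (w : Lp ℝ 2 μ)
    {φ : X → ℝ} (hφ : MemLp φ 2 μ) : ∫ z, ‖w z * φ z‖ ∂μ ≤ ‖w‖ * ‖hφ.toLp φ‖ := by
  have h1 := inner_toLp ((Lp.memLp w).norm.toLp) hφ.norm
  have h2 : ∫ z, ‖w z * φ z‖ ∂μ = ∫ z, (Lp.memLp w).norm.toLp (fun z => ‖w z‖) z * ‖φ z‖ ∂μ := by
    refine integral_congr_ae ?_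
    filter_upwards [(Lp.memLp w).norm.coeFn_toLp] with z hz
    rw [hz, norm_mul]
  rw [h2, ← h1]
  refine (real_inner_le_norm _ _).trans_eq ?_
  rw [Lp.norm_toLp, Lp.norm_toLp, Lp.norm_toLp, Lp.norm_def, eLpNorm_norm, eLpNorm_norm]

/-- Cauchy–Schwarz in `x`, uniformly in `a`, reduces joint integrability to integrability of `k`.
This justifies the Fubini steps with translated test functions. -/
theorem integrable_family {A X : Type*} [MeasurableSpace A] [MeasurableSpace X] {ρ : Measure A}
    {μ : Measure X} [SigmaFinite ρ] [SigmaFinite μ] (w : Lp ℝ 2 μ) {k : A → ℝ} (hk : Integrable k ρ)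
    {Ψ : A → X → ℝ} (hΨ : Measurable (Function.uncurry Ψ)) {C : ℝ}
    (hC : ∀ a, ∃ h : MemLp (Ψ a) 2 μ, ‖h.toLp (Ψ a)‖ ≤ C) :
    Integrable (fun p : A × X => k p.1 * (w p.2 * Ψ p.1 p.2)) (ρ.prod μ) := by
  have hm : AEStronglyMeasurable (fun p : A × X => k p.1 * (w p.2 * Ψ p.1 p.2)) (ρ.prod μ) :=
    hk.aestronglyMeasurable.comp_fst.mul
      (((Lp.stronglyMeasurable w).comp_measurable measurable_snd).aestronglyMeasurable.mul
        hΨ.aestronglyMeasurable)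
  rw [integrable_prod_iff hm]
  refine ⟨ae_of_all _ fun a => ?_, ?_⟩
  · exact ((Lp.memLp w).integrable_mul (hC a).choose).const_mul (k a)
  · refine Integrable.mono' (hk.norm.mul_const (‖w‖ * C)) hm.norm.integral_prod_right'
      (ae_of_all _ fun a => ?_)
    rw [Real.norm_of_nonneg (integral_nonneg fun _ => norm_nonneg _)]
    simp only [norm_mul (k a)]
    rw [integral_const_mul]
    refine mul_le_mul_of_nonneg_left ?_ (norm_nonneg _)
    exact (integral_mul_le_norm w (hC a).choose).trans
      (mul_le_mul_of_nonneg_left (hC a).choose_spec (norm_nonneg _))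

end Fubini

section Shift

variable {d : ℕ} {X : Type*} [TopologicalSpace X] [MeasurableSpace X] [BorelSpace X] {μ : Measure X}
  [R1Space X] [μ.InnerRegularCompactLTTop] [IsLocallyFiniteMeasure μ]

theorem Shift.integral_avg_mul (S : Shift d μ) (k : SchwartzMap (Cross d) ℝ) (w : Lp ℝ 2 μ)
    {φ : X → ℝ} (hφ : MemLp φ 2 μ) :
    Integrable (fun a => k a * ∫ z, w z * φ (S.toFun (-a) z) ∂μ) ∧
    ∫ z, S.avg k w z * φ z ∂μ = ∫ a, k a * ∫ z, w z * φ (S.toFun (-a) z) ∂μ := by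
  have h1 : ∀ a, inner ℝ (S.transl a w) (hφ.toLp φ) = ∫ z, w z * φ (S.toFun (-a) z) ∂μ := by
    intro a
    rw [S.inner_transl, L2.inner_def]
    refine integral_congr_ae ?_
    filter_upwards [S.coeFn_transl (-a) (hφ.toLp φ),
      (S.mp (-a)).quasiMeasurePreserving.ae_eq_comp hφ.coeFn_toLp] with z h2 h3
    rw [h2, show (hφ.toLp φ) (S.toFun (-a) z) = φ (S.toFun (-a) z) from h3]
    simp [mul_comm]
  constructor
  · have h2 := (innerSL ℝ (hφ.toLp φ)).integrable_comp (S.integrable_smul_transl k.integrable w)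
    refine h2.congr (ae_of_all _ fun a => ?_)
    simp only [innerSL_apply_apply]
    rw [real_inner_smul_right, real_inner_comm, h1]
  · rw [← inner_toLp _ hφ, S.inner_avg]
    simp only [h1]

end Shift

/-! ### Weak derivatives and traces under averaging -/

section Parts

variable {d : ℕ} {ℓ : ℝ}

theorem contDiff_translate {E : Type*} [NormedAddCommGroup E] [NormedSpace ℝ E] {φ : E → ℝ}
    (h : ContDiff ℝ ∞ φ) (v : E) : ContDiff ℝ ∞ fun z => φ (z + v) :=
  h.comp (contDiff_id.add contDiff_const)

theorem hasCompactSupport_translate {E : Type*} [NormedAddCommGroup E] {φ : E → ℝ}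
    (h : HasCompactSupport φ) (v : E) : HasCompactSupport fun z => φ (z + v) :=
  h.comp_homeomorph (Homeomorph.addRight v)

theorem tsupport_translate {E : Type*} [NormedAddCommGroup E] (φ : E → ℝ) (v : E) :
    tsupport (fun z => φ (z + v)) = (fun z => z + v) ⁻¹' tsupport φ :=
  tsupport_comp_eq_preimage φ (Homeomorph.addRight v)

theorem memLp_fderiv {i : Fin (d + 1)} {φ : Cross d × ℝ → ℝ} (h1 : ContDiff ℝ ∞ φ)
    (h2 : HasCompactSupport φ) : MemLp (fun z => fderiv ℝ φ z (dir d i)) 2 (slab d ℓ) :=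
  memLp_test ((h1.continuous_fderiv (by simp)).clm_apply continuous_const)
    (h2.fderiv_apply (𝕜 := ℝ) (dir d i))

theorem integrable_mul_test {X : Type*} [MeasurableSpace X] {μ : Measure X} (w : Lp ℝ 2 μ)
    {φ : X → ℝ} (h : MemLp φ 2 μ) : Integrable (fun z => w z * φ z) μ :=
  (Lp.memLp w).integrable_mul h

theorem slabShift_neg (a : Cross d) (z : Cross d × ℝ) :
    (slabShift d ℓ).toFun (-a) z = z + (a, 0) := by
  ext <;> simp [slabShift]

/-- The average is moved onto the test function. Horizontal translations preserve every condition on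
its support in `y`, which is why weak derivatives, the bottom condition and the top trace all pass
to averages. -/
theorem integral_parts_avg (k : SchwartzMap (Cross d) ℝ) (w g : ScalL2 d ℓ) (i : Fin (d + 1))
    {φ : Cross d × ℝ → ℝ} (h1 : ContDiff ℝ ∞ φ) (h2 : HasCompactSupport φ) :
    ∫ z, ((slabShift d ℓ).avg k w z * fderiv ℝ φ z (dir d i) + (slabShift d ℓ).avg k g z * φ z)
      ∂(slab d ℓ) = ∫ a, k a * ∫ z, (w z * fderiv ℝ (fun z => φ (z + (a, 0))) z (dir d i)
        + g z * φ (z + (a, 0))) ∂(slab d ℓ) := by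
  have m1 : MemLp (fun z => fderiv ℝ φ z (dir d i)) 2 (slab d ℓ) := memLp_fderiv h1 h2
  have m2 : MemLp φ 2 (slab d ℓ) := memLp_test h1.continuous h2
  obtain ⟨i1, e1⟩ := (slabShift d ℓ).integral_avg_mul k w m1
  obtain ⟨i2, e2⟩ := (slabShift d ℓ).integral_avg_mul k g m2
  rw [integral_add (integrable_mul_test _ m1) (integrable_mul_test _ m2), e1, e2,
    ← integral_add i1 i2]
  congr 1; ext a
  rw [← mul_add]
  congr 1
  simp only [slabShift_neg]
  rw [← integral_add]
  · simp only [fderiv_comp_add_right]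
  · have := memLp_fderiv (ℓ := ℓ) (i := i) (contDiff_translate h1 ((a, 0) : Cross d × ℝ))
      (hasCompactSupport_translate h2 ((a, 0) : Cross d × ℝ))
    simp only [fderiv_comp_add_right] at this
    exact (Lp.memLp w).integrable_mul this
  · exact (Lp.memLp g).integrable_mul (memLp_test
      (contDiff_translate h1 ((a, 0) : Cross d × ℝ)).continuous
      (hasCompactSupport_translate h2 ((a, 0) : Cross d × ℝ)))

theorem tsupport_translate_subset {I : Set ℝ} {φ : Cross d × ℝ → ℝ}
    (h : tsupport φ ⊆ univ ×ˢ I) (a : Cross d) :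
    tsupport (fun z => φ (z + (a, 0))) ⊆ univ ×ˢ I := by
  rw [tsupport_translate]
  intro z hz
  have := (h hz).2
  exact ⟨trivial, by simpa using this⟩

theorem PartsOn.avg {I : Set ℝ} {i : Fin (d + 1)} {w g : ScalL2 d ℓ}
    (h : PartsOn d ℓ I i w g) (k : SchwartzMap (Cross d) ℝ) :
    PartsOn d ℓ I i ((slabShift d ℓ).avg k w) ((slabShift d ℓ).avg k g) := by
  intro φ h1 h2 h3
  rw [integral_parts_avg k w g i h1 h2]
  refine integral_eq_zero_of_ae (ae_of_all _ fun a => ?_)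
  change k a * _ = 0
  rw [h _ (contDiff_translate h1 _) (hasCompactSupport_translate h2 _)
    (tsupport_translate_subset h3 a), mul_zero]

theorem memLp_trace_test {φ : Cross d × ℝ → ℝ} (h1 : ContDiff ℝ ∞ φ) (h2 : HasCompactSupport φ)
    (y : ℝ) : MemLp (fun x => φ (x, y)) 2 (volume : Measure (Cross d)) := by
  refine Continuous.memLp_of_hasCompactSupport (h1.continuous.comp (by fun_prop)) ?_
  refine HasCompactSupport.intro (h2.isCompact.image continuous_fst) fun x hx => ?_
  exact image_eq_zero_of_notMem_tsupport fun hx' => hx ⟨_, hx', rfl⟩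

theorem IsTopTrace.avg {w g : ScalL2 d ℓ} {τ : SurfL2 d} (h : IsTopTrace d ℓ w g τ)
    (k : SchwartzMap (Cross d) ℝ) :
    IsTopTrace d ℓ ((slabShift d ℓ).avg k w) ((slabShift d ℓ).avg k g) ((surfShift d).avg k τ) := by
  intro φ h1 h2 h3
  rw [integral_parts_avg k w g _ h1 h2]
  have e := ((surfShift d).integral_avg_mul k τ (memLp_trace_test h1 h2 ℓ)).2
  simp only [mul_comm (φ _)]
  rw [e]
  congr 1; ext a
  rw [h _ (contDiff_translate h1 _) (hasCompactSupport_translate h2 _)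
    (tsupport_translate_subset h3 a)]
  congr 2; ext x
  simp [surfShift, mul_comm]

/-- The coordinate directions of `Σ`. -/
def hdir (i : Fin d) : Cross d := EuclideanSpace.single i 1

theorem dir_castSucc (i : Fin d) : dir d i.castSucc = (hdir i, 0) := by
  simp [dir, hdir]

theorem dir_last : dir d (Fin.last d) = (0, 1) := by
  simp [dir]

theorem integral_kernel_parts (k : SchwartzMap (Cross d) ℝ) (v : Cross d) {φ : Cross d × ℝ → ℝ}
    (h1 : ContDiff ℝ ∞ φ) (h2 : HasCompactSupport φ) (z : Cross d × ℝ) :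
    ∫ a, (k a * fderiv ℝ φ (z + (a, 0)) (v, 0) + (∂_{v} k) a * φ (z + (a, 0))) = 0 := by
  have g1 : ContDiff ℝ ∞ fun a : Cross d => φ (z + (a, 0)) := by fun_prop
  have g2 : HasCompactSupport fun a : Cross d => φ (z + (a, 0)) := by
    refine HasCompactSupport.intro (h2.isCompact.image (f := fun p : Cross d × ℝ => p.1 - z.1)
      (by fun_prop)) fun x hx => ?_
    exact image_eq_zero_of_notMem_tsupport fun hx' => hx ⟨_, hx', by simp⟩
  have hd : ∀ a : Cross d, (∂_{v} (g2.toSchwartzMap g1)) a = fderiv ℝ φ (z + (a, 0)) (v, 0) := by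
    intro a
    rw [SchwartzMap.lineDerivOp_apply_eq_fderiv]
    have h3 : HasFDerivAt (fun a : Cross d => φ (z + (a, 0)))
        ((fderiv ℝ φ (z + (a, 0))).comp (ContinuousLinearMap.inl ℝ (Cross d) ℝ)) a := by
      have h4 : HasFDerivAt (fun a : Cross d => z + (a, 0))
          (ContinuousLinearMap.inl ℝ (Cross d) ℝ) a :=
        ((ContinuousLinearMap.inl ℝ (Cross d) ℝ).hasFDerivAt (x := a)).const_add z
      exact ((h1.differentiable (by simp)).differentiableAt.hasFDerivAt (x := z + (a, 0))).comp a h4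
    change fderiv ℝ (fun a : Cross d => φ (z + (a, 0))) a v = _
    rw [h3.fderiv]; simp
  have h5 := SchwartzMap.integral_mul_lineDerivOp_right_eq_neg_left (μ := volume) k (g2.toSchwartzMap g1) v
  rw [integral_add]
  · simp only [hd] at h5
    rw [h5]
    exact neg_add_cancel _
  · simp only [← hd]
    exact k.integrable.mul_bdd (c := (SchwartzMap.seminorm ℝ 0 0) (∂_{v} (g2.toSchwartzMap g1)))
      (SchwartzMap.continuous _).aestronglyMeasurable
      (ae_of_all _ fun a => SchwartzMap.norm_le_seminorm ℝ _ _)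
  · exact (∂_{v} k).integrable.mul_bdd (c := (SchwartzMap.seminorm ℝ 0 0) (g2.toSchwartzMap g1))
      (SchwartzMap.continuous (g2.toSchwartzMap g1)).aestronglyMeasurable
      (ae_of_all _ fun a => SchwartzMap.norm_le_seminorm ℝ (g2.toSchwartzMap g1) _)

theorem norm_translate_test {φ : Cross d × ℝ → ℝ} (h1 : Continuous φ) (h2 : HasCompactSupport φ)
    (v : Cross d × ℝ) : ∃ h : MemLp (fun z => φ (z + v)) 2 (slab d ℓ),
      ‖h.toLp _‖ ≤ (eLpNorm φ 2 volume).toReal := by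
  have h3 : MemLp (fun z => φ (z + v)) 2 (slab d ℓ) :=
    memLp_test (by fun_prop) (hasCompactSupport_translate h2 v)
  refine ⟨h3, ?_⟩
  rw [Lp.norm_toLp]
  refine ENNReal.toReal_mono (h1.memLp_of_hasCompactSupport h2).eLpNorm_ne_top ?_
  refine (eLpNorm_mono_measure _ Measure.restrict_le_self).trans_eq ?_
  exact eLpNorm_comp_measurePreserving (f := fun z => z + v)
    h1.aestronglyMeasurable (by
      rw [Measure.volume_eq_prod]
      exact measurePreserving_add_right _ v)

/-- Convolution with `∂_i k` is the weak derivative of the convolution with `k`. -/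
theorem partsOn_avg_deriv (k : SchwartzMap (Cross d) ℝ) (w : ScalL2 d ℓ) (i : Fin d) (I : Set ℝ) :
    PartsOn d ℓ I i.castSucc ((slabShift d ℓ).avg k w)
      ((slabShift d ℓ).avg (∂_{hdir i} k) w) := by
  intro φ h1 h2 _
  have m1 : MemLp (fun z => fderiv ℝ φ z (dir d i.castSucc)) 2 (slab d ℓ) := memLp_fderiv h1 h2
  have m2 : MemLp φ 2 (slab d ℓ) := memLp_test h1.continuous h2
  -- After both averages are moved to the test function, Fubini leaves, for each fixed `z`, an
  -- integration by parts in the translation variable `a`, namely `integral_kernel_parts`.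
  have c1 : Continuous fun z => fderiv ℝ φ z (dir d i.castSucc) :=
    (h1.continuous_fderiv (by simp)).clm_apply continuous_const
  obtain ⟨i1, e1⟩ := (slabShift d ℓ).integral_avg_mul k w m1
  obtain ⟨i2, e2⟩ := (slabShift d ℓ).integral_avg_mul (∂_{hdir i} k) w m2
  rw [integral_add (integrable_mul_test _ m1) (integrable_mul_test _ m2), e1, e2]
  simp only [slabShift_neg, dir_castSucc] at *
  have f1 := integrable_family (ρ := (volume : Measure (Cross d))) (A := Cross d) w k.integrable
    (Ψ := fun a z => fderiv ℝ φ (z + (a, 0)) (hdir i, 0))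
    (c1.comp (by fun_prop : Continuous fun p : Cross d × (Cross d × ℝ) => p.2 + (p.1, 0))).measurable
    fun a => norm_translate_test c1 (by exact h2.fderiv_apply (𝕜 := ℝ) _) (a, 0)
  have f2 := integrable_family (ρ := (volume : Measure (Cross d))) (A := Cross d) w
    (∂_{hdir i} k).integrable (Ψ := fun a z => φ (z + (a, 0)))
    (h1.continuous.comp
      (by fun_prop : Continuous fun p : Cross d × (Cross d × ℝ) => p.2 + (p.1, 0))).measurable
    fun a => norm_translate_test h1.continuous h2 (a, 0)
  simp only [← integral_const_mul]
  have s1 := integral_integral_swap (μ := volume) (ν := slab d ℓ)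
    (f := fun a z => k a * (w z * fderiv ℝ φ (z + (a, 0)) (hdir i, 0))) f1
  have s2 := integral_integral_swap (μ := volume) (ν := slab d ℓ)
    (f := fun a z => (∂_{hdir i} k) a * (w z * φ (z + (a, 0)))) f2
  rw [s1, s2, ← integral_add f1.integral_prod_right f2.integral_prod_right]
  refine integral_eq_zero_of_ae ?_
  filter_upwards [f1.prod_left_ae, f2.prod_left_ae] with z g1 g2
  rw [← integral_add g1 g2]
  have := integral_kernel_parts k (hdir i) h1 h2 z
  calc _ = ∫ a, w z * (k a * fderiv ℝ φ (z + (a, 0)) (hdir i, 0)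
        + (∂_{hdir i} k) a * φ (z + (a, 0))) := by congr 1; ext a; ring
    _ = 0 := by rw [integral_const_mul, this, mul_zero]

theorem isOpen_strip (I : Set ℝ) (hI : IsOpen I) : IsOpen ((univ : Set (Cross d)) ×ˢ I) :=
  isOpen_univ.prod hI

theorem weakPartial_unique {i : Fin (d + 1)} {w g g' : ScalL2 d ℓ} (h : HasWeakPartial d ℓ i w g)
    (h' : HasWeakPartial d ℓ i w g') : g = g' := by
  refine eq_of_test (isOpen_strip _ isOpen_Ioo) fun φ h1 h2 h3 => ?_
  have e1 := h φ h1 h2 h3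
  have e2 := h' φ h1 h2 h3
  have m1 : MemLp (fun z => fderiv ℝ φ z (dir d i)) 2 (slab d ℓ) := memLp_fderiv h1 h2
  have m2 : MemLp φ 2 (slab d ℓ) := memLp_test h1.continuous h2
  rw [integral_add (integrable_mul_test _ m1) (integrable_mul_test _ m2)] at e1 e2
  have : ∫ z, g z * φ z ∂(slab d ℓ) = ∫ z, g' z * φ z ∂(slab d ℓ) := by linarith
  exact this

/-- Both sides are weak derivatives of the same average. Thus horizontal derivatives of averaged
fields become Fourier multipliers acting on the field itself. -/
theorem avg_weakPartial {i : Fin d} {w g : ScalL2 d ℓ} (h : HasWeakPartial d ℓ i.castSucc w g)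
    (k : SchwartzMap (Cross d) ℝ) :
    (slabShift d ℓ).avg k g = (slabShift d ℓ).avg (∂_{hdir i} k) w :=
  weakPartial_unique (PartsOn.avg h k) (partsOn_avg_deriv k w i _)

theorem khat_lineDeriv (k : SchwartzMap (Cross d) ℝ) (v ξ : Cross d) :
    khat (∂_{v} k) ξ = 2 * Real.pi * Complex.I * (inner ℝ ξ v : ℝ) * khat k ξ := by
  have h0 : (∂_{v} k).postcompCLM Complex.ofRealCLM = ∂_{v} (k.postcompCLM Complex.ofRealCLM) := by
    ext x
    rw [SchwartzMap.postcompCLM_apply, SchwartzMap.lineDerivOp_apply_eq_fderiv,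
      SchwartzMap.lineDerivOp_apply_eq_fderiv]
    have h1 : HasFDerivAt (fun x => Complex.ofRealCLM (k x)) (Complex.ofRealCLM.comp (fderiv ℝ k x)) x :=
      Complex.ofRealCLM.hasFDerivAt.comp x (k.hasFDerivAt x)
    change _ = fderiv ℝ (fun x => Complex.ofRealCLM (k x)) x v
    rw [h1.fderiv]; rfl
  rw [khat, h0, SchwartzMap.fourier_lineDerivOp_eq, khat]
  have : (inner ℝ · v : Cross d → ℝ).HasTemperateGrowth := ((innerSL ℝ).flip v).hasTemperateGrowth
  rw [smul_apply, SchwartzMap.smulLeftCLM_apply_apply this]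
  rw [smul_eq_mul, Complex.real_smul]; ring

end Parts

theorem norm_le_of_test_univ {E : Type*} [NormedAddCommGroup E] [NormedSpace ℝ E]
    [FiniteDimensional ℝ E] [MeasurableSpace E] [BorelSpace E] {ν : Measure E}
    [IsLocallyFiniteMeasure ν] (w : Lp ℝ 2 ν) {C : ℝ} (hC : 0 ≤ C)
    (h : ∀ φ : E → ℝ, ContDiff ℝ ∞ φ → HasCompactSupport φ →
      ∀ hφ : MemLp φ 2 ν, |∫ z, w z * φ z ∂ν| ≤ C * ‖hφ.toLp φ‖) : ‖w‖ ≤ C := by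
  -- `Lp` over `ν.restrict univ` and `Lp` over `ν` are different types, so the measure is
  -- generalised before the equality is substituted.
  have aux : ∀ ρ (_ : ν.restrict univ = ρ) (w : Lp ℝ 2 ρ),
      (∀ φ : E → ℝ, ContDiff ℝ ∞ φ → HasCompactSupport φ →
        ∀ hφ : MemLp φ 2 ρ, |∫ z, w z * φ z ∂ρ| ≤ C * ‖hφ.toLp φ‖) → ‖w‖ ≤ C := by
    rintro _ rfl w h
    exact norm_le_of_test isOpen_univ w hC fun φ h1 h2 _ => h φ h1 h2
  exact aux ν Measure.restrict_univ w h

/-! ### Poincaré and trace inequalities in the vertical direction -/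

section Vertical

variable {d : ℕ} {ℓ : ℝ}

theorem integral_vertical_derivative {φ : Cross d × ℝ → ℝ} (h1 : ContDiff ℝ ∞ φ) (x : Cross d)
    (a b : ℝ) : ∫ t in a..b, fderiv ℝ φ (x, t) (0, 1) = φ (x, b) - φ (x, a) := by
  refine intervalIntegral.integral_eq_sub_of_hasDerivAt (f := fun t => φ (x, t)) (fun t _ => ?_) ?_
  · have h2 : HasDerivAt (fun t : ℝ => (x, t)) ((0 : Cross d), (1 : ℝ)) t :=
      (hasDerivAt_const t x).prodMk (hasDerivAt_id t)
    exact ((h1.differentiable (by simp)).differentiableAt.hasFDerivAt (x := (x, t))).comp_hasDerivAt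
      t h2
  · refine Continuous.intervalIntegrable ?_ _ _
    exact ((h1.continuous_fderiv (by simp)).comp (by fun_prop)).clm_apply continuous_const

theorem norm_toLp_test {φ : Cross d × ℝ → ℝ} (h3 : tsupport φ ⊆ univ ×ˢ Ioo 0 ℓ)
    (hφ : MemLp φ 2 (slab d ℓ)) : ‖hφ.toLp φ‖ = (eLpNorm φ 2 volume).toReal := by
  rw [Lp.norm_toLp, slab, eLpNorm_restrict_eq_of_support_subset ((subset_tsupport φ).trans h3)]

/-- By duality: a test function supported in the slab satisfies `φ(x, y) = -∫₀^ℓ ∂_y φ(x, y + t)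
dt`, because `φ(x, y + ℓ) = 0`. The shifted function `φ(·, · + t)` vanishes near the top, so it is
admissible in the bottom condition, which replaces `w ∂_y φ` by `-g φ`. Each `t` contributes at most
`‖g‖ ‖φ‖`, and there are `ℓ` of them to integrate over. -/
theorem poincare (hℓ : 0 < ℓ) {w g : ScalL2 d ℓ} (h : VanishesAtBottom d ℓ w g) :
    ‖w‖ ≤ ℓ * ‖g‖ := by
  refine norm_le_of_test (ν := volume) (U := univ ×ˢ Ioo 0 ℓ) (isOpen_strip _ isOpen_Ioo) w
    (by positivity) fun φ h1 h2 h3 hφ => ?_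
  have c1 : Continuous fun z => fderiv ℝ φ z (0, 1) :=
    (h1.continuous_fderiv (by simp)).clm_apply continuous_const
  have s1 : HasCompactSupport fun z => fderiv ℝ φ z (0, 1) := h2.fderiv_apply (𝕜 := ℝ) _
  have e1 : ∀ z ∈ (univ : Set (Cross d)) ×ˢ Ioo 0 ℓ,
      φ z = - ∫ t in Ioc 0 ℓ, fderiv ℝ φ (z + (0, t)) (0, 1) := by
    rintro ⟨x, y⟩ ⟨-, hy⟩
    have h4 := integral_vertical_derivative h1 x y (y + ℓ)
    have h5 : φ (x, y + ℓ) = 0 := image_eq_zero_of_notMem_tsupport fun hm => by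
      have := (h3 hm).2.2
      simp only at this
      linarith [hy.1]
    have h6 : ∫ t in (0 : ℝ)..ℓ, fderiv ℝ φ (x, t + y) (0, 1)
        = ∫ t in y..y + ℓ, fderiv ℝ φ (x, t) (0, 1) := by
      rw [intervalIntegral.integral_comp_add_right (fun t => fderiv ℝ φ (x, t) (0, 1)) y, zero_add,
        add_comm ℓ]
    rw [h5, ← h6, intervalIntegral.integral_of_le hℓ.le] at h4
    simp only [Prod.mk_add_mk, add_zero, add_comm y]
    rw [h4]; simp
  have f1 := integrable_family (ρ := volume.restrict (Ioc 0 ℓ)) (A := ℝ) w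
    (integrable_const (1 : ℝ)) (Ψ := fun t z => fderiv ℝ φ (z + (0, t)) (0, 1))
    (c1.comp (by fun_prop : Continuous fun p : ℝ × (Cross d × ℝ) => p.2 + (0, p.1))).measurable
    fun t => norm_translate_test c1 s1 (0, t)
  simp only [one_mul] at f1
  have e2 : ∫ z, w z * φ z ∂(slab d ℓ)
      = - ∫ z, (∫ t in Ioc 0 ℓ, w z * fderiv ℝ φ (z + (0, t)) (0, 1)) ∂(slab d ℓ) := by
    rw [← integral_neg]
    refine setIntegral_congr_fun (isOpen_strip _ isOpen_Ioo).measurableSet fun z hz => ?_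
    rw [integral_const_mul, e1 z hz, mul_neg]
  have e3 := integral_integral_swap (μ := volume.restrict (Ioc 0 ℓ)) (ν := slab d ℓ)
    (f := fun t z => w z * fderiv ℝ φ (z + (0, t)) (0, 1)) f1
  change |∫ z, w z * φ z ∂(slab d ℓ)| ≤ _
  rw [e2, ← e3, abs_neg, ← Real.norm_eq_abs]
  have key : ∀ t ∈ Ioc 0 ℓ,
      ‖∫ z, w z * fderiv ℝ φ (z + (0, t)) (0, 1) ∂(slab d ℓ)‖ ≤ ‖g‖ * ‖hφ.toLp φ‖ := by
    intro t ht
    have h4 := contDiff_translate h1 ((0, t) : Cross d × ℝ)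
    have h5 := hasCompactSupport_translate h2 ((0, t) : Cross d × ℝ)
    have h6 := h _ h4 h5 (by
      rw [tsupport_translate]
      intro z hz
      have := (h3 hz).2.2
      simp only [Prod.snd_add] at this
      exact ⟨trivial, by simp only [mem_Iio]; linarith [ht.1]⟩)
    have m1 := memLp_fderiv (ℓ := ℓ) (i := Fin.last d) h4 h5
    obtain ⟨m2, n2⟩ := norm_translate_test (ℓ := ℓ) h1.continuous h2 ((0, t) : Cross d × ℝ)
    simp only [fderiv_comp_add_right, dir_last] at h6 m1
    rw [integral_add (integrable_mul_test _ m1) (integrable_mul_test _ m2)] at h6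
    rw [eq_neg_of_add_eq_zero_left h6, norm_neg]
    refine (norm_integral_le_integral_norm _).trans ((integral_mul_le_norm g m2).trans ?_)
    exact mul_le_mul_of_nonneg_left (n2.trans_eq (norm_toLp_test h3 hφ).symm) (norm_nonneg g)
  refine (norm_setIntegral_le_of_norm_le_const (by simp) key).trans_eq ?_
  rw [Real.volume_real_Ioc_of_le hℓ.le]; ring

theorem eLpNorm_tensor {χ : ℝ → ℝ} {f : Cross d → ℝ}
    (hχ : AEStronglyMeasurable χ (volume.restrict (Ioo 0 ℓ))) (hf : AEStronglyMeasurable f volume) :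
    eLpNorm (fun z : Cross d × ℝ => χ z.2 * f z.1) 2 (slab d ℓ)
      = eLpNorm χ 2 (volume.restrict (Ioo 0 ℓ)) * eLpNorm f 2 volume := by
  simp only [eLpNorm_eq_lintegral_rpow_enorm_toReal two_ne_zero ENNReal.ofNat_ne_top]
  rw [← ENNReal.mul_rpow_of_nonneg _ _ (by positivity), mul_comm (lintegral _ _),
    ← lintegral_prod_mul (hf.enorm.pow_const _) (hχ.enorm.pow_const _), ← slab_eq_prod]
  congr 1
  refine lintegral_congr fun z => ?_
  rw [enorm_mul, ENNReal.mul_rpow_of_nonneg _ _ (by positivity), mul_comm]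

/-- A cutoff equal to `1` on `[0, ℓ]`, split into a part vanishing near `{y = ℓ}` and one vanishing
near `{y = 0}`. -/
theorem exists_cutoff (hℓ : 0 < ℓ) : ∃ ζ₁ ζ₂ : ℝ → ℝ, ContDiff ℝ ∞ ζ₁ ∧ ContDiff ℝ ∞ ζ₂ ∧
    HasCompactSupport ζ₁ ∧ HasCompactSupport ζ₂ ∧ tsupport ζ₁ ⊆ Iio ℓ ∧ tsupport ζ₂ ⊆ Ioi 0 ∧
    (∀ y ∈ Ioo 0 ℓ, ζ₁ y + ζ₂ y = 1) ∧ ζ₂ ℓ = 1 := by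
  -- The bump equals `1` on `[-ℓ/2, 3ℓ/2]` and serves only to make supports compact; the transition
  -- `η` rises from `0` to `1` on `[ℓ/3, 2ℓ/3]`.
  let b : ContDiffBump (ℓ / 2) := ⟨ℓ, 2 * ℓ, hℓ, by linarith⟩
  let η : ℝ → ℝ := fun y => Real.smoothTransition (3 * y / ℓ - 1)
  have hη : ContDiff ℝ ∞ η := Real.smoothTransition.contDiff.comp (by fun_prop)
  have hb : ∀ y, |y - ℓ / 2| ≤ ℓ → b y = 1 := fun y hy =>
    b.one_of_mem_closedBall (by rwa [Metric.mem_closedBall, Real.dist_eq])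
  refine ⟨fun y => (1 - η y) * b y, fun y => η y * b y, (contDiff_const.sub hη).mul b.contDiff,
    hη.mul b.contDiff, b.hasCompactSupport.mul_left, b.hasCompactSupport.mul_left, ?_, ?_, ?_, ?_⟩
  · refine (closure_minimal ?_ (isClosed_Iic (a := 2 * ℓ / 3))).trans
      (Iic_subset_Iio.2 (by linarith))
    intro y hy
    by_contra hy'
    refine hy ?_
    have : η y = 1 := Real.smoothTransition.one_of_one_le (by
      rw [mem_Iic, not_le] at hy'
      rw [le_sub_iff_add_le, le_div_iff₀ hℓ]; linarith)
    simp [this]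
  · refine (closure_minimal ?_ (isClosed_Ici (a := ℓ / 3))).trans
      (Ici_subset_Ioi.2 (by linarith))
    intro y hy
    by_contra hy'
    refine hy ?_
    have : η y = 0 := Real.smoothTransition.zero_of_nonpos (by
      rw [mem_Ici, not_le] at hy'
      rw [sub_nonpos, div_le_iff₀ hℓ]; linarith)
    simp [this]
  · intro y hy
    simp only
    rw [hb y (by rw [abs_le]; constructor <;> linarith [hy.1, hy.2])]; ring
  · simp only
    rw [hb ℓ (by rw [abs_le]; constructor <;> linarith), mul_one]
    refine Real.smoothTransition.one_of_one_le ?_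
    rw [le_sub_iff_add_le, le_div_iff₀ hℓ]; linarith

theorem fderiv_tensor {ψ : Cross d → ℝ} {ζ : ℝ → ℝ} (hψ : ContDiff ℝ ∞ ψ) (hζ : ContDiff ℝ ∞ ζ)
    (z : Cross d × ℝ) :
    fderiv ℝ (fun z : Cross d × ℝ => ψ z.1 * ζ z.2) z (0, 1) = ψ z.1 * deriv ζ z.2 := by
  have h1 : HasFDerivAt (fun z : Cross d × ℝ => ψ z.1) ((fderiv ℝ ψ z.1).comp
      (ContinuousLinearMap.fst ℝ (Cross d) ℝ)) z :=
    ((hψ.differentiable (by simp)).differentiableAt.hasFDerivAt (x := z.1)).comp z hasFDerivAt_fst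
  have h2 : HasFDerivAt (fun z : Cross d × ℝ => ζ z.2) ((fderiv ℝ ζ z.2).comp
      (ContinuousLinearMap.snd ℝ (Cross d) ℝ)) z :=
    ((hζ.differentiable (by simp)).differentiableAt.hasFDerivAt (x := z.2)).comp z hasFDerivAt_snd
  have h3 : HasFDerivAt (fun z : Cross d × ℝ => ψ z.1 * ζ z.2) _ z := h1.mul h2
  rw [h3.fderiv]
  simp

theorem hasCompactSupport_tensor {ψ : Cross d → ℝ} {ζ : ℝ → ℝ} (hψ : HasCompactSupport ψ)
    (hζ : HasCompactSupport ζ) : HasCompactSupport fun z : Cross d × ℝ => ψ z.1 * ζ z.2 := by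
  refine HasCompactSupport.intro (hψ.isCompact.prod hζ.isCompact) fun z hz => ?_
  by_cases h : z.1 ∈ tsupport ψ
  · rw [image_eq_zero_of_notMem_tsupport fun h' => hz ⟨h, h'⟩, mul_zero]
  · rw [image_eq_zero_of_notMem_tsupport h, zero_mul]

theorem tsupport_tensor {ψ : Cross d → ℝ} {ζ : ℝ → ℝ} {I : Set ℝ} (h : tsupport ζ ⊆ I) :
    tsupport (fun z : Cross d × ℝ => ψ z.1 * ζ z.2) ⊆ univ ×ˢ I := by
  refine (closure_minimal (t := univ ×ˢ tsupport ζ) (fun z hz => ⟨trivial, ?_⟩)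
    (isClosed_univ.prod (isClosed_tsupport ζ))).trans (prod_mono le_rfl h)
  by_contra h'
  exact hz (by simp [image_eq_zero_of_notMem_tsupport h'])

/-- The trace theorem on `{y = ℓ}`. -/
theorem norm_trace_le (hℓ : 0 < ℓ) {w g : ScalL2 d ℓ} {τ : SurfL2 d} (h : VanishesAtBottom d ℓ w g)
    (hτ : IsTopTrace d ℓ w g τ) : ‖τ‖ ≤ √ℓ * ‖g‖ := by
  obtain ⟨ζ₁, ζ₂, c1, c2, s1, s2, t1, t2, hsum, hone⟩ := exists_cutoff hℓ
  have key : ∀ φ : Cross d → ℝ, ContDiff ℝ ∞ φ → HasCompactSupport φ →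
      ∀ hφ : MemLp φ 2 volume, |∫ x, τ x * φ x| ≤ √ℓ * ‖g‖ * ‖hφ.toLp φ‖ := by
    intro ψ h1 h2 hψ
    -- The bottom condition is tested with `ψ ζ₁`, the trace identity with `ψ ζ₂`. As `ζ₁ + ζ₂ = 1`
    -- inside the slab, the sum reads `∫ τ ψ = ∫ g ψ(x)`, and Cauchy–Schwarz gives the factor `√ℓ`.
    have C1 : ContDiff ℝ ∞ fun z : Cross d × ℝ => ψ z.1 * ζ₁ z.2 :=
      (h1.comp contDiff_fst).mul (c1.comp contDiff_snd)
    have C2 : ContDiff ℝ ∞ fun z : Cross d × ℝ => ψ z.1 * ζ₂ z.2 :=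
      (h1.comp contDiff_fst).mul (c2.comp contDiff_snd)
    have S1 := hasCompactSupport_tensor h2 s1
    have S2 := hasCompactSupport_tensor h2 s2
    have e1 := h _ C1 S1 (tsupport_tensor t1)
    have e2 := hτ _ C2 S2 (tsupport_tensor t2)
    have m := fun {φ : Cross d × ℝ → ℝ} (c : ContDiff ℝ ∞ φ) (s : HasCompactSupport φ) =>
      integrable_parts (Fin.last d) (Lp.memLp w) (Lp.memLp g) c s
    have e3 := integral_add (m C1 S1) (m C2 S2)
    rw [e1, e2, zero_add] at e3
    simp only [dir_last, fderiv_tensor h1 c1, fderiv_tensor h1 c2, hone, mul_one] at e3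
    have e4 : ∫ x, τ x * ψ x = ∫ z, g z * ψ z.1 ∂(slab d ℓ) := by
      rw [show ∫ x, τ x * ψ x = ∫ x, ψ x * τ x by simp only [mul_comm], ← e3]
      refine setIntegral_congr_fun (isOpen_strip _ isOpen_Ioo).measurableSet fun z hz => ?_
      have h3 := hsum z.2 hz.2
      have h4 : deriv ζ₁ z.2 + deriv ζ₂ z.2 = 0 := by
        have h5 : HasDerivAt (fun y => ζ₁ y + ζ₂ y) (deriv ζ₁ z.2 + deriv ζ₂ z.2) z.2 :=
          (c1.differentiable (by simp)).differentiableAt.hasDerivAt.add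
            (c2.differentiable (by simp)).differentiableAt.hasDerivAt
        have h6 : HasDerivAt (fun y => ζ₁ y + ζ₂ y) 0 z.2 :=
          (hasDerivAt_const z.2 (1 : ℝ)).congr_of_eventuallyEq (by
            filter_upwards [isOpen_Ioo.mem_nhds hz.2] with y hy using hsum y hy)
        exact h5.unique h6
      linear_combination g z * ψ z.1 * h3 + w z * ψ z.1 * h4
    have hE : eLpNorm (fun z : Cross d × ℝ => ψ z.1) 2 (slab d ℓ)
        = ENNReal.ofReal √ℓ * eLpNorm ψ 2 volume := by
      have := eLpNorm_tensor (ℓ := ℓ) (aestronglyMeasurable_const (b := (1 : ℝ)))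
        h1.continuous.aestronglyMeasurable
      simp only [one_mul] at this
      rw [this, eLpNorm_const _ (by simp) (by simp [hℓ])]
      simp [← ENNReal.ofReal_rpow_of_pos hℓ, Real.sqrt_eq_rpow]
    have m2 : MemLp (fun z : Cross d × ℝ => ψ z.1) 2 (slab d ℓ) :=
      ⟨(h1.continuous.comp continuous_fst).aestronglyMeasurable, by
        rw [hE]; exact ENNReal.mul_lt_top ENNReal.ofReal_lt_top hψ.2⟩
    rw [e4, ← Real.norm_eq_abs]
    refine (norm_integral_le_integral_norm _).trans ((integral_mul_le_norm g m2).trans_eq ?_)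
    rw [Lp.norm_toLp, Lp.norm_toLp, hE, ENNReal.toReal_mul, ENNReal.toReal_ofReal (by positivity)]
    ring
  exact norm_le_of_test_univ τ (by positivity) key

end Vertical

/-! ### Products of a vertical profile and a surface function -/

section Tensor

variable {d : ℕ} {ℓ : ℝ}

theorem memLp_vertical {χ : ℝ → ℝ} (hχ : Continuous χ) :
    MemLp χ 2 (volume.restrict (Ioo 0 ℓ)) := by
  obtain ⟨C, hC⟩ := isCompact_Icc.exists_bound_of_continuousOn (hχ.continuousOn (s := Icc 0 ℓ))
  exact MemLp.of_bound hχ.aestronglyMeasurable C ((ae_restrict_iff' measurableSet_Ioo).2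
    (ae_of_all _ fun y hy => hC y (Ioo_subset_Icc_self hy)))

theorem memLp_tensor {χ : ℝ → ℝ} (hχ : Continuous χ) (f : SurfL2 d) :
    MemLp (fun z : Cross d × ℝ => χ z.2 * f z.1) 2 (slab d ℓ) := by
  refine ⟨(hχ.comp continuous_snd).aestronglyMeasurable.mul
    ((Lp.stronglyMeasurable f).comp_measurable measurable_fst).aestronglyMeasurable, ?_⟩
  rw [eLpNorm_tensor hχ.aestronglyMeasurable (Lp.aestronglyMeasurable f)]
  exact ENNReal.mul_lt_top (memLp_vertical hχ).2 (Lp.memLp f).2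

theorem ae_slab_fst {p : Cross d → Prop} (h : ∀ᵐ x, p x) : ∀ᵐ z ∂(slab d ℓ), p z.1 := by
  rw [slab_eq_prod]
  exact Measure.quasiMeasurePreserving_fst.ae h

/-- The bounded operator `f ↦ χ(y) f(x)`. -/
def tensorL (d : ℕ) (ℓ : ℝ) {χ : ℝ → ℝ} (hχ : Continuous χ) : SurfL2 d →L[ℝ] ScalL2 d ℓ :=
  LinearMap.mkContinuous
    { toFun := fun f => (memLp_tensor hχ f).toLp _
      map_add' := fun f g => by
        rw [← MemLp.toLp_add, MemLp.toLp_eq_toLp_iff]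
        filter_upwards [ae_slab_fst (Lp.coeFn_add f g)] with z hz
        rw [Pi.add_apply, hz, Pi.add_apply, mul_add]
      map_smul' := fun c f => by
        rw [RingHom.id_apply, ← MemLp.toLp_const_smul, MemLp.toLp_eq_toLp_iff]
        filter_upwards [ae_slab_fst (Lp.coeFn_smul c f)] with z hz
        rw [Pi.smul_apply, hz, Pi.smul_apply, smul_eq_mul, smul_eq_mul]; ring }
    (eLpNorm χ 2 (volume.restrict (Ioo 0 ℓ))).toReal fun f => by
      change ‖(memLp_tensor hχ f).toLp _‖ ≤ _
      rw [Lp.norm_toLp, eLpNorm_tensor hχ.aestronglyMeasurable (Lp.aestronglyMeasurable f),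
        ENNReal.toReal_mul, Lp.norm_def]

theorem coeFn_tensorL {χ : ℝ → ℝ} (hχ : Continuous χ) (f : SurfL2 d) :
    tensorL d ℓ hχ f =ᵐ[slab d ℓ] fun z => χ z.2 * f z.1 :=
  (memLp_tensor hχ f).coeFn_toLp

/-- The factor `√(ℓ - a)` records the gain from concentrating the profile in a thin layer below the
top. -/
theorem norm_tensorL_le {χ : ℝ → ℝ} (hχ : Continuous χ) {a C : ℝ} (haℓ : a ≤ ℓ)
    (hC : ∀ y ∈ Ioo 0 ℓ, |χ y| ≤ C) (h0 : ∀ y ∈ Ioo 0 ℓ, y ≤ a → χ y = 0) (hC0 : 0 ≤ C)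
    (f : SurfL2 d) : ‖tensorL d ℓ hχ f‖ ≤ C * √(ℓ - a) * ‖f‖ := by
  change ‖(memLp_tensor hχ f).toLp _‖ ≤ _
  rw [Lp.norm_toLp, eLpNorm_tensor hχ.aestronglyMeasurable (Lp.aestronglyMeasurable f),
    ENNReal.toReal_mul, Lp.norm_def]
  gcongr
  have h1 : eLpNorm χ 2 (volume.restrict (Ioo 0 ℓ)) ≤ eLpNorm ((Ioo a ℓ).indicator fun _ => C) 2
      volume := by
    refine (eLpNorm_mono_ae (g := (Ioo a ℓ).indicator fun _ => C) ?_).trans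
      (eLpNorm_mono_measure _ Measure.restrict_le_self)
    refine (ae_restrict_iff' measurableSet_Ioo).2 (ae_of_all _ fun y hy => ?_)
    by_cases h : y ≤ a
    · rw [h0 y hy h]; simp
    · rw [indicator_of_mem (show y ∈ Ioo a ℓ from ⟨not_le.1 h, hy.2⟩), Real.norm_eq_abs,
        Real.norm_eq_abs, abs_of_nonneg hC0]
      exact hC y hy
  rw [eLpNorm_indicator_const measurableSet_Ioo two_ne_zero ENNReal.ofNat_ne_top,
    Real.volume_Ioo] at h1
  refine (ENNReal.toReal_mono (by finiteness) h1).trans_eq ?_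
  rw [ENNReal.toReal_mul, ← ENNReal.toReal_rpow, ENNReal.toReal_ofReal (by linarith),
    Real.sqrt_eq_rpow, toReal_enorm, Real.norm_of_nonneg hC0]
  norm_num

theorem tensorL_avg {χ : ℝ → ℝ} (hχ : Continuous χ) (k : SchwartzMap (Cross d) ℝ) (f : SurfL2 d) :
    tensorL d ℓ hχ ((surfShift d).avg k f) = (slabShift d ℓ).avg k (tensorL d ℓ hχ f) := by
  rw [Shift.map_avg, Shift.avg_apply]
  refine integral_congr_ae (ae_of_all _ fun a => ?_)
  simp only
  congr 1
  refine Lp.ext ?_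
  filter_upwards [coeFn_tensorL hχ ((surfShift d).transl a f),
    (slabShift d ℓ).coeFn_transl a (tensorL d ℓ hχ f), ae_slab_fst ((surfShift d).coeFn_transl a f),
    ((slabShift d ℓ).mp a).quasiMeasurePreserving.ae (coeFn_tensorL hχ f)] with z h1 h2 h3 h4
  rw [h1, h2, h3, h4]
  rfl

/-- On each vertical line this is the fundamental theorem of calculus, with the lower boundary term
killed by `χ 0 = 0`. It yields both the bottom condition and the top trace. -/
theorem tensor_parts (hℓ : 0 < ℓ) {χ : ℝ → ℝ} (hχ : ContDiff ℝ ∞ χ) (h0 : χ 0 = 0) (f : SurfL2 d)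
    (hχ' : Continuous (deriv χ)) {φ : Cross d × ℝ → ℝ} (h1 : ContDiff ℝ ∞ φ)
    (h2 : HasCompactSupport φ) :
    ∫ z, (tensorL d ℓ hχ.continuous f z * fderiv ℝ φ z (dir d (Fin.last d))
      + tensorL d ℓ hχ' f z * φ z) ∂(slab d ℓ) = ∫ x, φ (x, ℓ) * (χ ℓ * f x) := by
  have e1 := integrable_parts (ℓ := ℓ) (Fin.last d) (memLp_tensor hχ.continuous f) (memLp_tensor hχ' f) h1 h2
  have e2 : ∫ z, (tensorL d ℓ hχ.continuous f z * fderiv ℝ φ z (dir d (Fin.last d))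
      + tensorL d ℓ hχ' f z * φ z) ∂(slab d ℓ) = ∫ z, (χ z.2 * f z.1 *
        fderiv ℝ φ z (dir d (Fin.last d)) + deriv χ z.2 * f z.1 * φ z) ∂(slab d ℓ) := by
    refine integral_congr_ae ?_
    filter_upwards [coeFn_tensorL hχ.continuous f, coeFn_tensorL hχ' f] with z h3 h4
    rw [h3, h4]
  rw [e2]
  rw [slab_eq_prod] at e1 ⊢
  rw [integral_prod _ e1]
  refine integral_congr_ae (ae_of_all _ fun x => ?_)
  simp only [dir_last]
  rw [← integral_Ioc_eq_integral_Ioo, ← intervalIntegral.integral_of_le hℓ.le]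
  have h3 : ∀ y ∈ uIcc 0 ℓ, HasDerivAt (fun y => f x * (χ y * φ (x, y)))
      (χ y * f x * fderiv ℝ φ (x, y) (0, 1) + deriv χ y * f x * φ (x, y)) y := by
    intro y _
    have h4 : HasDerivAt (fun t : ℝ => (x, t)) ((0 : Cross d), (1 : ℝ)) y :=
      (hasDerivAt_const y x).prodMk (hasDerivAt_id y)
    have h5 := ((h1.differentiable (by simp)).differentiableAt.hasFDerivAt
      (x := (x, y))).comp_hasDerivAt y h4
    have h6 := ((hχ.differentiable (by simp)).differentiableAt.hasDerivAt.mul h5).const_mul (f x)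
    refine h6.congr_deriv ?_
    simp only [Function.comp_apply]
    ring
  rw [intervalIntegral.integral_eq_sub_of_hasDerivAt h3]
  · simp only [h0]; ring
  · refine Continuous.intervalIntegrable ?_ _ _
    have c1 : Continuous fun y : ℝ => fderiv ℝ φ (x, y) (0, 1) :=
      ((h1.continuous_fderiv (by simp)).comp (by fun_prop)).clm_apply continuous_const
    have c2 : Continuous fun y : ℝ => φ (x, y) := h1.continuous.comp (by fun_prop)
    have := hχ.continuous
    fun_prop

theorem vanishesAtBottom_tensorL (hℓ : 0 < ℓ) {χ : ℝ → ℝ} (hχ : ContDiff ℝ ∞ χ) (h0 : χ 0 = 0)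
    (f : SurfL2 d) (hχ' : Continuous (deriv χ)) :
    VanishesAtBottom d ℓ (tensorL d ℓ hχ.continuous f) (tensorL d ℓ hχ' f) := by
  intro φ h1 h2 h3
  rw [tensor_parts hℓ hχ h0 f hχ' h1 h2]
  have : ∀ x : Cross d, φ (x, ℓ) = 0 := fun x =>
    image_eq_zero_of_notMem_tsupport fun hm => lt_irrefl ℓ (h3 hm).2
  simp [this]

theorem isTopTrace_tensorL (hℓ : 0 < ℓ) {χ : ℝ → ℝ} (hχ : ContDiff ℝ ∞ χ) (h0 : χ 0 = 0)
    (f : SurfL2 d) (hχ' : Continuous (deriv χ)) (h1 : χ ℓ = 1) :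
    IsTopTrace d ℓ (tensorL d ℓ hχ.continuous f) (tensorL d ℓ hχ' f) f := by
  intro φ g1 g2 _
  rw [tensor_parts hℓ hχ h0 f hχ' g1 g2, h1]
  simp

end Tensor

/-! ### Components of vector fields -/

section Components

variable {d : ℕ} {ℓ : ℝ} {ι : Type*} [Fintype ι]

/-- The `j`-th component of a vector valued `L²` function. -/
def comp (j : ι) : Lp (EuclideanSpace ℝ ι) 2 (slab d ℓ) →L[ℝ] ScalL2 d ℓ :=
  (EuclideanSpace.proj (𝕜 := ℝ) j : EuclideanSpace ℝ ι →L[ℝ] ℝ).compLpL 2 (slab d ℓ)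

theorem coeFn_comp (j : ι) (w : Lp (EuclideanSpace ℝ ι) 2 (slab d ℓ)) :
    comp j w =ᵐ[slab d ℓ] fun z => w z j :=
  ContinuousLinearMap.coeFn_compLpL _ w

variable {E : Type*} [NormedAddCommGroup E] [NormedSpace ℝ E]

/-- The vector valued operator with given components. -/
def assemble [DecidableEq ι] (A : ι → E →L[ℝ] ScalL2 d ℓ) : E →L[ℝ] Lp (EuclideanSpace ℝ ι) 2 (slab d ℓ) :=
  ∑ j, ((ContinuousLinearMap.toSpanSingleton ℝ
    (EuclideanSpace.single j (1 : ℝ) : EuclideanSpace ℝ ι)).compLpL 2 (slab d ℓ)).comp (A j)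

theorem comp_assemble [DecidableEq ι] (A : ι → E →L[ℝ] ScalL2 d ℓ) (j : ι) (x : E) :
    comp j (assemble A x) = A j x := by
  rw [assemble, sum_apply, map_sum, Finset.sum_eq_single j]
  · refine Lp.ext ?_
    refine (coeFn_comp j _).trans ?_
    filter_upwards [ContinuousLinearMap.coeFn_compLpL (p := 2) (μ := slab d ℓ)
      (ContinuousLinearMap.toSpanSingleton ℝ (EuclideanSpace.single j (1 : ℝ) : EuclideanSpace ℝ ι))
      (A j x)] with z hz
    rw [ContinuousLinearMap.comp_apply, hz]
    simp
  · intro i _ hi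
    refine Lp.ext ?_
    refine (coeFn_comp j _).trans ?_
    filter_upwards [ContinuousLinearMap.coeFn_compLpL (p := 2) (μ := slab d ℓ)
      (ContinuousLinearMap.toSpanSingleton ℝ (EuclideanSpace.single i (1 : ℝ) : EuclideanSpace ℝ ι))
      (A i x), Lp.coeFn_zero ℝ 2 (slab d ℓ)] with z hz h0
    rw [ContinuousLinearMap.comp_apply, hz, h0]
    simp [hi.symm]
  · simp

theorem inner_eq_sum_comp (w v : Lp (EuclideanSpace ℝ ι) 2 (slab d ℓ)) :
    inner ℝ w v = ∑ j, inner ℝ (comp j w) (comp j v) := by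
  simp only [L2.inner_def]
  rw [← integral_finsetSum]
  · refine integral_congr_ae ?_
    filter_upwards [ae_all_iff.2 fun j => coeFn_comp j w, ae_all_iff.2 fun j => coeFn_comp j v]
      with z h1 h2
    rw [PiLp.inner_apply]
    exact Finset.sum_congr rfl fun j _ => by rw [h1, h2]
  · intro j _
    exact L2.integrable_inner _ _

theorem norm_sq_eq_sum_comp (w : Lp (EuclideanSpace ℝ ι) 2 (slab d ℓ)) :
    ‖w‖ ^ 2 = ∑ j, ‖comp j w‖ ^ 2 := by
  rw [← real_inner_self_eq_norm_sq, inner_eq_sum_comp]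
  simp only [real_inner_self_eq_norm_sq]

theorem ext_comp {w v : Lp (EuclideanSpace ℝ ι) 2 (slab d ℓ)} (h : ∀ j, comp j w = comp j v) :
    w = v := by
  rw [← sub_eq_zero, ← norm_eq_zero, ← sq_eq_zero_iff, norm_sq_eq_sum_comp]
  simp [h]

end Components

/-! ### The energy space as a Hilbert space -/

section Hel

variable {d : ℕ} {ℓ : ℝ}

theorem PartsOn.congr {I : Set ℝ} {i : Fin (d + 1)} {w g w' g' : Cross d × ℝ → ℝ}
    (hw : w =ᵐ[slab d ℓ] w') (hg : g =ᵐ[slab d ℓ] g') (h : PartsOn d ℓ I i w g) :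
    PartsOn d ℓ I i w' g' := by
  intro φ h1 h2 h3
  rw [← h φ h1 h2 h3]
  refine integral_congr_ae ?_
  filter_upwards [hw, hg] with z h4 h5
  rw [h4, h5]

theorem IsTopTrace.congr {w g w' g' : Cross d × ℝ → ℝ} {τ : Cross d → ℝ}
    (hw : w =ᵐ[slab d ℓ] w') (hg : g =ᵐ[slab d ℓ] g') (h : IsTopTrace d ℓ w g τ) :
    IsTopTrace d ℓ w' g' τ := by
  intro φ h1 h2 h3
  rw [← h φ h1 h2 h3]
  refine integral_congr_ae ?_
  filter_upwards [hw, hg] with z h4 h5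
  rw [h4, h5]

theorem partsOn_comp_iff {ι κ : Type*} [Fintype ι] [Fintype κ] {I : Set ℝ} {i : Fin (d + 1)}
    (w : Lp (EuclideanSpace ℝ ι) 2 (slab d ℓ)) (g : Lp (EuclideanSpace ℝ κ) 2 (slab d ℓ))
    (j : ι) (k : κ) : PartsOn d ℓ I i (fun z => w z j) (fun z => g z k)
      ↔ PartsOn d ℓ I i (comp j w) (comp k g) :=
  ⟨PartsOn.congr (coeFn_comp j w).symm (coeFn_comp k g).symm,
    PartsOn.congr (coeFn_comp j w) (coeFn_comp k g)⟩

theorem sum_comp_eq_zero_iff (G : MatL2 d ℓ) :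
    (∀ᵐ z ∂(slab d ℓ), ∑ i, G z (i, i) = 0) ↔ ∑ i, comp (i, i) G = 0 := by
  rw [Lp.eq_zero_iff_ae_eq_zero]
  refine eventually_congr ?_
  filter_upwards [Lp.coeFn_finsetSum Finset.univ fun i => comp (d := d) (ℓ := ℓ) (i, i) G,
    ae_all_iff.2 fun i => coeFn_comp (d := d) (ℓ := ℓ) (i, i) G] with z h1 h2
  rw [h1, Finset.sum_apply, Pi.zero_apply, Finset.sum_congr rfl fun i _ => h2 i]

theorem isHelField_iff (p : WithLp 2 (VecL2 d ℓ × MatL2 d ℓ)) : IsHelField d ℓ p ↔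
    (∀ i j, HasWeakPartial d ℓ i (comp j p.fst) (comp (i, j) p.snd)) ∧
    (∀ j, VanishesAtBottom d ℓ (comp j p.fst) (comp (Fin.last d, j) p.snd)) ∧
    ∑ i, comp (i, i) p.snd = 0 :=
  ⟨fun h => ⟨fun i j => (partsOn_comp_iff _ _ _ _).1 (h.weakGrad i j),
    fun j => (partsOn_comp_iff _ _ _ _).1 (h.bottom j), (sum_comp_eq_zero_iff _).1 h.divFree⟩,
  fun h => ⟨fun i j => (partsOn_comp_iff _ _ _ _).2 (h.1 i j),
    fun j => (partsOn_comp_iff _ _ _ _).2 (h.2.1 j), (sum_comp_eq_zero_iff _).2 h.2.2⟩⟩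

theorem isClosed_partsOn {X : Type*} [TopologicalSpace X] {W G : X → ScalL2 d ℓ}
    (hW : Continuous W) (hG : Continuous G) (I : Set ℝ) (i : Fin (d + 1)) :
    IsClosed {x | PartsOn d ℓ I i (W x) (G x)} := by
  simp only [PartsOn, ofPred_forall]
  refine isClosed_iInter fun φ => isClosed_iInter fun h1 => isClosed_iInter fun h2 =>
    isClosed_iInter fun _ => ?_
  have m1 : MemLp (fun z => fderiv ℝ φ z (dir d i)) 2 (slab d ℓ) := memLp_fderiv h1 h2
  have m2 : MemLp φ 2 (slab d ℓ) := memLp_test h1.continuous h2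
  have e : ∀ x, ∫ z, (W x z * fderiv ℝ φ z (dir d i) + G x z * φ z) ∂(slab d ℓ)
      = inner ℝ (W x) (m1.toLp _) + inner ℝ (G x) (m2.toLp _) := fun x => by
    rw [integral_add (integrable_mul_test _ m1) (integrable_mul_test _ m2), inner_toLp, inner_toLp]
  simp only [e]
  exact isClosed_eq (by fun_prop) (by fun_prop)

/-- Each defining condition is a continuous linear equation, most of them against fixed test
functions. The resulting completeness is needed for adjoints, Riesz representation and Lax–Milgram.
-/
theorem isClosed_Hel : IsClosed (Hel d ℓ : Set (WithLp 2 (VecL2 d ℓ × MatL2 d ℓ))) := by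
  have : (Hel d ℓ : Set (WithLp 2 (VecL2 d ℓ × MatL2 d ℓ))) =
      (⋂ i, ⋂ j, {p | PartsOn d ℓ (Ioo 0 ℓ) i (comp j p.fst) (comp (i, j) p.snd)}) ∩
      ((⋂ j, {p | PartsOn d ℓ (Iio ℓ) (Fin.last d) (comp j p.fst) (comp (Fin.last d, j) p.snd)}) ∩
      {p | ∑ i, comp (i, i) p.snd = 0}) := by
    ext p
    simp only [mem_inter_iff, mem_iInter]
    exact isHelField_iff p
  rw [this]
  have c1 : Continuous fun p : WithLp 2 (VecL2 d ℓ × MatL2 d ℓ) => p.fst :=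
    (WithLp.fstL 2 ℝ (VecL2 d ℓ) (MatL2 d ℓ)).continuous
  have c2 : Continuous fun p : WithLp 2 (VecL2 d ℓ × MatL2 d ℓ) => p.snd :=
    (WithLp.sndL 2 ℝ (VecL2 d ℓ) (MatL2 d ℓ)).continuous
  refine IsClosed.inter ?_ (IsClosed.inter ?_ ?_)
  · exact isClosed_iInter fun i => isClosed_iInter fun j =>
      isClosed_partsOn (by fun_prop) (by fun_prop) _ _
  · exact isClosed_iInter fun j => isClosed_partsOn (by fun_prop) (by fun_prop) _ _
  · exact isClosed_eq (by fun_prop) continuous_const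

instance : CompleteSpace (Hel d ℓ) := isClosed_Hel.completeSpace_coe

/-- The components of a field. -/
def Hel.u (j : Fin (d + 1)) : Hel d ℓ →L[ℝ] ScalL2 d ℓ :=
  ((comp j).comp (WithLp.fstL 2 ℝ (VecL2 d ℓ) (MatL2 d ℓ))).comp (Hel d ℓ).subtypeL

/-- The entries `∂_i v_j` of the gradient. -/
def Hel.G (i j : Fin (d + 1)) : Hel d ℓ →L[ℝ] ScalL2 d ℓ :=
  ((comp (i, j)).comp (WithLp.sndL 2 ℝ (VecL2 d ℓ) (MatL2 d ℓ))).comp (Hel d ℓ).subtypeL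

/-- The embedding of the energy space into `L²`. -/
def Hel.fieldL (d : ℕ) (ℓ : ℝ) : Hel d ℓ →L[ℝ] VecL2 d ℓ :=
  (WithLp.fstL 2 ℝ (VecL2 d ℓ) (MatL2 d ℓ)).comp (Hel d ℓ).subtypeL

theorem Hel.fieldL_apply (v : Hel d ℓ) : Hel.fieldL d ℓ v = Hel.field v := rfl

theorem Hel.comp_field (v : Hel d ℓ) (j : Fin (d + 1)) : comp j (Hel.field v) = Hel.u j v := rfl

theorem Hel.comp_grad (v : Hel d ℓ) (i j : Fin (d + 1)) :
    comp (i, j) (Hel.grad v) = Hel.G i j v := rfl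

theorem Hel.weakPartial (v : Hel d ℓ) (i j : Fin (d + 1)) :
    HasWeakPartial d ℓ i (Hel.u j v) (Hel.G i j v) :=
  ((isHelField_iff v.1).1 v.2).1 i j

theorem Hel.vanishes (v : Hel d ℓ) (j : Fin (d + 1)) :
    VanishesAtBottom d ℓ (Hel.u j v) (Hel.G (Fin.last d) j v) :=
  ((isHelField_iff v.1).1 v.2).2.1 j

theorem Hel.div_eq_zero (v : Hel d ℓ) : ∑ i, Hel.G i i v = 0 :=
  ((isHelField_iff v.1).1 v.2).2.2

/-- The gradient component is determined by the field, by uniqueness of weak derivatives. -/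
theorem Hel.injective_fieldL : Function.Injective (Hel.fieldL d ℓ) := by
  intro v w h
  have h1 : Hel.field v = Hel.field w := h
  refine Subtype.ext (WithLp.ofLp_injective 2 (Prod.ext h1 (ext_comp ?_)))
  rintro ⟨i, j⟩
  have h2 := Hel.weakPartial w i j
  rw [← Hel.comp_field, ← h1] at h2
  exact weakPartial_unique (Hel.weakPartial v i j) h2

theorem Hel.isNormalTrace_iff (v : Hel d ℓ) (τ : SurfL2 d) : Hel.IsNormalTrace v τ ↔
    IsTopTrace d ℓ (Hel.u (Fin.last d) v) (Hel.G (Fin.last d) (Fin.last d) v) τ :=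
  ⟨IsTopTrace.congr (coeFn_comp _ _).symm (coeFn_comp _ _).symm,
    IsTopTrace.congr (coeFn_comp _ _) (coeFn_comp _ _)⟩

theorem Hel.norm_sq_field (v : Hel d ℓ) : ‖Hel.field v‖ ^ 2 = ∑ j, ‖Hel.u j v‖ ^ 2 :=
  norm_sq_eq_sum_comp _

/-- The entries of the symmetrised gradient. -/
def Hel.D (i j : Fin (d + 1)) : Hel d ℓ →L[ℝ] ScalL2 d ℓ := Hel.G i j + Hel.G j i

theorem symGradInner_eq (v w : Hel d ℓ) :
    symGradInner v w = ∑ i, ∑ j, inner ℝ (Hel.D i j v) (Hel.D i j w) := by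
  refine Finset.sum_congr rfl fun i _ => Finset.sum_congr rfl fun j _ => ?_
  rw [L2.inner_def]
  refine integral_congr_ae ?_
  filter_upwards [coeFn_comp (i, j) (Hel.grad v), coeFn_comp (j, i) (Hel.grad v),
    coeFn_comp (i, j) (Hel.grad w), coeFn_comp (j, i) (Hel.grad w),
    Lp.coeFn_add (Hel.G i j v) (Hel.G j i v), Lp.coeFn_add (Hel.G i j w) (Hel.G j i w)]
    with z h1 h2 h3 h4 h5 h6
  rw [Hel.D, add_apply, add_apply, h5, h6, Pi.add_apply, Pi.add_apply,
    ← Hel.comp_grad, ← Hel.comp_grad, ← Hel.comp_grad, ← Hel.comp_grad, h1, h2, h3, h4]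
  simp [mul_comm]

variable {E : Type*} [NormedAddCommGroup E] [NormedSpace ℝ E]

/-- An operator into `Hel` given by its components. -/
def Hel.mk (U : Fin (d + 1) → E →L[ℝ] ScalL2 d ℓ) (V : Fin (d + 1) → Fin (d + 1) → E →L[ℝ] ScalL2 d ℓ)
    (h1 : ∀ x i j, HasWeakPartial d ℓ i (U j x) (V i j x))
    (h2 : ∀ x j, VanishesAtBottom d ℓ (U j x) (V (Fin.last d) j x))
    (h3 : ∀ x, ∑ i, V i i x = 0) : E →L[ℝ] Hel d ℓ :=
  ContinuousLinearMap.codRestrict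
    ((WithLp.prodContinuousLinearEquiv 2 ℝ (VecL2 d ℓ) (MatL2 d ℓ)).symm.toContinuousLinearMap.comp
      ((assemble U).prod (assemble fun p : Fin (d + 1) × Fin (d + 1) => V p.1 p.2))) (Hel d ℓ) fun x => by
    refine (isHelField_iff _).2 ⟨fun i j => ?_, fun j => ?_, ?_⟩
    · change HasWeakPartial d ℓ i (comp j (assemble U x)) (comp (i, j) (assemble _ x))
      rw [comp_assemble, comp_assemble]; exact h1 x i j
    · change VanishesAtBottom d ℓ (comp j (assemble U x)) (comp (Fin.last d, j) (assemble _ x))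
      rw [comp_assemble, comp_assemble]; exact h2 x j
    · change ∑ i, comp (i, i) (assemble _ x) = 0
      simp only [comp_assemble]; exact h3 x

variable {U : Fin (d + 1) → E →L[ℝ] ScalL2 d ℓ} {V : Fin (d + 1) → Fin (d + 1) → E →L[ℝ] ScalL2 d ℓ}
    {h1 : ∀ x i j, HasWeakPartial d ℓ i (U j x) (V i j x)}
    {h2 : ∀ x j, VanishesAtBottom d ℓ (U j x) (V (Fin.last d) j x)}
    {h3 : ∀ x, ∑ i, V i i x = 0}

theorem Hel.u_mk (j : Fin (d + 1)) (x : E) : Hel.u j (Hel.mk U V h1 h2 h3 x) = U j x :=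
  comp_assemble U j x

theorem Hel.G_mk (i j : Fin (d + 1)) (x : E) : Hel.G i j (Hel.mk U V h1 h2 h3 x) = V i j x :=
  comp_assemble (fun p : Fin (d + 1) × Fin (d + 1) => V p.1 p.2) (i, j) x

end Hel

/-! ### Derivatives of kernels and band limitation -/

section KernelAlgebra

variable {d : ℕ} {X : Type*} [TopologicalSpace X] [MeasurableSpace X] [BorelSpace X] {μ : Measure X}
  [R1Space X] [μ.InnerRegularCompactLTTop] [IsLocallyFiniteMeasure μ]

theorem Shift.avg_neg (S : Shift d μ) (k : SchwartzMap (Cross d) ℝ) (w : Lp ℝ 2 μ) :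
    S.avg (-k) w = -S.avg k w := by
  rw [S.avg_apply, S.avg_apply, ← integral_neg]
  simp

theorem Shift.avg_sum (S : Shift d μ) {ι : Type*} (s : Finset ι) (k : ι → SchwartzMap (Cross d) ℝ)
    (w : Lp ℝ 2 μ) : S.avg (∑ i ∈ s, k i) w = ∑ i ∈ s, S.avg (k i) w := by
  simp only [S.avg_apply]
  rw [← integral_finsetSum _ fun i _ => S.integrable_smul_transl (k i).integrable w]
  simp [Finset.sum_smul]

/-- The Laplacian of a kernel. -/
def lap (k : SchwartzMap (Cross d) ℝ) : SchwartzMap (Cross d) ℝ :=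
  ∑ i : Fin d, ∂_{hdir i} (∂_{hdir i} k)

theorem khat_neg (k : SchwartzMap (Cross d) ℝ) (ξ : Cross d) : khat (-k) ξ = -khat k ξ := by
  rw [khat_apply, khat_apply, ← integral_neg]
  simp

theorem khat_sum {ι : Type*} (s : Finset ι) (k : ι → SchwartzMap (Cross d) ℝ) (ξ : Cross d) :
    khat (∑ i ∈ s, k i) ξ = ∑ i ∈ s, khat (k i) ξ := by
  have h : khat (∑ i ∈ s, k i) = ∑ i ∈ s, khat (k i) := by
    simp only [khat, ← FourierTransform.fourierCLM_apply (R := ℂ), map_sum]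
  rw [h, sum_apply]

theorem khat_lap (k : SchwartzMap (Cross d) ℝ) (ξ : Cross d) :
    khat (lap k) ξ = -((2 * Real.pi * ‖ξ‖) ^ 2 : ℝ) * khat k ξ := by
  rw [lap, khat_sum]
  simp only [khat_lineDeriv, hdir, EuclideanSpace.inner_single_right]
  rw [mul_pow, EuclideanSpace.norm_sq_eq]
  push_cast
  rw [Finset.mul_sum, ← Finset.sum_neg_distrib, Finset.sum_mul]
  refine Finset.sum_congr rfl fun i _ => ?_
  simp only [Real.norm_eq_abs, ← Complex.ofReal_pow, sq_abs]
  push_cast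
  simp
  linear_combination 4 * (Real.pi : ℂ) ^ 2 * (ξ i : ℂ) ^ 2 * khat k ξ * Complex.I_sq

/-- The kernel `k` has no frequencies `ξ` with `2π|ξ| > B`. -/
def BandLimited (B : ℝ) (k : SchwartzMap (Cross d) ℝ) : Prop :=
  ∀ ξ, khat k ξ ≠ 0 → 2 * Real.pi * ‖ξ‖ ≤ B

theorem BandLimited.lineDeriv {B : ℝ} {k : SchwartzMap (Cross d) ℝ} (h : BandLimited B k)
    (v : Cross d) : BandLimited B (∂_{v} k) := by
  intro ξ hξ
  refine h ξ fun h0 => hξ ?_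
  rw [khat_lineDeriv, h0, mul_zero]

theorem BandLimited.neg_lap {B : ℝ} {k : SchwartzMap (Cross d) ℝ} (h : BandLimited B k) :
    BandLimited B (-lap k) := by
  intro ξ hξ
  refine h ξ fun h0 => hξ ?_
  rw [khat_neg, khat_lap, h0, mul_zero, neg_zero]

theorem BandLimited.norm_khat_lineDeriv_le {B : ℝ} {k : SchwartzMap (Cross d) ℝ}
    (h : BandLimited B k) (i : Fin d) (ξ : Cross d) :
    ‖khat (∂_{hdir i} k) ξ‖ ≤ B * ‖khat k ξ‖ := by
  by_cases h0 : khat k ξ = 0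
  · rw [khat_lineDeriv, h0, mul_zero]; simp
  · rw [khat_lineDeriv, norm_mul]
    gcongr
    refine le_trans ?_ (h ξ h0)
    simp only [norm_mul, Complex.norm_I, mul_one, Complex.norm_real, Complex.norm_ofNat,
      Real.norm_of_nonneg Real.pi_pos.le]
    gcongr
    refine (norm_inner_le_norm _ _).trans_eq ?_
    simp [hdir]

theorem BandLimited.norm_khat_neg_lap_le {B : ℝ} {k : SchwartzMap (Cross d) ℝ}
    (h : BandLimited B k) (ξ : Cross d) : ‖khat (-lap k) ξ‖ ≤ B ^ 2 * ‖khat k ξ‖ := by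
  by_cases h0 : khat k ξ = 0
  · rw [khat_neg, khat_lap, h0, mul_zero]; simp
  · rw [khat_neg, khat_lap, norm_neg, norm_mul, norm_neg, Complex.norm_real,
      Real.norm_of_nonneg (by positivity)]
    gcongr
    exact h ξ h0

theorem norm_surf_avg_le {k k' : SchwartzMap (Cross d) ℝ} {C : ℝ}
    (h : ∀ ξ, ‖khat k ξ‖ ≤ C * ‖khat k' ξ‖) (f : SurfL2 d) :
    ‖(surfShift d).avg k f‖ ≤ C * ‖(surfShift d).avg k' f‖ := by
  rw [← norm_hatL, ← norm_hatL]
  refine Lp.norm_le_mul_norm_of_ae_le_mul ?_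
  filter_upwards [hatL_avg k f, hatL_avg k' f] with ξ h1 h2
  rw [h1, h2, norm_mul, norm_mul, ← mul_assoc]
  exact mul_le_mul_of_nonneg_right (h ξ) (norm_nonneg _)

end KernelAlgebra

/-! ### Averages and solenoidal test fields in the energy space -/

section HelOperators

variable {d : ℕ} {ℓ : ℝ}

/-- Horizontal averaging on the energy space. -/
def Hel.avg (k : SchwartzMap (Cross d) ℝ) : Hel d ℓ →L[ℝ] Hel d ℓ :=
  Hel.mk (fun j => ((slabShift d ℓ).avg k).comp (Hel.u j))
    (fun i j => ((slabShift d ℓ).avg k).comp (Hel.G i j))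
    (fun v i j => PartsOn.avg (Hel.weakPartial v i j) k)
    (fun v j => PartsOn.avg (Hel.vanishes v j) k)
    fun v => by
      simp only [ContinuousLinearMap.comp_apply]
      rw [← map_sum, Hel.div_eq_zero, map_zero]

theorem Hel.u_avg (k : SchwartzMap (Cross d) ℝ) (v : Hel d ℓ) (j : Fin (d + 1)) :
    Hel.u j (Hel.avg k v) = (slabShift d ℓ).avg k (Hel.u j v) := Hel.u_mk j v

theorem Hel.G_avg (k : SchwartzMap (Cross d) ℝ) (v : Hel d ℓ) (i j : Fin (d + 1)) :
    Hel.G i j (Hel.avg k v) = (slabShift d ℓ).avg k (Hel.G i j v) := Hel.G_mk i j v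

theorem Hel.D_avg (k : SchwartzMap (Cross d) ℝ) (v : Hel d ℓ) (i j : Fin (d + 1)) :
    Hel.D i j (Hel.avg k v) = (slabShift d ℓ).avg k (Hel.D i j v) := by
  simp only [Hel.D, add_apply, Hel.G_avg, map_add]

theorem Hel.IsNormalTrace.avg {v : Hel d ℓ} {τ : SurfL2 d} (h : Hel.IsNormalTrace v τ)
    (k : SchwartzMap (Cross d) ℝ) :
    Hel.IsNormalTrace (Hel.avg k v) ((surfShift d).avg k τ) := by
  rw [Hel.isNormalTrace_iff] at h ⊢
  rw [Hel.u_avg, Hel.G_avg]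
  exact IsTopTrace.avg h k

/-- Horizontal averaging of vector fields. -/
def vecAvg (d : ℕ) (ℓ : ℝ) (k : SchwartzMap (Cross d) ℝ) : VecL2 d ℓ →L[ℝ] VecL2 d ℓ :=
  assemble fun j => ((slabShift d ℓ).avg k).comp (comp j)

theorem comp_vecAvg (k : SchwartzMap (Cross d) ℝ) (w : VecL2 d ℓ) (j : Fin (d + 1)) :
    comp j (vecAvg d ℓ k w) = (slabShift d ℓ).avg k (comp j w) := comp_assemble _ j w

theorem Hel.field_avg (k : SchwartzMap (Cross d) ℝ) (v : Hel d ℓ) :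
    Hel.field (Hel.avg k v) = vecAvg d ℓ k (Hel.field v) :=
  ext_comp fun j => by rw [comp_vecAvg, Hel.comp_field, Hel.comp_field, Hel.u_avg]

theorem inner_vecAvg_comm {k : SchwartzMap (Cross d) ℝ} (hk : ∀ a, k (-a) = k a)
    (v w : VecL2 d ℓ) : inner ℝ (vecAvg d ℓ k v) w = inner ℝ v (vecAvg d ℓ k w) := by
  simp only [inner_eq_sum_comp, comp_vecAvg]
  exact Finset.sum_congr rfl fun j _ => (slabShift d ℓ).inner_avg_comm hk _ _

theorem symGradInner_avg_comm {k : SchwartzMap (Cross d) ℝ} (hk : ∀ a, k (-a) = k a)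
    (v w : Hel d ℓ) : symGradInner (Hel.avg k v) w = symGradInner v (Hel.avg k w) := by
  simp only [symGradInner_eq, Hel.D_avg]
  exact Finset.sum_congr rfl fun i _ => Finset.sum_congr rfl fun j _ =>
    (slabShift d ℓ).inner_avg_comm hk _ _

/-- The vertical profiles of the components of the test field. -/
def prof (χ : ℝ → ℝ) (j : Fin (d + 1)) : ℝ → ℝ :=
  Fin.lastCases (motive := fun _ => ℝ → ℝ) χ (fun _ => deriv χ) j

/-- The horizontal kernels of the components of the test field. -/
def hker (k : SchwartzMap (Cross d) ℝ) (j : Fin (d + 1)) : SchwartzMap (Cross d) ℝ :=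
  Fin.lastCases (motive := fun _ => SchwartzMap (Cross d) ℝ) (-lap k) (fun i => ∂_{hdir i} k) j

theorem prof_last (χ : ℝ → ℝ) : prof χ (Fin.last d) = χ := by simp [prof]

theorem prof_castSucc (χ : ℝ → ℝ) (i : Fin d) : prof χ i.castSucc = deriv χ := by simp [prof]

theorem hker_last (k : SchwartzMap (Cross d) ℝ) : hker k (Fin.last d) = -lap k := by simp [hker]

theorem hker_castSucc (k : SchwartzMap (Cross d) ℝ) (i : Fin d) :
    hker k i.castSucc = ∂_{hdir i} k := by simp [hker]

theorem contDiff_deriv_of {χ : ℝ → ℝ} (h : ContDiff ℝ ∞ χ) : ContDiff ℝ ∞ (deriv χ) :=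
  (contDiff_infty_iff_deriv.1 h).2

theorem contDiff_prof {χ : ℝ → ℝ} (h : ContDiff ℝ ∞ χ) (j : Fin (d + 1)) :
    ContDiff ℝ ∞ (prof χ j) := by
  refine Fin.lastCases ?_ (fun i => ?_) j
  · rw [prof_last]; exact h
  · rw [prof_castSucc]; exact contDiff_deriv_of h

/-- The gradient entries of the test field. -/
def testGrad (d : ℕ) (ℓ : ℝ) {χ : ℝ → ℝ} (hχ : ContDiff ℝ ∞ χ) (k : SchwartzMap (Cross d) ℝ)
    (i j : Fin (d + 1)) : SurfL2 d →L[ℝ] ScalL2 d ℓ :=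
  Fin.lastCases (motive := fun _ => SurfL2 d →L[ℝ] ScalL2 d ℓ)
    ((tensorL d ℓ (contDiff_deriv_of (contDiff_prof hχ j)).continuous).comp
      ((surfShift d).avg (hker k j)))
    (fun i => (tensorL d ℓ (contDiff_prof hχ j).continuous).comp
      ((surfShift d).avg (∂_{hdir i} (hker k j)))) i

theorem testGrad_last {χ : ℝ → ℝ} (hχ : ContDiff ℝ ∞ χ) (k : SchwartzMap (Cross d) ℝ)
    (j : Fin (d + 1)) (f : SurfL2 d) : testGrad d ℓ hχ k (Fin.last d) j f =
      tensorL d ℓ (contDiff_deriv_of (contDiff_prof hχ j)).continuous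
        ((surfShift d).avg (hker k j) f) := by simp [testGrad]

theorem testGrad_castSucc {χ : ℝ → ℝ} (hχ : ContDiff ℝ ∞ χ) (k : SchwartzMap (Cross d) ℝ)
    (i : Fin d) (j : Fin (d + 1)) (f : SurfL2 d) : testGrad d ℓ hχ k i.castSucc j f =
      tensorL d ℓ (contDiff_prof hχ j).continuous
        ((surfShift d).avg (∂_{hdir i} (hker k j)) f) := by simp [testGrad]

theorem tensorL_congr {χ χ' : ℝ → ℝ} (h : χ = χ') (hχ : Continuous χ) (hχ' : Continuous χ') :
    tensorL d ℓ hχ = tensorL d ℓ hχ' := by subst h; rfl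

/-- The solenoidal test field `(χ' ∇_x f, -χ Δ_x f)` with `f = k * h`, as a function of `h`. -/
def testField (d : ℕ) {ℓ : ℝ} (hℓ : 0 < ℓ) {χ : ℝ → ℝ} (hχ : ContDiff ℝ ∞ χ)
    (h0 : ∀ j : Fin (d + 1), prof χ j 0 = 0) (k : SchwartzMap (Cross d) ℝ) :
    SurfL2 d →L[ℝ] Hel d ℓ :=
  Hel.mk (fun j => (tensorL d ℓ (contDiff_prof hχ j).continuous).comp ((surfShift d).avg (hker k j)))
    (testGrad d ℓ hχ k)
    -- Vertical derivatives fall on the profile, horizontal ones on the kernel.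
    (fun f i j => by
      refine Fin.lastCases ?_ (fun i => ?_) i
      · rw [testGrad_last]
        intro φ h1 h2 h3
        exact vanishesAtBottom_tensorL hℓ (contDiff_prof hχ j) (h0 j) _
          (contDiff_deriv_of (contDiff_prof hχ j)).continuous φ h1 h2
          (h3.trans (prod_mono le_rfl Ioo_subset_Iio_self))
      · rw [testGrad_castSucc, ContinuousLinearMap.comp_apply, tensorL_avg, tensorL_avg]
        exact partsOn_avg_deriv _ _ i _)
    (fun f j => by
      rw [testGrad_last]
      exact vanishesAtBottom_tensorL hℓ (contDiff_prof hχ j) (h0 j) _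
        (contDiff_deriv_of (contDiff_prof hχ j)).continuous)
    fun f => by
      -- The horizontal divergence is `χ' Δf` and the vertical derivative of the last component is
      -- `-χ' Δf`.
      rw [Fin.sum_univ_castSucc, testGrad_last]
      simp only [testGrad_castSucc]
      have e : ∀ i : Fin d, tensorL d ℓ (contDiff_prof hχ i.castSucc).continuous =
          tensorL d ℓ (contDiff_deriv_of hχ).continuous :=
        fun i => tensorL_congr (prof_castSucc χ i) _ _
      simp only [e, hker_castSucc, hker_last]
      rw [tensorL_congr (congrArg deriv (prof_last χ)) _ (contDiff_deriv_of hχ).continuous, ← map_sum,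
        ← (tensorL d ℓ (contDiff_deriv_of hχ).continuous).map_add,
        Shift.avg_neg, lap, Shift.avg_sum, add_neg_cancel, map_zero]

variable {hℓ : 0 < ℓ} {χ : ℝ → ℝ} {hχ : ContDiff ℝ ∞ χ} {h0 : ∀ j : Fin (d + 1), prof χ j 0 = 0}
  {k : SchwartzMap (Cross d) ℝ}

theorem isNormalTrace_testField (h1 : χ ℓ = 1) (f : SurfL2 d) :
    Hel.IsNormalTrace (testField d hℓ hχ h0 k f) ((surfShift d).avg (-lap k) f) := by
  rw [Hel.isNormalTrace_iff, testField, Hel.u_mk, Hel.G_mk, testGrad_last, hker_last]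
  exact isTopTrace_tensorL hℓ (contDiff_prof hχ (Fin.last d)) (h0 _) _ _ (by rw [prof_last, h1])

/-- A priori bounds for the test field, given bounds for its vertical profile. -/
theorem norm_testField_le {B c C β : ℝ} (hB : 0 ≤ B) (hc : 0 < c) (hC : 0 ≤ C) (hβ : 0 ≤ β)
    (hBc : B ≤ β * c) (hk : BandLimited B k)
    (hb0 : ∀ y ∈ Ioo 0 ℓ, |χ y| ≤ C) (hb1 : ∀ y ∈ Ioo 0 ℓ, |deriv χ y| ≤ C * c)
    (hb2 : ∀ y ∈ Ioo 0 ℓ, |deriv (deriv χ) y| ≤ C * c ^ 2)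
    (hz : ∀ y, y ≤ ℓ - 1 / c → χ y = 0 ∧ deriv χ y = 0 ∧ deriv (deriv χ) y = 0) (f : SurfL2 d)
    (i j : Fin (d + 1)) :
    ‖Hel.u j (testField d hℓ hχ h0 k f)‖
      ≤ C * (1 + β) * (√(1 / c) * c * B * ‖(surfShift d).avg k f‖) ∧
    ‖Hel.G i j (testField d hℓ hχ h0 k f)‖
      ≤ C * (1 + β) ^ 2 * (√(1 / c) * c ^ 2 * B * ‖(surfShift d).avg k f‖) := by
  set b := ‖(surfShift d).avg k f‖ with hb
  have hb' : 0 ≤ b := norm_nonneg _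
  set s := √(1 / c)
  have hs : 0 ≤ s := Real.sqrt_nonneg _
  -- Every entry is a profile times an averaged surface function. The layer has width `1 / c`,
  -- whence `s`; each vertical derivative costs a factor `c`, each horizontal one a factor `B`. The
  -- inequality `B ≤ β c` then leaves a single power of `B`.
  have key : ∀ {ψ : ℝ → ℝ} (hψ : Continuous ψ) (A : ℝ) (_ : 0 ≤ A) (_ : ∀ y ∈ Ioo 0 ℓ, |ψ y| ≤ A)
      (_ : ∀ y, y ≤ ℓ - 1 / c → ψ y = 0) (k' : SchwartzMap (Cross d) ℝ) (M : ℝ) (_ : 0 ≤ M)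
      (_ : ‖(surfShift d).avg k' f‖ ≤ M * b),
      ‖tensorL d ℓ hψ ((surfShift d).avg k' f)‖ ≤ A * s * (M * b) := by
    intro ψ hψ A hA h1 h2 k' M hM h3
    have h4 := norm_tensorL_le (a := ℓ - 1 / c) hψ (by simp [hc.le]) h1 (fun y _ => h2 y) hA
      ((surfShift d).avg k' f)
    rw [sub_sub_cancel] at h4
    exact h4.trans (by gcongr)
  have n0 : ∀ i, ‖(surfShift d).avg (∂_{hdir i} k) f‖ ≤ B * b := fun i =>
    norm_surf_avg_le (hk.norm_khat_lineDeriv_le i) f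
  have n1 : ‖(surfShift d).avg (-lap k) f‖ ≤ B ^ 2 * b :=
    norm_surf_avg_le hk.norm_khat_neg_lap_le f
  have n2 : ∀ i j, ‖(surfShift d).avg (∂_{hdir i} (∂_{hdir j} k)) f‖ ≤ B ^ 2 * b := fun i j =>
    (norm_surf_avg_le ((hk.lineDeriv _).norm_khat_lineDeriv_le i) f).trans (by
      have := mul_le_mul_of_nonneg_left (n0 j) hB
      linarith)
  have n3 : ∀ i, ‖(surfShift d).avg (∂_{hdir i} (-lap k)) f‖ ≤ B ^ 3 * b := fun i =>
    (norm_surf_avg_le (hk.neg_lap.norm_khat_lineDeriv_le i) f).trans (by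
      have := mul_le_mul_of_nonneg_left n1 hB
      linarith)
  have z0 := fun y hy => (hz y hy).1
  have z1 := fun y hy => (hz y hy).2.1
  have z2 := fun y hy => (hz y hy).2.2
  have hX : 0 ≤ C * s * B * b := by positivity
  have hB2 : B ^ 2 ≤ β ^ 2 * c ^ 2 := by rw [← mul_pow]; gcongr
  constructor
  · rw [testField, Hel.u_mk, ContinuousLinearMap.comp_apply]
    refine Fin.lastCases ?_ (fun j => ?_) j
    · rw [tensorL_congr (prof_last χ) _ hχ.continuous, hker_last]
      refine (key _ C hC hb0 z0 _ _ (by positivity) n1).trans ?_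
      have := mul_le_mul_of_nonneg_left hBc hX
      nlinarith [mul_nonneg hX hc.le]
    · rw [tensorL_congr (prof_castSucc χ j) _ (contDiff_deriv_of hχ).continuous, hker_castSucc]
      refine (key _ (C * c) (by positivity) hb1 z1 _ _ hB (n0 j)).trans ?_
      nlinarith [mul_nonneg hX hc.le, mul_nonneg (mul_nonneg hX hc.le) hβ]
  · rw [testField, Hel.G_mk]
    have hX2 := mul_nonneg hX (sq_nonneg c)
    have hX3 := mul_nonneg hX2 hβ
    have hX4 := mul_nonneg hX3 hβ
    have h5 := mul_le_mul_of_nonneg_left hBc (mul_nonneg hX hc.le)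
    have h6 := mul_le_mul_of_nonneg_left hB2 hX
    refine Fin.lastCases ?_ (fun i => ?_) i
    · rw [testGrad_last]
      refine Fin.lastCases ?_ (fun j => ?_) j
      · rw [tensorL_congr (congrArg deriv (prof_last χ)) _ (contDiff_deriv_of hχ).continuous, hker_last]
        refine (key _ (C * c) (by positivity) hb1 z1 _ _ (by positivity) n1).trans ?_
        nlinarith
      · rw [tensorL_congr (congrArg deriv (prof_castSucc χ j)) _
          (contDiff_deriv_of (contDiff_deriv_of hχ)).continuous, hker_castSucc]
        refine (key _ (C * c ^ 2) (by positivity) hb2 z2 _ _ hB (n0 j)).trans ?_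
        nlinarith
    · rw [testGrad_castSucc]
      refine Fin.lastCases ?_ (fun j => ?_) j
      · rw [tensorL_congr (prof_last χ) _ hχ.continuous, hker_last]
        refine (key _ C hC hb0 z0 _ _ (by positivity) (n3 i)).trans ?_
        nlinarith
      · rw [tensorL_congr (prof_castSucc χ j) _ (contDiff_deriv_of hχ).continuous, hker_castSucc]
        refine (key _ (C * c) (by positivity) hb1 z1 _ _ (by positivity) (n2 i j)).trans ?_
        nlinarith

end HelOperators

/-! ### Dyadic frequency kernels -/

section Kernels

variable {d : ℕ}

/-- A real even symbol that is smooth with compact support comes from a real even Schwartz kernel. -/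
theorem exists_kernel {φ : Cross d → ℝ} (h1 : ContDiff ℝ ∞ φ) (h2 : HasCompactSupport φ)
    (h3 : ∀ ξ, φ (-ξ) = φ ξ) :
    ∃ k : SchwartzMap (Cross d) ℝ, (∀ a, k (-a) = k a) ∧ ∀ ξ, khat k ξ = φ ξ := by
  have g1 : ContDiff ℝ ∞ fun ξ => (φ ξ : ℂ) := Complex.ofRealCLM.contDiff.comp h1
  have g2 : HasCompactSupport fun ξ => (φ ξ : ℂ) := h2.comp_left Complex.ofReal_zero
  let Φ : SchwartzMap (Cross d) ℂ := g2.toSchwartzMap g1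
  have hΦ : ∀ ξ, Φ ξ = (φ ξ : ℂ) := fun ξ => rfl
  let K : SchwartzMap (Cross d) ℂ := 𝓕⁻ Φ
  have hK : ∀ x, K x = ∫ ξ, (Real.fourierChar (inner ℝ ξ x) : ℂ) * (φ ξ : ℂ) := by
    intro x
    change (𝓕⁻ Φ) x = _
    rw [SchwartzMap.fourierInv_coe, Real.fourierInv_eq]
    rfl
  have heven : ∀ x, K (-x) = K x := by
    intro x
    rw [hK, hK, ← integral_neg_eq_self]
    simp [h3]
  have hreal : ∀ x, ((K x).re : ℂ) = K x := by
    intro x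
    rw [← Complex.conj_eq_iff_re]
    rw [hK, ← integral_conj, ← integral_neg_eq_self]
    congr 1; ext ξ
    rw [map_mul, Complex.conj_ofReal, h3, inner_neg_left]
    congr 1
    rw [AddChar.map_neg_eq_inv, Circle.coe_inv_eq_conj, Complex.conj_conj]
  refine ⟨K.postcompCLM Complex.reCLM, fun a => ?_, fun ξ => ?_⟩
  · simp [SchwartzMap.postcompCLM_apply, heven]
  · have h4 : (K.postcompCLM Complex.reCLM).postcompCLM Complex.ofRealCLM = K := by
      ext x
      simp [SchwartzMap.postcompCLM_apply, hreal]
    rw [khat, h4]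
    change (𝓕 (𝓕⁻ Φ)) ξ = _
    rw [FourierTransform.fourier_fourierInv_eq, hΦ]

/-- Smooth cutoff to frequencies comparable with `R`. -/
theorem exists_band_symbol : ∃ b : ℝ → ℝ, ContDiff ℝ ∞ b ∧ (∀ s, 0 ≤ b s) ∧ (∀ s, b s ≤ 1) ∧
    (∀ s, 1 ≤ s → s ≤ 4 → b s = 1) ∧ ∀ s, b s ≠ 0 → 1 / 2 ≤ s ∧ s ≤ 9 / 2 := by
  let f : ContDiffBump (5 / 2 : ℝ) := ⟨3 / 2, 2, by norm_num, by norm_num⟩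
  refine ⟨f, f.contDiff, fun s => f.nonneg, fun s => f.le_one, fun s h1 h2 => ?_, fun s hs => ?_⟩
  · refine f.one_of_mem_closedBall ?_
    rw [Metric.mem_closedBall, Real.dist_eq, abs_le]
    constructor <;> change _ ≤ (_ : ℝ) <;> norm_num <;> linarith
  · have h1 : s ∈ Function.support f := hs
    rw [f.support_eq, Metric.mem_ball, Real.dist_eq, abs_lt] at h1
    have h2 : f.rOut = 2 := rfl
    rw [h2] at h1
    constructor <;> linarith [h1.1, h1.2]

/-- The dyadic kernels: their symbols take values in `[0,1]`, equal `1` for `R ≤ |ξ| ≤ 2R`, and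
vanish unless `R²/2 ≤ |ξ|² ≤ 9R²/2`. -/
structure IsBandKernel (R : ℝ) (k : SchwartzMap (Cross d) ℝ) (φ : Cross d → ℝ) : Prop where
  pos : 0 < R
  even : ∀ a, k (-a) = k a
  khat_eq : ∀ ξ, khat k ξ = φ ξ
  cont : Continuous φ
  nonneg : ∀ ξ, 0 ≤ φ ξ
  le_one : ∀ ξ, φ ξ ≤ 1
  eq_one : ∀ ξ, R ≤ ‖ξ‖ → ‖ξ‖ ≤ 2 * R → φ ξ = 1
  supp : ∀ ξ, φ ξ ≠ 0 → R ^ 2 / 2 ≤ ‖ξ‖ ^ 2 ∧ ‖ξ‖ ^ 2 ≤ 9 / 2 * R ^ 2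

theorem exists_isBandKernel (d : ℕ) {R : ℝ} (hR : 0 < R) :
    ∃ (k : SchwartzMap (Cross d) ℝ) (φ : Cross d → ℝ), IsBandKernel R k φ := by
  obtain ⟨b, b1, b2, b3, b4, b5⟩ := exists_band_symbol
  -- The squared norm is used because it is smooth at the origin; the plateau `[1, 4]` of `b`
  -- becomes `R ≤ ‖ξ‖ ≤ 2R`.
  let φ : Cross d → ℝ := fun ξ => b (‖ξ‖ ^ 2 / R ^ 2)
  have hφ : ContDiff ℝ ∞ φ := b1.comp ((contDiff_norm_sq ℝ).div_const _)
  have hsupp : ∀ ξ, φ ξ ≠ 0 → R ^ 2 / 2 ≤ ‖ξ‖ ^ 2 ∧ ‖ξ‖ ^ 2 ≤ 9 / 2 * R ^ 2 := by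
    intro ξ hξ
    obtain ⟨h1, h2⟩ := b5 _ hξ
    rw [le_div_iff₀ (by positivity)] at h1
    rw [div_le_iff₀ (by positivity)] at h2
    exact ⟨by linarith, h2⟩
  have hc : HasCompactSupport φ := by
    refine HasCompactSupport.intro (isCompact_closedBall (0 : Cross d) (3 * R)) fun ξ hξ => ?_
    by_contra h
    refine hξ ?_
    rw [mem_closedBall_zero_iff]
    refine abs_le_of_sq_le_sq' ?_ (by positivity) |>.2
    nlinarith [(hsupp ξ h).2]
  obtain ⟨k, k1, k2⟩ := exists_kernel hφ hc fun ξ => by simp [φ]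
  refine ⟨k, φ, hR, k1, k2, hφ.continuous, fun _ => b2 _, fun _ => b3 _, fun ξ h1 h2 => ?_, hsupp⟩
  refine b4 _ ?_ ?_
  · rw [le_div_iff₀ (by positivity)]; nlinarith
  · rw [div_le_iff₀ (by positivity)]; nlinarith [norm_nonneg ξ]

variable {R : ℝ} {k : SchwartzMap (Cross d) ℝ} {φ : Cross d → ℝ}

/-- On the support `‖ξ‖² ≤ 9R²/2 ≤ (3R)²`, and `2π · 3R = 6πR`. -/
theorem IsBandKernel.bandLimited (h : IsBandKernel R k φ) : BandLimited (6 * Real.pi * R) k := by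
  intro ξ hξ
  rw [h.khat_eq] at hξ
  have h1 := (h.supp ξ (by simpa using hξ)).2
  have h2 : ‖ξ‖ ≤ 3 * R := by
    refine abs_le_of_sq_le_sq' ?_ (by linarith [h.pos]) |>.2
    nlinarith [h.pos]
  nlinarith [Real.pi_pos]

theorem IsBandKernel.le_norm (h : IsBandKernel R k φ) {ξ : Cross d} (hξ : φ ξ ≠ 0) :
    R ≤ 2 * Real.pi * ‖ξ‖ := by
  have h1 := (h.supp ξ hξ).1
  have h2 : R ≤ 2 * ‖ξ‖ := by
    refine abs_le_of_sq_le_sq' ?_ (by positivity) |>.2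
    nlinarith [h.pos]
  nlinarith [Real.pi_gt_three, norm_nonneg ξ]

end Kernels

/-! ### Boundary layer profiles and the scaled test fields -/

section Profile

theorem deriv_affine_comp {F : ℝ → ℝ} (hF : Differentiable ℝ F) (c ℓ A : ℝ) :
    deriv (fun y => A * F (1 + c * (y - ℓ))) = fun y => A * c * deriv F (1 + c * (y - ℓ)) := by
  ext y
  have h1 : HasDerivAt (fun y => 1 + c * (y - ℓ)) c y := by
    simpa using (((hasDerivAt_id y).sub_const ℓ).const_mul c).const_add 1
  have h2 := ((hF.differentiableAt (x := 1 + c * (y - ℓ))).hasDerivAt.comp y h1).const_mul A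
  rw [show (fun y => A * F (1 + c * (y - ℓ))) = fun y => A * (F ∘ fun y => 1 + c * (y - ℓ)) y
    from rfl, h2.deriv]
  ring

/-- Vertical profiles concentrated in a layer of width `1 / c` below `{y = ℓ}`. -/
theorem exists_profile : ∃ C : ℝ, 0 < C ∧ ∀ ℓ c : ℝ, 0 < c → ∃ χ : ℝ → ℝ, ContDiff ℝ ∞ χ ∧ χ ℓ = 1 ∧
    (∀ y ∈ Ioo 0 ℓ, |χ y| ≤ C) ∧ (∀ y ∈ Ioo 0 ℓ, |deriv χ y| ≤ C * c) ∧
    (∀ y ∈ Ioo 0 ℓ, |deriv (deriv χ) y| ≤ C * c ^ 2) ∧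
    ∀ y, y ≤ ℓ - 1 / c → χ y = 0 ∧ deriv χ y = 0 ∧ deriv (deriv χ) y = 0 := by
  -- `η` is `0` up to `1/2` and `1` from `1` on. Beginning the rise at `1/2` rather than `0` leaves
  -- an open set of zeros, so that the derivatives vanish at the edge of the layer too.
  let η : ℝ → ℝ := fun s => Real.smoothTransition (2 * s - 1)
  have h0 : ContDiff ℝ ∞ η := Real.smoothTransition.contDiff.comp (by fun_prop)
  have h1 := contDiff_deriv_of h0
  have h2 := contDiff_deriv_of h1
  obtain ⟨C0, hC0⟩ := (isCompact_Icc (a := (0 : ℝ)) (b := 1)).exists_bound_of_continuousOn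
    h0.continuous.continuousOn
  obtain ⟨C1, hC1⟩ := (isCompact_Icc (a := (0 : ℝ)) (b := 1)).exists_bound_of_continuousOn
    h1.continuous.continuousOn
  obtain ⟨C2, hC2⟩ := (isCompact_Icc (a := (0 : ℝ)) (b := 1)).exists_bound_of_continuousOn
    h2.continuous.continuousOn
  have z0 : ∀ s < 1 / 2, η s = 0 := fun s hs =>
    Real.smoothTransition.zero_of_nonpos (by linarith)
  have zd : ∀ {F : ℝ → ℝ}, (∀ s < 1 / 2, F s = 0) → ∀ s < 1 / 2, deriv F s = 0 := by
    intro F hF s hs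
    have : F =ᶠ[𝓝 s] fun _ => 0 := by
      filter_upwards [isOpen_Iio.mem_nhds (show s ∈ Iio (1 / 2 : ℝ) from hs)] with t ht using hF t ht
    rw [this.deriv_eq, deriv_const]
  have z1 := zd z0
  have z2 := zd z1
  have key : ∀ {F : ℝ → ℝ} {C' : ℝ}, (∀ s < 1 / 2, F s = 0) → (∀ s ∈ Icc (0 : ℝ) 1, ‖F s‖ ≤ C') →
      C' ≤ |C0| + |C1| + |C2| + 1 → ∀ s ≤ 1, |F s| ≤ |C0| + |C1| + |C2| + 1 := by
    intro F C' g0 g1 g2 s hs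
    rcases lt_or_ge s 0 with h | h
    · rw [g0 s (by linarith), abs_zero]; positivity
    · exact (g1 s ⟨h, hs⟩).trans g2
  refine ⟨|C0| + |C1| + |C2| + 1, by positivity, fun ℓ c hc => ?_⟩
  -- The factor `1` matches the form of `deriv_affine_comp`, which is applied twice.
  let χ : ℝ → ℝ := fun y => 1 * η (1 + c * (y - ℓ))
  have e1 : deriv χ = fun y => 1 * c * deriv η (1 + c * (y - ℓ)) :=
    deriv_affine_comp (h0.differentiable (by simp)) c ℓ 1
  have e2 : deriv (deriv χ) = fun y => 1 * c * c * deriv (deriv η) (1 + c * (y - ℓ)) := by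
    rw [e1]; exact deriv_affine_comp (h1.differentiable (by simp)) c ℓ _
  have hs : ∀ y ∈ Ioo 0 ℓ, 1 + c * (y - ℓ) ≤ 1 := fun y hy => by nlinarith [hy.2]
  refine ⟨χ, contDiff_const.mul (h0.comp (by fun_prop)), ?_, fun y hy => ?_, fun y hy => ?_,
    fun y hy => ?_, fun y hy => ?_⟩
  · simp only [χ, η, sub_self, mul_zero, add_zero, one_mul]
    exact Real.smoothTransition.one_of_one_le (by norm_num)
  · simp only [χ, one_mul]
    exact key z0 hC0 (by linarith [le_abs_self C0, abs_nonneg C1, abs_nonneg C2]) _ (hs y hy)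
  · rw [e1]
    simp only [one_mul]
    rw [abs_mul, abs_of_pos hc, mul_comm]
    gcongr
    exact key z1 hC1 (by linarith [le_abs_self C1, abs_nonneg C0, abs_nonneg C2]) _ (hs y hy)
  · rw [e2]
    simp only [one_mul]
    rw [abs_mul, abs_mul, abs_of_pos hc, mul_comm, sq]
    gcongr
    exact key z2 hC2 (by linarith [le_abs_self C2, abs_nonneg C1, abs_nonneg C0]) _ (hs y hy)
  · have h3 : 1 + c * (y - ℓ) < 1 / 2 := by
      have h4 : c * (y - ℓ) ≤ c * (-(1 / c)) := by gcongr; linarith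
      rw [mul_neg, mul_one_div_cancel hc.ne'] at h4
      linarith
    rw [e2, e1]
    simp only [χ]
    rw [z0 _ h3, z1 _ h3, z2 _ h3]
    simp

variable {d : ℕ}

theorem IsTopTrace.smul {d : ℕ} {ℓ : ℝ} {w g : ScalL2 d ℓ} {τ : SurfL2 d}
    (h : IsTopTrace d ℓ w g τ) (c : ℝ) :
    IsTopTrace d ℓ (c • w : ScalL2 d ℓ) (c • g : ScalL2 d ℓ) (c • τ : SurfL2 d) := by
  intro φ h1 h2 h3
  have e1 : ∫ z, ((c • w : ScalL2 d ℓ) z * fderiv ℝ φ z (dir d (Fin.last d))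
      + (c • g : ScalL2 d ℓ) z * φ z) ∂(slab d ℓ)
      = c * ∫ z, (w z * fderiv ℝ φ z (dir d (Fin.last d)) + g z * φ z) ∂(slab d ℓ) := by
    rw [← integral_const_mul]
    refine integral_congr_ae ?_
    filter_upwards [Lp.coeFn_smul c w, Lp.coeFn_smul c g] with z h4 h5
    rw [h4, h5]
    simp only [Pi.smul_apply, smul_eq_mul]
    ring
  rw [e1, h φ h1 h2 h3, ← integral_const_mul]
  refine integral_congr_ae ?_
  filter_upwards [Lp.coeFn_smul c τ] with x h4
  rw [h4]
  simp only [Pi.smul_apply, smul_eq_mul]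
  ring

theorem Hel.IsNormalTrace.smul {d : ℕ} {ℓ : ℝ} {v : Hel d ℓ} {τ : SurfL2 d}
    (h : Hel.IsNormalTrace v τ) (c : ℝ) : Hel.IsNormalTrace (c • v) (c • τ) := by
  rw [Hel.isNormalTrace_iff] at h ⊢
  rw [map_smul, map_smul]
  exact IsTopTrace.smul h c

/-- The family of test fields with their bounds, uniformly in the frequency scale `R`. -/
theorem exists_testField (d : ℕ) {ℓ : ℝ} (hℓ : 0 < ℓ) : ∃ C : ℝ, 0 < C ∧ ∀ (R : ℝ)
    (k : SchwartzMap (Cross d) ℝ), 0 < R → BandLimited (6 * Real.pi * R) k →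
    ∃ W : SurfL2 d →L[ℝ] Hel d ℓ,
      (∀ f, Hel.IsNormalTrace (W f) (((max 1 R) ^ 2)⁻¹ • (surfShift d).avg (-lap k) f)) ∧
      ∀ f i j, ‖Hel.u j (W f)‖ ≤ C * (R / max 1 R / √(max 1 R) * ‖(surfShift d).avg k f‖) ∧
        ‖Hel.G i j (W f)‖ ≤ C * (R / max 1 R * √(max 1 R) * ‖(surfShift d).avg k f‖) := by
  obtain ⟨C, hC, hprof⟩ := exists_profile
  set β := 6 * Real.pi * ℓ
  have hβ : 0 < β := by positivity
  refine ⟨C * (1 + β) ^ 2 * (6 * Real.pi) * √ℓ * (1 / ℓ + 1 / ℓ ^ 2), by positivity,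
    fun R k hR hk => ?_⟩
  set R' := max 1 R
  have hR1 : 1 ≤ R' := le_max_left _ _
  have hR2 : R ≤ R' := le_max_right _ _
  have hc : 0 < R' / ℓ := by positivity
  -- The layer has width `ℓ / R' ≤ ℓ`, so the profile and its derivative vanish at the bottom.
  obtain ⟨χ, hχ, x1, b0, b1, b2, hz⟩ := hprof ℓ (R' / ℓ) hc
  have h0 : ∀ j : Fin (d + 1), prof χ j 0 = 0 := by
    have h3 := hz 0 (by
      rw [one_div_div, sub_nonneg, div_le_iff₀ (by linarith)]; nlinarith)
    intro j
    refine Fin.lastCases ?_ (fun j => ?_) j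
    · rw [prof_last]; exact h3.1
    · rw [prof_castSucc]; exact h3.2.1
  have hBc : 6 * Real.pi * R ≤ β * (R' / ℓ) := by
    simp only [β]
    rw [mul_assoc (6 * Real.pi), mul_div_cancel₀ _ hℓ.ne']
    gcongr
  have hbound := fun f => norm_testField_le (hℓ := hℓ) (hχ := hχ) (h0 := h0) (k := k) (B := 6 * Real.pi * R)
    (by positivity) hc hC.le hβ.le hBc hk b0 b1 b2 hz f
  -- The normalisation by `R'⁻²` makes the damping obtained from the trace `-Δf` of size `(R /
  -- R')²`, bounded uniformly in `R`.
  refine ⟨(R' ^ 2)⁻¹ • testField d hℓ hχ h0 k, fun f => ?_, fun f i j => ?_⟩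
  · exact (isNormalTrace_testField (hℓ := hℓ) (hχ := hχ) (h0 := h0) (k := k) x1 f).smul _
  · obtain ⟨h3, h4⟩ := hbound f i j
    set b := ‖(surfShift d).avg k f‖
    have hs : √(1 / (R' / ℓ)) = √ℓ / √R' := by rw [one_div_div, Real.sqrt_div hℓ.le]
    have hR' : √R' * √R' = R' := Real.mul_self_sqrt (by linarith)
    have hsR : 0 < √R' := by positivity
    have hb : 0 ≤ b := norm_nonneg _
    rw [hs] at h3 h4
    simp only [smul_apply, map_smul, norm_smul, norm_inv, Real.norm_of_nonneg (sq_nonneg R')]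
    constructor
    · calc _ ≤ (R' ^ 2)⁻¹ * (C * (1 + β) * (√ℓ / √R' * (R' / ℓ) * (6 * Real.pi * R) * b)) := by
            gcongr
        _ = C * (1 + β) * (6 * Real.pi) * √ℓ * (1 / ℓ) * (R / R' / √R' * b) := by
            field_simp
        _ ≤ _ := by
            gcongr ?_ * _ * _ * ?_ * _
            · have : 1 + β ≤ (1 + β) ^ 2 := by nlinarith
              gcongr
            · have : 0 < 1 / ℓ ^ 2 := by positivity
              linarith
    · calc _ ≤ (R' ^ 2)⁻¹ * (C * (1 + β) ^ 2 * (√ℓ / √R' * (R' / ℓ) ^ 2 * (6 * Real.pi * R) * b)) := by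
            gcongr
        _ = C * (1 + β) ^ 2 * (6 * Real.pi) * √ℓ * (1 / ℓ ^ 2) * (R / R' * √R' * b) := by
            field_simp
            rw [sq, hR']
        _ ≤ _ := by
            gcongr ?_ * _
            gcongr
            have : 0 < 1 / ℓ := by positivity
            linarith

end Profile

/-! ### Korn–Poincaré inequalities for localised fields -/

section Korn

variable {d : ℕ} {ℓ : ℝ}

theorem symGradInner_self_nonneg (v : Hel d ℓ) : 0 ≤ symGradInner v v := by
  rw [symGradInner_eq]
  exact Finset.sum_nonneg fun i _ => Finset.sum_nonneg fun j _ => real_inner_self_nonneg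

theorem norm_sq_D_le (v : Hel d ℓ) (i j : Fin (d + 1)) : ‖Hel.D i j v‖ ^ 2 ≤ symGradInner v v := by
  rw [symGradInner_eq]
  simp only [real_inner_self_eq_norm_sq]
  refine le_trans ?_ (Finset.single_le_sum (f := fun i => ∑ j, ‖Hel.D i j v‖ ^ 2)
    (fun i _ => Finset.sum_nonneg fun j _ => sq_nonneg _) (Finset.mem_univ i))
  exact Finset.single_le_sum (f := fun j => ‖Hel.D i j v‖ ^ 2) (fun j _ => sq_nonneg _)
    (Finset.mem_univ j)

theorem norm_D_le (v : Hel d ℓ) (i j : Fin (d + 1)) : ‖Hel.D i j v‖ ≤ √(symGradInner v v) :=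
  Real.le_sqrt_of_sq_le (norm_sq_D_le v i j)

/-- The diagonal entry of `𝔻v` is `2 ∂_N v_N`. So the vertical component and its trace are
controlled by `𝔻v` through one-dimensional inequalities, without Korn. -/
theorem norm_vertical_G_le (v : Hel d ℓ) :
    ‖Hel.G (Fin.last d) (Fin.last d) v‖ ≤ √(symGradInner v v) / 2 := by
  have h := norm_D_le v (Fin.last d) (Fin.last d)
  rw [Hel.D, ← two_smul ℝ, smul_apply, norm_smul, Real.norm_ofNat] at h
  linarith

theorem norm_vertical_u_le (hℓ : 0 < ℓ) (v : Hel d ℓ) :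
    ‖Hel.u (Fin.last d) v‖ ≤ ℓ * √(symGradInner v v) / 2 := by
  have := poincare hℓ (Hel.vanishes v (Fin.last d))
  have := mul_le_mul_of_nonneg_left (norm_vertical_G_le v) hℓ.le
  linarith

theorem norm_normalTrace_le (hℓ : 0 < ℓ) {v : Hel d ℓ} {τ : SurfL2 d} (h : Hel.IsNormalTrace v τ) :
    ‖τ‖ ≤ √ℓ * √(symGradInner v v) := by
  have h1 := norm_trace_le hℓ (Hel.vanishes v (Fin.last d)) ((Hel.isNormalTrace_iff v τ).1 h)
  refine h1.trans ?_
  have := norm_vertical_G_le v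
  gcongr
  linarith [Real.sqrt_nonneg (symGradInner v v)]

theorem avg_G (k : SchwartzMap (Cross d) ℝ) (v : Hel d ℓ) (i : Fin d) (j : Fin (d + 1)) :
    (slabShift d ℓ).avg k (Hel.G i.castSucc j v) = (slabShift d ℓ).avg (∂_{hdir i} k) (Hel.u j v) :=
  avg_weakPartial (Hel.weakPartial v i.castSucc j) k

/-- For horizontal components `∂_N w_j = (𝔻w)_{Nj} - ∂_j w_N`. On band limited fields `∂_j` costs at
most `B`, so the last term is controlled by `w_N`, and vertical Poincaré concludes. -/
theorem low_frequency_korn (hℓ : 0 < ℓ) {B : ℝ} (hB : 0 ≤ B) {k : SchwartzMap (Cross d) ℝ}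
    (hk : BandLimited B k) (v : Hel d ℓ) (j : Fin (d + 1)) :
    ‖Hel.u j (Hel.avg k v)‖ ≤ ℓ * (1 + B * ℓ) * √(symGradInner (Hel.avg k v) (Hel.avg k v)) := by
  set w := Hel.avg k v with hw
  set δ := √(symGradInner w w)
  have hδ : 0 ≤ δ := Real.sqrt_nonneg _
  have h1 := norm_vertical_u_le hℓ w
  refine Fin.lastCases ?_ (fun j => ?_) j
  · have : 0 ≤ ℓ * (B * ℓ) * δ := by positivity
    have : 0 ≤ ℓ * δ := by positivity
    linarith
  · have h2 := poincare hℓ (Hel.vanishes w j.castSucc)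
    have h3 : Hel.G (Fin.last d) j.castSucc w
        = Hel.D (Fin.last d) j.castSucc w - Hel.G j.castSucc (Fin.last d) w := by
      rw [Hel.D, add_apply]; abel
    have h4 : ‖Hel.G j.castSucc (Fin.last d) w‖ ≤ B * ‖Hel.u (Fin.last d) w‖ := by
      rw [hw, Hel.G_avg, avg_G, Hel.u_avg]
      exact norm_avg_le hB (hk.norm_khat_lineDeriv_le j) _
    rw [h3] at h2
    have h5 := norm_sub_le (Hel.D (Fin.last d) j.castSucc w) (Hel.G j.castSucc (Fin.last d) w)
    have h6 := norm_D_le w (Fin.last d) j.castSucc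
    have h7 := mul_le_mul_of_nonneg_left h1 hB
    have h8 : 0 ≤ B * ℓ * δ := by positivity
    refine h2.trans ?_
    rw [mul_assoc]
    gcongr
    linarith

theorem Shift.avg_zero {X : Type*} [TopologicalSpace X] [MeasurableSpace X] [BorelSpace X]
    {μ : Measure X} [R1Space X] [μ.InnerRegularCompactLTTop] [IsLocallyFiniteMeasure μ]
    (S : Shift d μ) (w : Lp ℝ 2 μ) : S.avg 0 w = 0 := by
  simp [S.avg_apply]

theorem Shift.avg_add {X : Type*} [TopologicalSpace X] [MeasurableSpace X] [BorelSpace X]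
    {μ : Measure X} [R1Space X] [μ.InnerRegularCompactLTTop] [IsLocallyFiniteMeasure μ]
    (S : Shift d μ) (k k' : SchwartzMap (Cross d) ℝ) (w : Lp ℝ 2 μ) :
    S.avg (k + k') w = S.avg k w + S.avg k' w := by
  simp only [S.avg_apply, add_apply, add_smul]
  exact integral_add (S.integrable_smul_transl k.integrable w)
    (S.integrable_smul_transl k'.integrable w)

theorem khat_zero (ξ : Cross d) : khat 0 ξ = 0 := by simp [khat_apply]

theorem khat_add (k k' : SchwartzMap (Cross d) ℝ) (ξ : Cross d) :
    khat (k + k') ξ = khat k ξ + khat k' ξ := by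
  have := khat_sum Finset.univ (![k, k']) ξ
  simpa using this

/-- Korn's inequality on the Fourier side: the right-hand side expands to `2|x|²|a|² + 2|x·a|²`. -/
theorem sum_sq_le_sum_sym_sq (x : Fin d → ℝ) (a : Fin d → ℂ) :
    (∑ i, x i ^ 2) * ∑ j, ‖a j‖ ^ 2
      ≤ ∑ p : Fin d × Fin d, ‖(x p.1 : ℂ) * a p.2 + (x p.2 : ℂ) * a p.1‖ ^ 2 := by
  have h1 : ∀ i j : Fin d, ‖(x i : ℂ) * a j + (x j : ℂ) * a i‖ ^ 2
      = x i ^ 2 * ‖a j‖ ^ 2 + x j ^ 2 * ‖a i‖ ^ 2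
        + 2 * ((x i * (a i).re) * (x j * (a j).re) + (x i * (a i).im) * (x j * (a j).im)) := by
    intro i j
    simp only [← Complex.normSq_eq_norm_sq, Complex.normSq_apply, Complex.add_re, Complex.add_im,
      Complex.re_ofReal_mul, Complex.im_ofReal_mul]
    ring
  rw [Fintype.sum_prod_type]
  simp only [h1, Finset.sum_add_distrib, ← Finset.mul_sum, ← Finset.sum_mul]
  have h2 : 0 ≤ (∑ i, x i ^ 2) * ∑ j, ‖a j‖ ^ 2 := by positivity
  nlinarith [sq_nonneg (∑ i, x i * (a i).re), sq_nonneg (∑ i, x i * (a i).im)]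

/-- Only the horizontal block of `𝔻` is used. Its symbol is the symmetrised product of `2πξ` with
the amplitude, and `2π|ξ| ≥ 1` absorbs the frequency. -/
theorem high_frequency_korn {k : SchwartzMap (Cross d) ℝ}
    (hk : ∀ ξ, khat k ξ ≠ 0 → 1 ≤ 2 * Real.pi * ‖ξ‖) (v : Hel d ℓ) :
    ∑ i : Fin d, ‖Hel.u i.castSucc (Hel.avg k v)‖ ^ 2
      ≤ symGradInner (Hel.avg k v) (Hel.avg k v) := by
  have h1 := sum_norm_sq_avg_le (fun i : Fin d => Hel.u i.castSucc v)
    (fun i j : Fin d => if i = j then k else 0)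
    (fun (p : Fin d × Fin d) j => (if p.2 = j then ∂_{hdir p.1} k else 0)
      + if p.1 = j then ∂_{hdir p.2} k else 0) (fun ξ a => by
      have e1 : ∀ i, ∑ j, khat (if i = j then k else 0) ξ * a j = khat k ξ * a i := by
        intro i
        rw [Finset.sum_eq_single i (fun j _ hj => by rw [if_neg hj.symm, khat_zero, zero_mul])
          (by simp), if_pos rfl]
      have e2 : ∀ p : Fin d × Fin d, ∑ j, khat ((if p.2 = j then ∂_{hdir p.1} k else 0)
          + if p.1 = j then ∂_{hdir p.2} k else 0) ξ * a j
          = 2 * Real.pi * Complex.I * khat k ξ * ((ξ p.1 : ℂ) * a p.2 + (ξ p.2 : ℂ) * a p.1) := by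
        intro p
        simp only [khat_add, add_mul, Finset.sum_add_distrib]
        rw [Finset.sum_eq_single p.2 (fun j _ hj => by rw [if_neg hj.symm, khat_zero, zero_mul])
          (by simp), if_pos rfl,
          Finset.sum_eq_single p.1 (fun j _ hj => by rw [if_neg hj.symm, khat_zero, zero_mul])
          (by simp), if_pos rfl, khat_lineDeriv, khat_lineDeriv]
        simp only [hdir, EuclideanSpace.inner_single_right]
        simp
        ring
      simp only [e1, e2, norm_mul, mul_pow, ← Finset.mul_sum]
      by_cases h0 : khat k ξ = 0
      · simp [h0]
      · have h2 := hk ξ h0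
        have h3 := sum_sq_le_sum_sym_sq ξ a
        rw [show ∑ i, ξ i ^ 2 = ‖ξ‖ ^ 2 by simp [EuclideanSpace.norm_sq_eq]] at h3
        simp only [Complex.norm_I, Complex.norm_real, Complex.norm_ofNat, one_pow, mul_one,
          Real.norm_of_nonneg Real.pi_pos.le]
        have h4 : 1 ≤ (2 * Real.pi * ‖ξ‖) ^ 2 := one_le_pow₀ h2
        have h5 : 0 ≤ ∑ j, ‖a j‖ ^ 2 := by positivity
        calc _ ≤ ‖khat k ξ‖ ^ 2 * ((2 * Real.pi * ‖ξ‖) ^ 2 * ∑ j, ‖a j‖ ^ 2) := by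
              gcongr
              nlinarith
          _ = (2 * Real.pi) ^ 2 * ‖khat k ξ‖ ^ 2 * (‖ξ‖ ^ 2 * ∑ j, ‖a j‖ ^ 2) := by ring
          _ ≤ (2 * Real.pi) ^ 2 * ‖khat k ξ‖ ^ 2 * _ := mul_le_mul_of_nonneg_left h3 (by positivity)
          _ = _ := by ring)
  have e1 : ∀ i : Fin d, ∑ j, (slabShift d ℓ).avg (if i = j then k else 0) (Hel.u j.castSucc v)
      = Hel.u i.castSucc (Hel.avg k v) := by
    intro i
    rw [Finset.sum_eq_single i (fun j _ hj => by rw [if_neg hj.symm, Shift.avg_zero]) (by simp),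
      if_pos rfl, Hel.u_avg]
  have e2 : ∀ p : Fin d × Fin d, ∑ j, (slabShift d ℓ).avg ((if p.2 = j then ∂_{hdir p.1} k else 0)
      + if p.1 = j then ∂_{hdir p.2} k else 0) (Hel.u j.castSucc v)
      = Hel.D p.1.castSucc p.2.castSucc (Hel.avg k v) := by
    intro p
    simp only [Shift.avg_add, Finset.sum_add_distrib]
    rw [Finset.sum_eq_single p.2 (fun j _ hj => by rw [if_neg hj.symm, Shift.avg_zero]) (by simp),
      Finset.sum_eq_single p.1 (fun j _ hj => by rw [if_neg hj.symm, Shift.avg_zero]) (by simp),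
      if_pos rfl, if_pos rfl, Hel.D, add_apply, Hel.G_avg, Hel.G_avg, avg_G, avg_G]
  simp only [e1, e2] at h1
  refine h1.trans ?_
  rw [symGradInner_eq, Fintype.sum_prod_type]
  simp only [real_inner_self_eq_norm_sq]
  rw [Fin.sum_univ_castSucc]
  have h2 : ∀ i : Fin d, ∑ j : Fin d, ‖Hel.D i.castSucc j.castSucc (Hel.avg k v)‖ ^ 2
      ≤ ∑ j, ‖Hel.D i.castSucc j (Hel.avg k v)‖ ^ 2 := by
    intro i
    rw [Fin.sum_univ_castSucc]
    exact le_add_of_nonneg_right (sq_nonneg _)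
  exact (Finset.sum_le_sum fun i _ => h2 i).trans
    (le_add_of_nonneg_right (Finset.sum_nonneg fun _ _ => sq_nonneg _))

/-- A Korn-Poincaré inequality for frequency localised fields, uniform in the frequency. -/
theorem exists_korn (d : ℕ) {ℓ : ℝ} (hℓ : 0 < ℓ) : ∃ C : ℝ, 0 < C ∧ ∀ (R : ℝ)
    (k : SchwartzMap (Cross d) ℝ), 0 < R → BandLimited (6 * Real.pi * R) k →
    (∀ ξ, khat k ξ ≠ 0 → R ≤ 2 * Real.pi * ‖ξ‖) → ∀ v : Hel d ℓ,
      ‖Hel.field (Hel.avg k v)‖ ^ 2 ≤ C * symGradInner (Hel.avg k v) (Hel.avg k v) := by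
  set C1 := ℓ * (1 + 6 * Real.pi * ℓ)
  refine ⟨(d + 1) * C1 ^ 2 + 1 + ℓ ^ 2, by positivity, fun R k hR h1 h2 v => ?_⟩
  set S := symGradInner (Hel.avg k v) (Hel.avg k v) with hS
  have hS0 : 0 ≤ S := symGradInner_self_nonneg _
  rw [Hel.norm_sq_field]
  have hC1 : 0 ≤ C1 := by positivity
  -- For `R ≤ 1` the band limit is at most `6π`, so the low frequency constant is uniform; for `R ≥
  -- 1` the high frequency inequality applies.
  rcases le_total R 1 with hR1 | hR1
  · have h3 : ∀ j, ‖Hel.u j (Hel.avg k v)‖ ^ 2 ≤ C1 ^ 2 * S := by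
      intro j
      have h4 := low_frequency_korn hℓ (by positivity) h1 v j
      have h5 : ‖Hel.u j (Hel.avg k v)‖ ≤ C1 * √S := by
        refine h4.trans ?_
        gcongr ?_ * _
        have : 6 * Real.pi * R * ℓ ≤ 6 * Real.pi * ℓ := by
          have : 0 ≤ 6 * Real.pi * ℓ := by positivity
          nlinarith
        simp only [C1]
        gcongr
      calc _ ≤ (C1 * √S) ^ 2 := by gcongr
        _ = _ := by rw [mul_pow, Real.sq_sqrt hS0]
    refine (Finset.sum_le_sum fun j _ => h3 j).trans ?_
    rw [Finset.sum_const, Finset.card_univ, Fintype.card_fin, nsmul_eq_mul]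
    push_cast
    have : 0 ≤ (1 + ℓ ^ 2) * S := by positivity
    linarith
  · rw [Fin.sum_univ_castSucc]
    have h3 := high_frequency_korn (fun ξ hξ => hR1.trans (h2 ξ hξ)) v
    have h4 : ‖Hel.u (Fin.last d) (Hel.avg k v)‖ ^ 2 ≤ ℓ ^ 2 * S := by
      have h5 := norm_vertical_u_le hℓ (Hel.avg k v)
      have h6 : ‖Hel.u (Fin.last d) (Hel.avg k v)‖ ≤ ℓ * √S := by
        have : 0 ≤ ℓ * √S := by positivity
        linarith
      calc _ ≤ (ℓ * √S) ^ 2 := by gcongr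
        _ = _ := by rw [mul_pow, Real.sq_sqrt hS0]
    have : 0 ≤ (d + 1) * C1 ^ 2 * S := by positivity
    linarith

end Korn

/-! ### The surface energy in a band -/

section SurfaceEnergy

variable {d : ℕ}

theorem symbol_nonneg {g σ : ℝ} (hg : 0 < g) (hσ : 0 < σ) (r : ℝ) (ξ : Cross d) :
    0 ≤ symbol g σ r ξ := by unfold symbol; positivity

theorem continuous_symbol (g σ : ℝ) {r : ℝ} (hr : 0 ≤ r) :
    Continuous (symbol g σ r : Cross d → ℝ) := by
  unfold symbol
  exact continuous_const.add (continuous_const.mul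
    ((by fun_prop : Continuous fun ξ : Cross d => 2 * Real.pi * ‖ξ‖).rpow_const fun _ =>
      Or.inr (by positivity)))

theorem inner_hatL (f h : SurfL2 d) :
    (inner ℝ (hatL d f) (hatL d h) : ℝ) = inner ℝ f h :=
  LinearIsometry.inner_map_map
    (⟨(hatL d).toLinearMap, norm_hatL⟩ : SurfL2 d →ₗᵢ[ℝ] Lp ℂ 2 (volume : Measure (Cross d))) f h

theorem inner_ofReal_mul (a b : ℝ) (z w : ℂ) :
    (inner ℝ ((a : ℂ) * z) ((b : ℂ) * w) : ℝ) = a * b * inner ℝ z w := by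
  simp only [Complex.inner, map_mul, Complex.conj_ofReal]
  rw [show (b : ℂ) * w * ((a : ℂ) * (starRingEnd ℂ) z) = ((a * b : ℝ) : ℂ) * (w * (starRingEnd ℂ) z)
    by push_cast; ring, Complex.re_ofReal_mul]

theorem measurable_root {g σ r : ℝ} (hr : 0 ≤ r) {φ : Cross d → ℝ} (hφ : Continuous φ) :
    Measurable fun ξ : Cross d => ((√(symbol g σ r ξ) * φ ξ : ℝ) : ℂ) :=
  (Complex.continuous_ofReal.comp ((continuous_symbol g σ hr).sqrt.mul hφ)).measurable

theorem IsBandKernel.norm_root_le {R : ℝ} {k : SchwartzMap (Cross d) ℝ} {φ : Cross d → ℝ}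
    (h : IsBandKernel R k φ) {g σ r : ℝ} (hσ : 0 < σ) (hr : 0 ≤ r) (ξ : Cross d) :
    ‖((√(symbol g σ r ξ) * φ ξ : ℝ) : ℂ)‖ ≤ √(g + σ * (6 * Real.pi * R) ^ (2 * r)) := by
  rw [Complex.norm_real, norm_mul, Real.norm_of_nonneg (Real.sqrt_nonneg _),
    Real.norm_of_nonneg (h.nonneg ξ)]
  by_cases h0 : φ ξ = 0
  · rw [h0, mul_zero]; positivity
  · refine (mul_le_of_le_one_right (Real.sqrt_nonneg _) (h.le_one ξ)).trans (Real.sqrt_le_sqrt ?_)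
    unfold symbol
    have := h.bandLimited ξ (by rw [h.khat_eq]; simpa using h0)
    gcongr

/-- The Fourier transform of `h` weighted by `√μ φ`; its norm is the surface energy in a band. -/
def IsBandKernel.J {R : ℝ} {k : SchwartzMap (Cross d) ℝ} {φ : Cross d → ℝ}
    (h : IsBandKernel R k φ) (g : ℝ) {σ r : ℝ} (hσ : 0 < σ) (hr : 0 ≤ r) :
    SurfL2 d →L[ℝ] Lp ℂ 2 (volume : Measure (Cross d)) :=
  ((mulL (measurable_root (g := g) (σ := σ) hr h.cont)
    (h.norm_root_le hσ hr)).restrictScalars ℝ).comp (hatL d)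

variable {R : ℝ} {k : SchwartzMap (Cross d) ℝ} {φ : Cross d → ℝ} (hk : IsBandKernel R k φ)
  {g σ r : ℝ} (hσ : 0 < σ) (hr : 0 ≤ r)

theorem IsBandKernel.coeFn_J (f : SurfL2 d) : hk.J g hσ hr f =ᵐ[volume]
    fun ξ => ((√(symbol g σ r ξ) * φ ξ : ℝ) : ℂ) * hatL d f ξ :=
  coeFn_mulL (measurable_root hr hk.cont) (hk.norm_root_le hσ hr) (hatL d f)

/-- Plancherel with `μ φ² = (√μ φ)²`. Applied to `f' = ∂_t h`, it identifies the boundary term of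
the momentum equation with the time derivative of the surface energy. -/
theorem IsBandKernel.inner_multiplier (hg : 0 < g) {f f' m : SurfL2 d}
    (hm : IsMultiplier (symbol g σ r) f m) :
    inner ℝ m ((surfShift d).avg k ((surfShift d).avg k f'))
      = inner ℝ (hk.J g hσ hr f) (hk.J g hσ hr f') := by
  rw [← inner_hatL, L2.inner_def, L2.inner_def]
  refine integral_congr_ae ?_
  filter_upwards [hm, hk.coeFn_J hσ hr f, hk.coeFn_J hσ hr f', hatL_avg k f',
    hatL_avg k ((surfShift d).avg k f')] with ξ h1 h2 h3 h4 h5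
  rw [hat_coe, hat_coe] at h1
  rw [h1, h2, h3, h5, h4, hk.khat_eq, ← mul_assoc, ← Complex.ofReal_mul, inner_ofReal_mul,
    inner_ofReal_mul]
  have := Real.mul_self_sqrt (symbol_nonneg hg hσ r ξ)
  linear_combination (-(φ ξ * φ ξ) * inner ℝ (hatL d f ξ) (hatL d f' ξ)) * this

/-- On the support of `φ` the symbol `(2π|ξ|)²` of `-Δ` is at least `R²`. This is the coercivity in
`h` that the test field supplies. -/
theorem IsBandKernel.le_inner_multiplier (hg : 0 < g) {f m : SurfL2 d}
    (hm : IsMultiplier (symbol g σ r) f m) :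
    R ^ 2 * ‖hk.J g hσ hr f‖ ^ 2
      ≤ inner ℝ m ((surfShift d).avg k ((surfShift d).avg (-lap k) f)) := by
  rw [← inner_hatL, ← real_inner_self_eq_norm_sq, L2.inner_def, L2.inner_def,
    ← integral_const_mul]
  refine integral_mono_ae ((L2.integrable_inner _ _).const_mul _) (L2.integrable_inner _ _) ?_
  filter_upwards [hm, hk.coeFn_J hσ hr f, hatL_avg (-lap k) f,
    hatL_avg k ((surfShift d).avg (-lap k) f)] with ξ h1 h2 h4 h5
  rw [hat_coe, hat_coe] at h1
  rw [h1, h2, h5, h4, khat_neg, khat_lap, hk.khat_eq, ← mul_assoc,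
    show (φ ξ : ℂ) * -(-(((2 * Real.pi * ‖ξ‖) ^ 2 : ℝ) : ℂ) * (φ ξ : ℂ))
      = ((φ ξ ^ 2 * (2 * Real.pi * ‖ξ‖) ^ 2 : ℝ) : ℂ) by push_cast; ring,
    inner_ofReal_mul, inner_ofReal_mul]
  have h6 := Real.mul_self_sqrt (symbol_nonneg hg hσ r ξ)
  have h7 : (0 : ℝ) ≤ inner ℝ (hatL d f ξ) (hatL d f ξ) := real_inner_self_nonneg
  by_cases h0 : φ ξ = 0
  · simp [h0]
  · have h8 : R ^ 2 ≤ (2 * Real.pi * ‖ξ‖) ^ 2 := by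
      have := hk.le_norm h0
      have := hk.pos
      gcongr
    calc R ^ 2 * (√(symbol g σ r ξ) * φ ξ * (√(symbol g σ r ξ) * φ ξ) * inner ℝ (hatL d f ξ) (hatL d f ξ))
        = R ^ 2 * (symbol g σ r ξ * φ ξ ^ 2 * inner ℝ (hatL d f ξ) (hatL d f ξ)) := by
          linear_combination (R ^ 2 * φ ξ ^ 2 * inner ℝ (hatL d f ξ) (hatL d f ξ)) * h6
      _ ≤ (2 * Real.pi * ‖ξ‖) ^ 2 * (symbol g σ r ξ * φ ξ ^ 2 * inner ℝ (hatL d f ξ) (hatL d f ξ)) := by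
          have := symbol_nonneg hg hσ r ξ
          gcongr
      _ = _ := by ring

/-- For `R ≤ 1` the constant part `g` of the symbol suffices; for `R ≥ 1` the fractional part does,
since `2π|ξ| ≥ R` on the support. -/
theorem IsBandKernel.le_symbol {R : ℝ} {k : SchwartzMap (Cross d) ℝ} {φ : Cross d → ℝ}
    (hk : IsBandKernel R k φ) {g σ r : ℝ} (hσ : 0 < σ) (hr : 0 ≤ r) (hg : 0 < g) {ξ : Cross d}
    (h0 : φ ξ ≠ 0) :
    min g σ * (max 1 R) ^ (2 * r) ≤ symbol g σ r ξ := by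
  have h1 := hk.le_norm h0
  have hR := hk.pos
  unfold symbol
  rcases le_total R 1 with h | h
  · rw [max_eq_left h, Real.one_rpow, mul_one]
    exact (min_le_left _ _).trans (le_add_of_nonneg_right (by positivity))
  · rw [max_eq_right h]
    calc _ ≤ σ * (2 * Real.pi * ‖ξ‖) ^ (2 * r) := by
          gcongr
          exact min_le_right _ _
      _ ≤ _ := le_add_of_nonneg_left hg.le

theorem IsBandKernel.norm_avg_le_J (hg : 0 < g) (f : SurfL2 d) :
    ‖(surfShift d).avg k f‖ ≤ (√(min g σ))⁻¹ * ((max 1 R) ^ r)⁻¹ * ‖hk.J g hσ hr f‖ := by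
  have hR : 0 < max 1 R := by positivity
  have hmin : 0 < min g σ := lt_min hg hσ
  rw [← norm_hatL]
  refine Lp.norm_le_mul_norm_of_ae_le_mul ?_
  filter_upwards [hk.coeFn_J hσ hr f, hatL_avg k f] with ξ h1 h2
  rw [h1, h2, hk.khat_eq, norm_mul, norm_mul, Complex.norm_real, Complex.norm_real, ← mul_assoc,
    norm_mul]
  refine mul_le_mul_of_nonneg_right ?_ (norm_nonneg _)
  by_cases h0 : φ ξ = 0
  · simp [h0]
  · rw [← mul_assoc]
    refine le_mul_of_one_le_left (norm_nonneg _) ?_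
    rw [Real.norm_of_nonneg (Real.sqrt_nonneg _), ← mul_inv, inv_mul_eq_div,
      one_le_div (by positivity)]
    refine Real.le_sqrt_of_sq_le ?_
    rw [mul_pow, Real.sq_sqrt hmin.le, ← Real.rpow_natCast, ← Real.rpow_mul hR.le]
    have := hk.le_symbol hσ hr hg h0
    rw [mul_comm 2 r] at this
    exact_mod_cast this

end SurfaceEnergy

/-! ### The scalar Lyapunov inequality -/

section Scalar

/-- The pointwise dissipation estimate behind the Lyapunov functional `L = E + ε X`. -/
theorem lyapunov_pointwise {C p S δ q a s x' X : ℝ} (hC : 1 ≤ C) (hp : 0 ≤ p) (hS : 0 ≤ S) (hδ : 0 ≤ δ)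
    (hq : 0 ≤ q) (hq1 : q ≤ 1) (hs : 0 ≤ s) (hs1 : s ≤ 1) (hsa : s * a ^ 2 ≤ 1)
    (hx' : x' ≤ C * (δ * q * a * S) + C * (p * δ * q) - q ^ 2 * S ^ 2)
    (hX : |X| ≤ C * (p * q * S)) (hpδ : p ^ 2 ≤ C * δ ^ 2) :
    -(δ ^ 2 / 2) + s / (8 * C ^ 2) * x'
      ≤ -(1 / (32 * C ^ 3) * (s * q ^ 2) * ((p ^ 2 + S ^ 2) / 2 + s / (8 * C ^ 2) * X)) ∧
    (p ^ 2 + S ^ 2) / 4 ≤ (p ^ 2 + S ^ 2) / 2 + s / (8 * C ^ 2) * X ∧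
    (p ^ 2 + S ^ 2) / 2 + s / (8 * C ^ 2) * X ≤ p ^ 2 + S ^ 2 := by
  -- In the application `p = ‖k * u‖`, `S = ‖J h‖`, `δ² = ‖𝔻(k * u)‖²`, `q = R / R'`, `a = R'^(1/2 -
  -- r)`. The factor `s` with `s a² ≤ 1` compensates the large gradient of the test field; `1 / (8
  -- C²)` keeps `|εX|` below half the energy and the error `3δ²/16` below the dissipation `δ²/2`.
  set ε := s / (8 * C ^ 2) with hε
  have hC0 : 0 < C := by linarith
  have hε0 : 0 ≤ ε := by positivity
  have hεX : |ε * X| ≤ (p ^ 2 + S ^ 2) / 4 := by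
    rw [abs_mul, abs_of_nonneg hε0]
    have h1 : C * (p * q * S) ≤ C * (p * S) := by
      have : 0 ≤ p * S := by positivity
      gcongr
      nlinarith
    have h2 : ε * C ≤ 1 / 8 := by
      rw [hε, div_mul_eq_mul_div, div_le_div_iff₀ (by positivity) (by positivity)]
      nlinarith [mul_nonneg hC0.le (sub_nonneg.2 hC)]
    have h3 : 0 ≤ p * S := by positivity
    calc ε * |X| ≤ ε * (C * (p * S)) := by gcongr; exact hX.trans h1
      _ = (ε * C) * (p * S) := by ring
      _ ≤ 1 / 8 * (p * S) := by gcongr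
      _ ≤ _ := by nlinarith [sq_nonneg (p - S)]
  obtain ⟨hX1, hX2⟩ := abs_le.1 hεX
  refine ⟨?_, by linarith, by linarith⟩
  have hL : (p ^ 2 + S ^ 2) / 2 + ε * X ≤ p ^ 2 + S ^ 2 := by linarith
  have hpd : p * δ ≤ C * δ ^ 2 := by
    have h1 : p ≤ C * δ := by
      refine abs_le_of_sq_le_sq' ?_ (by positivity) |>.2
      rw [mul_pow]
      nlinarith [mul_nonneg (mul_nonneg hC0.le (sub_nonneg.2 hC)) (sq_nonneg δ)]
    nlinarith
  have hx2 : s * x' ≤ 3 / 2 * C ^ 2 * δ ^ 2 - s * q ^ 2 * S ^ 2 / 2 := by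
    -- Young's inequality spends half of the damping in `S`; the remaining term carries `a²`, which
    -- `s` absorbs.
    have h1 : C * (δ * q * a * S) ≤ q ^ 2 * S ^ 2 / 2 + C ^ 2 * a ^ 2 * δ ^ 2 / 2 := by
      nlinarith [sq_nonneg (q * S - C * a * δ)]
    have h2 : C * (p * δ * q) ≤ C ^ 2 * δ ^ 2 := by
      have : p * δ * q ≤ p * δ := mul_le_of_le_one_right (by positivity) hq1
      calc C * (p * δ * q) ≤ C * (C * δ ^ 2) := mul_le_mul_of_nonneg_left (this.trans hpd) hC0.le
        _ = _ := by ring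
    have h3 : s * x' ≤ s * (q ^ 2 * S ^ 2 / 2 + C ^ 2 * a ^ 2 * δ ^ 2 / 2 + C ^ 2 * δ ^ 2
        - q ^ 2 * S ^ 2) := by
      gcongr; linarith
    have h4 : s * a ^ 2 * (C ^ 2 * δ ^ 2) ≤ 1 * (C ^ 2 * δ ^ 2) := by gcongr
    have h5 : s * (C ^ 2 * δ ^ 2) ≤ 1 * (C ^ 2 * δ ^ 2) := by gcongr
    nlinarith
  have hεx : ε * x' ≤ 3 / 16 * δ ^ 2 - s * q ^ 2 * S ^ 2 / (16 * C ^ 2) := by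
    rw [hε, div_mul_eq_mul_div, div_le_iff₀ (by positivity)]
    calc s * x' ≤ _ := hx2
      _ = _ := by field_simp; ring
  have hρ : s * q ^ 2 ≤ 1 := mul_le_one₀ hs1 (by positivity) (pow_le_one₀ hq hq1)
  have hfin : 1 / (32 * C ^ 3) * (s * q ^ 2) * ((p ^ 2 + S ^ 2) / 2 + ε * X)
      ≤ δ ^ 2 / 32 + s * q ^ 2 * S ^ 2 / (32 * C ^ 2) := by
    have h1 : s * q ^ 2 * ((p ^ 2 + S ^ 2) / 2 + ε * X) ≤ C * δ ^ 2 + s * q ^ 2 * S ^ 2 := by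
      calc _ ≤ s * q ^ 2 * (p ^ 2 + S ^ 2) := by gcongr
        _ = s * q ^ 2 * p ^ 2 + s * q ^ 2 * S ^ 2 := by ring
        _ ≤ _ := by
          exact add_le_add_left ((mul_le_of_le_one_left (sq_nonneg p) hρ).trans hpδ) _
    have h2 : 1 ≤ C ^ 2 := one_le_pow₀ hC
    have h3 : 0 ≤ s * q ^ 2 * S ^ 2 := by positivity
    calc _ = 1 / (32 * C ^ 3) * (s * q ^ 2 * ((p ^ 2 + S ^ 2) / 2 + ε * X)) := by ring
      _ ≤ 1 / (32 * C ^ 3) * (C * δ ^ 2 + s * q ^ 2 * S ^ 2) := by gcongr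
      _ = δ ^ 2 / (32 * C ^ 2) + s * q ^ 2 * S ^ 2 / (32 * C ^ 3) := by field_simp
      _ ≤ _ := by
        gcongr
        · linarith
        · norm_num
  have h6 : s * q ^ 2 * S ^ 2 / (32 * C ^ 2) ≤ s * q ^ 2 * S ^ 2 / (16 * C ^ 2) := by
    gcongr; norm_num
  nlinarith [sq_nonneg δ]

end Scalar

/-! ### Almost everywhere statements in time -/

section Time

theorem ae_Ioi_of_forall_Ioo {p : ℝ → Prop}
    (h : ∀ T > 0, ∀ᵐ t ∂(volume.restrict (Ioo (0 : ℝ) T)), p t) :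
    ∀ᵐ t ∂(volume.restrict (Ioi (0 : ℝ))), p t := by
  have h1 : Ioi (0 : ℝ) = ⋃ n : ℕ, Ioo (0 : ℝ) (n + 1) := by
    ext t
    simp only [mem_Ioi, mem_iUnion, mem_Ioo]
    exact ⟨fun ht => (exists_nat_gt t).imp fun n hn => ⟨ht, by linarith⟩, fun ⟨n, hn⟩ => hn.1⟩
  rw [h1, ae_restrict_iUnion_iff]
  exact fun n => h _ (by positivity)

theorem aestronglyMeasurable_Ioi_of_forall_Ioo {E : Type*} [TopologicalSpace E]
    [TopologicalSpace.PseudoMetrizableSpace E] {f : ℝ → E}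
    (h : ∀ T > 0, AEStronglyMeasurable f (volume.restrict (Ioo (0 : ℝ) T))) :
    AEStronglyMeasurable f (volume.restrict (Ioi (0 : ℝ))) := by
  have h1 : Ioi (0 : ℝ) = ⋃ n : ℕ, Ioo (0 : ℝ) (n + 1) := by
    ext t
    simp only [mem_Ioi, mem_iUnion, mem_Ioo]
    exact ⟨fun ht => (exists_nat_gt t).imp fun n hn => ⟨ht, by linarith⟩, fun ⟨n, hn⟩ => hn.1⟩
  rw [h1, aestronglyMeasurable_iUnion_iff]
  exact fun n => h _ (by positivity)

theorem eqOn_Ici_of_ae_eq {E : Type*} [TopologicalSpace E] [T2Space E] {f g : ℝ → E}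
    (h : ∀ᵐ t ∂(volume.restrict (Ioi (0 : ℝ))), f t = g t) (hf : ContinuousOn f (Ici 0))
    (hg : ContinuousOn g (Ici 0)) : ∀ t, 0 ≤ t → f t = g t := by
  refine fun t ht => Measure.eqOn_of_ae_eq (μ := volume) ?_ hf hg ?_ ht
  · rw [← restrict_Ioi_eq_restrict_Ici]; exact h
  · rw [interior_Ici, closure_Ioi]

/-- The exceptional null set may depend on `v`. Strong measurability gives a separable essential
range, so that one null set serves for all `v`. -/
theorem ae_eq_of_forall_inner_eq {V : Type*} [NormedAddCommGroup V] [InnerProductSpace ℝ V]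
    [CompleteSpace V] {α : Type*} [MeasurableSpace α] {μ : Measure α} {f g : α → V}
    (hf : AEStronglyMeasurable f μ) (hg : AEStronglyMeasurable g μ)
    (h : ∀ v, ∀ᵐ t ∂μ, inner ℝ (f t) v = inner ℝ (g t) v) : f =ᵐ[μ] g := by
  obtain ⟨s, hs, hs'⟩ := (hf.sub hg).isSeparable_ae_range
  have h1 := ae_eq_zero_of_forall_dual_of_isSeparable ℝ hs (fun c => ?_) hs'
  · filter_upwards [h1] with t ht using sub_eq_zero.1 ht
  · filter_upwards [h ((InnerProductSpace.toDual ℝ V).symm c)] with t ht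
    change c (f t - g t) = 0
    rw [← InnerProductSpace.toDual_symm_apply, inner_sub_right, real_inner_comm, ht,
      real_inner_comm, sub_self]

end Time

/-! ### Localising the abstract evolution equation -/

section Abstract

variable {V H : Type*} [NormedAddCommGroup V] [InnerProductSpace ℝ V] [CompleteSpace V]
  [NormedAddCommGroup H] [InnerProductSpace ℝ H] [CompleteSpace H] {ι : V →L[ℝ] H}
  {u₀ : H} {u : ℝ → V} {u' : ℝ → (V →L[ℝ] ℝ)} {f : ℝ → V} {U : ℝ → H}

/-- The Riesz representative `f` of `∂_t u` and the continuous representative `U` of `u`. -/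
structure IsRepresented (ι : V →L[ℝ] H) (u₀ : H) (u : ℝ → V) (u' : ℝ → (V →L[ℝ] ℝ))
    (f : ℝ → V) (U : ℝ → H) : Prop where
  u_mem : ∀ T > 0, MemLp u 2 (volume.restrict (Ioo 0 T))
  f_mem : ∀ T > 0, MemLp f 2 (volume.restrict (Ioo 0 T))
  f_inner : ∀ s v, inner ℝ (f s) v = u' s v
  f_eq : ∀ᵐ t ∂(volume.restrict (Ioi (0 : ℝ))),
    ContinuousLinearMap.adjoint ι (ι (u t)) = ContinuousLinearMap.adjoint ι u₀ + ∫ s in (0 : ℝ)..t, f s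
  mem_closure : u₀ ∈ closure (range ι)
  U_cont : ContinuousOn U (Ici 0)
  U_zero : U 0 = u₀
  U_ae : ∀ᵐ t ∂(volume.restrict (Ioi (0 : ℝ))), U t = ι (u t)

theorem exists_isRepresented (hι : Function.Injective ι)
    (hu : ∀ T > 0, MemLp u 2 (volume.restrict (Ioo 0 T)))
    (hu' : ∀ T > 0, MemLp u' 2 (volume.restrict (Ioo 0 T))) (hu₀ : u₀ ∈ closure (range ι))
    (hd : ∀ v : V, ∀ᵐ t ∂(volume.restrict (Ioi (0 : ℝ))),
      inner ℝ (ι (u t)) (ι v) = inner ℝ u₀ (ι v) + ∫ s in (0 : ℝ)..t, u' s v) :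
    ∃ f U, IsRepresented ι u₀ u u' f U := by
  let f : ℝ → V := fun s => (InnerProductSpace.toDual ℝ V).symm (u' s)
  have f_mem : ∀ T > 0, MemLp f 2 (volume.restrict (Ioo 0 T)) := fun T hT => by
    refine MemLp.of_le (F := V →L[ℝ] ℝ) (hu' T hT) ((InnerProductSpace.toDual ℝ V).symm.continuous
      |>.comp_aestronglyMeasurable (hu' T hT).1) (ae_of_all _ fun t => ?_)
    rw [LinearIsometryEquiv.norm_map]
  have f_inner : ∀ s v, inner ℝ (f s) v = u' s v := fun s v =>
    InnerProductSpace.toDual_symm_apply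
  have f_eq : ∀ᵐ t ∂(volume.restrict (Ioi (0 : ℝ))),
      ContinuousLinearMap.adjoint ι (ι (u t))
        = ContinuousLinearMap.adjoint ι u₀ + ∫ s in (0 : ℝ)..t, f s := by
    refine ae_eq_of_forall_inner_eq ?_ ?_ fun v => ?_
    · refine aestronglyMeasurable_Ioi_of_forall_Ioo fun T hT => ?_
      exact ((ContinuousLinearMap.adjoint ι).comp ι).continuous.comp_aestronglyMeasurable (hu T hT).1
    · exact ((continuousOn_const.add (continuousOn_primitive f_mem)).mono
        Ioi_subset_Ici_self).aestronglyMeasurable measurableSet_Ioi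
    · filter_upwards [hd v, ae_restrict_mem measurableSet_Ioi] with t h1 ht
      have h2 : IntervalIntegrable f volume 0 t :=
        (intervalIntegrable_iff_integrableOn_Ioc_of_le (le_of_lt ht)).2
          (integrableOn_Ioc f_mem (le_of_lt ht))
      have h3 := (innerSL ℝ v).intervalIntegral_comp_comm h2
      simp only [innerSL_apply_apply, real_inner_comm _ v, f_inner] at h3
      rw [ContinuousLinearMap.adjoint_inner_left, h1, inner_add_left,
        ContinuousLinearMap.adjoint_inner_left, h3]
  obtain ⟨U, U1, U2, U3, -, -⟩ := exists_continuous_representative ι hι hu f_mem hu₀ f_eq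
  exact ⟨f, U, hu, f_mem, f_inner, f_eq, hu₀, U1, U2, U3⟩

/-- The energy identity and the weak equation after applying an operator `P` on `V` which is the
restriction of a symmetric operator `Q` on `H`. -/
theorem IsRepresented.comp (hr : IsRepresented ι u₀ u u' f U) (hι : Function.Injective ι)
    {P : V →L[ℝ] V} {Q : H →L[ℝ] H} (hPQ : ∀ v, ι (P v) = Q (ι v))
    (hQ : ∀ v w, inner ℝ (Q v) w = inner ℝ v (Q w)) : ∃ F : ℝ → V,
      (∀ T > 0, MemLp F 2 (volume.restrict (Ioo 0 T))) ∧
      (∀ s v, inner ℝ (F s) v = u' s (P v)) ∧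
      (∀ t, 0 ≤ t → ContinuousLinearMap.adjoint ι (Q (U t))
        = ContinuousLinearMap.adjoint ι (Q u₀) + ∫ s in (0 : ℝ)..t, F s) ∧
      ∀ t, 0 ≤ t → IntervalIntegrable (fun s => u' s (P (P (u s)))) volume 0 t ∧
        ‖Q (U t)‖ ^ 2 = ‖Q u₀‖ ^ 2 + 2 * ∫ s in (0 : ℝ)..t, u' s (P (P (u s))) := by
  set P' := ContinuousLinearMap.adjoint P
  have F_inner : ∀ s v, inner ℝ (P' (f s)) v = u' s (P v) := fun s v => by
    rw [ContinuousLinearMap.adjoint_inner_left, hr.f_inner]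
  have F_mem : ∀ T > 0, MemLp (fun s => P' (f s)) 2 (volume.restrict (Ioo 0 T)) := fun T hT =>
    P'.comp_memLp' (hr.f_mem T hT)
  have u_mem : ∀ T > 0, MemLp (fun s => P (u s)) 2 (volume.restrict (Ioo 0 T)) := fun T hT =>
    P.comp_memLp' (hr.u_mem T hT)
  -- Taking adjoints in `ι P = Q ι` shows that `P u` solves an equation of the same kind with source
  -- `P† f`. Lions–Magenes applies to it, and its continuous representative must be `Q U` by
  -- uniqueness.
  have comm : ∀ w, ContinuousLinearMap.adjoint ι (Q w) = P' (ContinuousLinearMap.adjoint ι w) := by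
    intro w
    refine ext_inner_right ℝ fun v => ?_
    rw [ContinuousLinearMap.adjoint_inner_left, ContinuousLinearMap.adjoint_inner_left,
      ContinuousLinearMap.adjoint_inner_left, hQ, ← hPQ]
  have heq : ∀ᵐ t ∂(volume.restrict (Ioi (0 : ℝ))),
      ContinuousLinearMap.adjoint ι (ι (P (u t)))
        = ContinuousLinearMap.adjoint ι (Q u₀) + ∫ s in (0 : ℝ)..t, P' (f s) := by
    filter_upwards [hr.f_eq, ae_restrict_mem measurableSet_Ioi] with t h1 ht
    have h2 : IntervalIntegrable f volume 0 t :=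
      (intervalIntegrable_iff_integrableOn_Ioc_of_le (le_of_lt ht)).2
        (integrableOn_Ioc hr.f_mem (le_of_lt ht))
    rw [P'.intervalIntegral_comp_comm h2, comm, ← map_add, ← h1, ← comm, hPQ]
  have hcl : Q u₀ ∈ closure (range ι) := by
    refine closure_mono ?_ (image_closure_subset_closure_image Q.continuous
      (mem_image_of_mem _ hr.mem_closure))
    rintro _ ⟨_, ⟨v, rfl⟩, rfl⟩
    exact ⟨P v, hPQ v⟩
  obtain ⟨W, V1, V2, V3, V4, V5⟩ := exists_continuous_representative ι hι u_mem F_mem hcl heq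
  have hV : ∀ t, 0 ≤ t → W t = Q (U t) := by
    refine eqOn_Ici_of_ae_eq ?_ V1 (Q.continuous.comp_continuousOn hr.U_cont)
    filter_upwards [V3, hr.U_ae] with t h1 h2
    rw [h1, h2, hPQ]
  refine ⟨_, F_mem, F_inner, fun t ht => by rw [← hV t ht, V4 t ht], fun t ht => ⟨?_, ?_⟩⟩
  · rw [intervalIntegrable_iff_integrableOn_Ioc_of_le ht]
    have h1 := memLp_Ioc F_mem ht
    have h2 := memLp_Ioc u_mem ht
    have h3 : Integrable (fun s => ‖P' (f s)‖ * ‖P (u s)‖) (volume.restrict (Ioc 0 t)) :=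
      h1.norm.integrable_mul h2.norm
    refine (h3.mono' (f := fun s => (inner ℝ (P' (f s)) (P (u s)) : ℝ)) (h1.1.inner h2.1)
      (ae_of_all _ fun s => norm_inner_le_norm _ _)).congr (ae_of_all _ fun s => F_inner s _)
  · rw [← hV t ht, V5 t ht]
    simp only [F_inner]

end Abstract

/-! ### Consequences of the weak formulation -/

section Solution

variable {d : ℕ} {ℓ : ℝ} {μ : Cross d → ℝ} {u₀ : VecL2 d ℓ} {h₀ : SurfL2 d} {u : ℝ → Hel d ℓ}
  {h : ℝ → SurfL2 d} {u' : ℝ → (Hel d ℓ →L[ℝ] ℝ)} {h' m : ℝ → SurfL2 d}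

/-- The continuous representative of the surface. -/
def surfRep (h₀ : SurfL2 d) (h' : ℝ → SurfL2 d) (t : ℝ) : SurfL2 d := h₀ + ∫ s in (0 : ℝ)..t, h' s

variable (hs : IsWeakSolutionWith d ℓ μ u₀ h₀ u h u' h' m)
include hs

theorem IsWeakSolutionWith.h'_memLp (T : ℝ) (hT : T > 0) : MemLp h' 2 (volume.restrict (Ioo 0 T)) :=
  (hs.h'_mem T hT).1

theorem IsWeakSolutionWith.continuousOn_surfRep : ContinuousOn (surfRep h₀ h') (Ici 0) :=
  continuousOn_const.add (continuousOn_primitive hs.h'_memLp)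

theorem IsWeakSolutionWith.map_surfRep {E : Type*} [NormedAddCommGroup E] [NormedSpace ℝ E]
    [CompleteSpace E] (L : SurfL2 d →L[ℝ] E) {t : ℝ} (ht : 0 ≤ t) :
    L (surfRep h₀ h' t) = L h₀ + ∫ s in (0 : ℝ)..t, L (h' s) := by
  have h2 : IntervalIntegrable h' volume 0 t :=
    (intervalIntegrable_iff_integrableOn_Ioc_of_le ht).2 (integrableOn_Ioc hs.h'_memLp ht)
  rw [surfRep, map_add, L.intervalIntegral_comp_comm h2]

theorem IsWeakSolutionWith.norm_sq_map_surfRep {E : Type*} [NormedAddCommGroup E]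
    [InnerProductSpace ℝ E] [CompleteSpace E] (L : SurfL2 d →L[ℝ] E) {t : ℝ} (ht : 0 ≤ t) :
    IntervalIntegrable (fun s => (inner ℝ (L (h' s)) (L (surfRep h₀ h' s)) : ℝ)) volume 0 t ∧
    ‖L (surfRep h₀ h' t)‖ ^ 2 = ‖L h₀‖ ^ 2
      + 2 * ∫ s in (0 : ℝ)..t, inner ℝ (L (h' s)) (L (surfRep h₀ h' s)) := by
  have h1 : ∀ T > 0, MemLp (fun s => L (h' s)) 2 (volume.restrict (Ioo 0 T)) := fun T hT =>
    L.comp_memLp' (hs.h'_memLp T hT)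
  have hi := integrableOn_Ioc h1 ht
  refine ⟨intervalIntegrable_inner ht hi
    (L.continuous.comp_continuousOn (hs.continuousOn_surfRep.mono Icc_subset_Ici_self)), ?_⟩
  have h2 := inner_add_integral (L h₀) (L h₀) ht hi hi
  rw [← hs.map_surfRep L ht, real_inner_self_eq_norm_sq, real_inner_self_eq_norm_sq] at h2
  rw [h2, ← intervalIntegral.integral_const_mul]
  congr 1
  refine intervalIntegral.integral_congr fun s hs' => ?_
  rw [uIcc_of_le ht] at hs'
  rw [← hs.map_surfRep L hs'.1, real_inner_comm (L (h' s))]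
  ring

theorem IsWeakSolutionWith.ae_surfRep :
    ∀ᵐ t ∂(volume.restrict (Ioi (0 : ℝ))), surfRep h₀ h' t = h t := by
  filter_upwards [hs.h_deriv] with t ht using ht.symm

theorem IsWeakSolutionWith.ae_momentum {v : ℝ → Hel d ℓ} {τ : ℝ → SurfL2 d}
    (hv : ∀ T > 0, MemLp v 2 (volume.restrict (Ioo 0 T)))
    (hτ : ∀ᵐ t ∂(volume.restrict (Ioi (0 : ℝ))), Hel.IsNormalTrace (v t) (τ t)) :
    ∀ᵐ t ∂(volume.restrict (Ioi (0 : ℝ))),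
      u' t (v t) = -(symGradInner (u t) (v t) / 2) - inner ℝ (m t) (τ t) := by
  have h1 := ae_Ioi_of_forall_Ioo fun T hT => hs.momentum T hT v (hv T hT)
  filter_upwards [h1, hτ] with t h2 h3
  have h4 := h2 _ h3
  have h5 : (inner ℝ (m t) (τ t) : ℝ) = ∫ x, m t x * τ t x := by
    rw [L2.inner_def]
    simp [mul_comm]
  rw [h5]
  linarith

end Solution

/-! ### Absolutely continuous functionals and their decay -/

section Gronwall

theorem inner_primitive {V : Type*} [NormedAddCommGroup V] [InnerProductSpace ℝ V] [CompleteSpace V]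
    {a b F G : ℝ → V} {a₀ b₀ : V} (hF : ∀ T > 0, MemLp F 2 (volume.restrict (Ioo 0 T)))
    (hG : ∀ T > 0, MemLp G 2 (volume.restrict (Ioo 0 T)))
    (ha : ∀ t, 0 ≤ t → a t = a₀ + ∫ s in (0 : ℝ)..t, F s)
    (hb : ∀ t, 0 ≤ t → b t = b₀ + ∫ s in (0 : ℝ)..t, G s) {t : ℝ} (ht : 0 ≤ t) :
    IntervalIntegrable (fun s => (inner ℝ (F s) (b s) + inner ℝ (a s) (G s) : ℝ)) volume 0 t ∧
    inner ℝ (a t) (b t) = inner ℝ a₀ b₀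
      + ∫ s in (0 : ℝ)..t, (inner ℝ (F s) (b s) + inner ℝ (a s) (G s)) := by
  have cont : ∀ {a F : ℝ → V} {a₀ : V}, (∀ T > 0, MemLp F 2 (volume.restrict (Ioo 0 T))) →
      (∀ t, 0 ≤ t → a t = a₀ + ∫ s in (0 : ℝ)..t, F s) → ContinuousOn a (Icc 0 t) :=
    fun hF ha => ((continuousOn_const.add (continuousOn_primitive hF)).congr
      fun s hs => ha s hs).mono Icc_subset_Ici_self
  have k1 := intervalIntegrable_inner ht (integrableOn_Ioc hF ht) (cont hG hb)
  have k2 := intervalIntegrable_inner ht (integrableOn_Ioc hG ht) (cont hF ha)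
  simp only [real_inner_comm] at k2
  refine ⟨k1.add k2, ?_⟩
  rw [ha t ht, hb t ht, inner_add_integral a₀ b₀ ht (integrableOn_Ioc hF ht) (integrableOn_Ioc hG ht)]
  congr 1
  refine intervalIntegral.integral_congr fun s hs => ?_
  rw [uIcc_of_le ht] at hs
  rw [ha s hs.1, hb s hs.1]

theorem decay_of_dissipation {L l : ℝ → ℝ} {c : ℝ} (hc : 0 ≤ c) (hcont : ContinuousOn L (Ici 0))
    (hpos : ∀ t, 0 ≤ t → 0 ≤ L t)
    (hl : ∀ t, 0 ≤ t → IntervalIntegrable l volume 0 t ∧ L t = L 0 + ∫ s in (0 : ℝ)..t, l s)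
    (hle : ∀ᵐ s ∂(volume.restrict (Ioi (0 : ℝ))), l s ≤ -(c * L s)) {t : ℝ} (ht : 0 ≤ t) {n : ℕ}
    (hn : 0 < n) : L t ≤ L 0 / (1 + c * t / n) ^ n := by
  refine le_div_pow_of_le_sub_integral hc hcont hpos (fun s t hs hst => ?_) ht hn
  have ht := hs.trans hst
  obtain ⟨i1, e1⟩ := hl s hs
  obtain ⟨i2, e2⟩ := hl t ht
  have i3 : IntervalIntegrable l volume s t := i1.symm.trans i2
  have e3 : L t = L s + ∫ τ in s..t, l τ := by
    rw [e1, e2, add_assoc, intervalIntegral.integral_add_adjacent_intervals i1 i3]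
  have i4 : IntervalIntegrable L volume s t := by
    refine (hcont.mono ?_).intervalIntegrable
    rw [uIcc_of_le hst]
    exact fun x hx => hs.trans hx.1
  have h1 : ∫ τ in s..t, l τ ≤ ∫ τ in s..t, -(c * L τ) := by
    refine intervalIntegral.integral_mono_ae_restrict hst i3 (i4.const_mul c).neg ?_
    refine ae_restrict_of_ae_restrict_of_subset (s := Icc s t) (t := Ici 0)
      (fun x hx => hs.trans hx.1) ?_
    rw [← restrict_Ioi_eq_restrict_Ici]
    exact hle
  rw [intervalIntegral.integral_neg, intervalIntegral.integral_const_mul] at h1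
  linarith

end Gronwall

/-! ### Decay in a single frequency band -/

section Band

variable {d : ℕ} {ℓ : ℝ}

theorem abs_symGradInner_le (v w : Hel d ℓ) {M : ℝ} (hM : ∀ i j, ‖Hel.D i j w‖ ≤ M) :
    |symGradInner v w| ≤ (d + 1) ^ 2 * (√(symGradInner v v) * M) := by
  rw [symGradInner_eq v w]
  have h1 : ∀ i j, |(inner ℝ (Hel.D i j v) (Hel.D i j w) : ℝ)| ≤ √(symGradInner v v) * M :=
    fun i j => (abs_real_inner_le_norm _ _).trans
      (mul_le_mul (norm_D_le v i j) (hM i j) (norm_nonneg _) (Real.sqrt_nonneg _))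
  refine (Finset.abs_sum_le_sum_abs _ _).trans ((Finset.sum_le_sum fun i _ =>
    (Finset.abs_sum_le_sum_abs _ _).trans (Finset.sum_le_sum fun j _ => h1 i j)).trans_eq ?_)
  simp only [Finset.sum_const, Finset.card_univ, Fintype.card_fin, nsmul_eq_mul]
  push_cast
  ring

theorem abs_inner_field_le (V : VecL2 d ℓ) (w : Hel d ℓ) {M : ℝ} (hM : ∀ j, ‖Hel.u j w‖ ≤ M) :
    |inner ℝ V (Hel.field w)| ≤ (d + 1) * (‖V‖ * M) := by
  rw [inner_eq_sum_comp]
  have h0 : ∀ j, ‖comp j V‖ ≤ ‖V‖ := fun j => by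
    refine abs_le_of_sq_le_sq' ?_ (norm_nonneg _) |>.2
    rw [norm_sq_eq_sum_comp V]
    exact Finset.single_le_sum (f := fun j => ‖comp j V‖ ^ 2) (fun j _ => sq_nonneg _)
      (Finset.mem_univ j)
  have h1 : ∀ j, |(inner ℝ (comp j V) (comp j (Hel.field w)) : ℝ)| ≤ ‖V‖ * M :=
    fun j => (abs_real_inner_le_norm _ _).trans
      (mul_le_mul (h0 j) (by rw [Hel.comp_field]; exact hM j) (norm_nonneg _) (norm_nonneg _))
  refine (Finset.abs_sum_le_sum_abs _ _).trans ((Finset.sum_le_sum fun j _ => h1 j).trans_eq ?_)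
  simp only [Finset.sum_const, Finset.card_univ, Fintype.card_fin, nsmul_eq_mul]
  push_cast
  ring

/-- The decay rate at frequencies comparable with `R`. -/
def rate (r R : ℝ) : ℝ := min 1 ((max 1 R) ^ (2 * r - 1)) * (R / max 1 R) ^ 2

/-- The balance behind the rate: gradients of the test field grow like `√A`, while the surface
energy controls only `A^r` times the surface norm. Hence `a = A^(1/2 - r)` and `a² A^(2r-1) = 1`. -/
theorem rpow_scaling {A r : ℝ} (hA : 1 ≤ A) :
    √A * (A ^ r)⁻¹ * (√A * (A ^ r)⁻¹) * A ^ (2 * r - 1) = 1 := by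
  have hA0 : 0 < A := by linarith
  rw [← Real.rpow_neg hA0.le, Real.sqrt_eq_rpow, ← Real.rpow_add hA0, ← Real.rpow_add hA0,
    ← Real.rpow_add hA0, show 1 / 2 + -r + (1 / 2 + -r) + (2 * r - 1) = 0 by ring, Real.rpow_zero]

variable {R : ℝ} {k : SchwartzMap (Cross d) ℝ} {φ : Cross d → ℝ}

set_option maxHeartbeats 4000000 in
/-- Decay of the energy in a frequency band. -/
theorem exists_band_decay (d : ℕ) {ℓ g σ r : ℝ} (hℓ : 0 < ℓ) (hg : 0 < g) (hσ : 0 < σ) (hr : 0 ≤ r) :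
    ∃ c : ℝ, 0 < c ∧ ∀ (R : ℝ) (k : SchwartzMap (Cross d) ℝ) (φ : Cross d → ℝ)
      (hk : IsBandKernel R k φ) (u₀ : VecL2 d ℓ) (h₀ : SurfL2 d) (u : ℝ → Hel d ℓ)
      (h : ℝ → SurfL2 d) (u' : ℝ → (Hel d ℓ →L[ℝ] ℝ)) (h' m : ℝ → SurfL2 d) (f : ℝ → Hel d ℓ)
      (U : ℝ → VecL2 d ℓ), IsWeakSolutionWith d ℓ (symbol g σ r) u₀ h₀ u h u' h' m →
      IsRepresented (Hel.fieldL d ℓ) u₀ u u' f U → ∀ t : ℝ, 0 ≤ t → ∀ n : ℕ, 0 < n →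
      ‖vecAvg d ℓ k (U t)‖ ^ 2 + ‖hk.J g hσ hr (surfRep h₀ h' t)‖ ^ 2
        ≤ 4 * (‖vecAvg d ℓ k u₀‖ ^ 2 + ‖hk.J g hσ hr h₀‖ ^ 2) / (1 + c * rate r R * t / n) ^ n := by
  obtain ⟨C1, hC1, hW⟩ := exists_testField d hℓ
  obtain ⟨C2, hC2, hK⟩ := exists_korn d hℓ
  set cJ := (√(min g σ))⁻¹ with hcJ
  have hcJ0 : 0 < cJ := by
    have : 0 < min g σ := lt_min hg hσ
    positivity
  set N : ℝ := d + 1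
  have hN : 0 < N := by positivity
  -- One constant for everything: the summands after `1` serve, in order, the viscous term, the term
  -- with `∂_t h`, the bound on the cross term `X` and the Korn–Poincaré inequality.
  set C := 1 + N ^ 2 * C1 * cJ + N * C1 * √ℓ + N * C1 * cJ + C2 with hC
  have hC1' : 1 ≤ C := by
    have : 0 ≤ N ^ 2 * C1 * cJ + N * C1 * √ℓ + N * C1 * cJ + C2 := by positivity
    linarith
  refine ⟨1 / (32 * C ^ 3), by positivity, fun R k φ hk u₀ h₀ u h u' h' m f U hs hrep t ht n hn => ?_⟩
  obtain ⟨W, Wtr, Wb⟩ := hW R k hk.pos hk.bandLimited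
  obtain ⟨F, F_mem, F_inner, F_eq, F_en⟩ := hrep.comp Hel.injective_fieldL
    (P := Hel.avg k) (Q := vecAvg d ℓ k) (fun v => Hel.field_avg k v) (inner_vecAvg_comm hk.even)
  set J := hk.J g hσ hr
  set H := surfRep h₀ h'
  set R' := max 1 R with hR'
  have hR'1 : 1 ≤ R' := le_max_left _ _
  have hRR' : R ≤ R' := le_max_right _ _
  have hR'0 : 0 < R' := by linarith
  have hR0 := hk.pos
  set q := R / R'
  have hq0 : 0 ≤ q := by positivity
  have hq1 : q ≤ 1 := (div_le_one hR'0).2 hRR'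
  set s := min 1 (R' ^ (2 * r - 1)) with hsdef
  have hs0 : 0 ≤ s := le_min zero_le_one (by positivity)
  have hs1 : s ≤ 1 := min_le_left _ _
  set a := √R' * (R' ^ r)⁻¹ with ha
  have hsa : s * a ^ 2 ≤ 1 := by
    rw [← rpow_scaling (r := r) hR'1, sq, mul_comm]
    gcongr
    exact min_le_right _ _
  have hrpow : 1 ≤ R' ^ r := Real.one_le_rpow hR'1 hr
  have hsq : 1 ≤ √R' := Real.one_le_sqrt.2 hR'1
  set ε := s / (8 * C ^ 2)
  have W_mem : ∀ T > 0, MemLp (fun s => W (h' s)) 2 (volume.restrict (Ioo 0 T)) := fun T hT =>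
    W.comp_memLp' (hs.h'_memLp T hT)
  have hX := fun {t : ℝ} (ht : 0 ≤ t) => inner_primitive F_mem W_mem F_eq
    (fun t ht => hs.map_surfRep W ht) ht
  simp only [ContinuousLinearMap.adjoint_inner_left] at hX
  set X : ℝ → ℝ := fun t => inner ℝ (vecAvg d ℓ k (U t)) (Hel.fieldL d ℓ (W (H t)))
  set E : ℝ → ℝ := fun t => (‖vecAvg d ℓ k (U t)‖ ^ 2 + ‖J (H t)‖ ^ 2) / 2
  set e' : ℝ → ℝ := fun s => u' s (Hel.avg k (Hel.avg k (u s))) + inner ℝ (J (h' s)) (J (H s))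
  set x' : ℝ → ℝ := fun s => inner ℝ (F s) (W (H s))
    + inner ℝ (vecAvg d ℓ k (U s)) (Hel.fieldL d ℓ (W (h' s)))
  have H0 : H 0 = h₀ := by simp [H, surfRep]
  have hXbound : ∀ t, |X t| ≤ C * (‖vecAvg d ℓ k (U t)‖ * q * ‖J (H t)‖) := by
    intro t
    have h1 := abs_inner_field_le (vecAvg d ℓ k (U t)) (W (H t)) (fun j => (Wb (H t) j j).1)
    have h2 := hk.norm_avg_le_J hσ hr hg (H t)
    refine h1.trans ?_
    have h3 : ‖(surfShift d).avg k (H t)‖ ≤ cJ * ‖J (H t)‖ := by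
      refine h2.trans ?_
      rw [mul_assoc]
      gcongr
      exact mul_le_of_le_one_left (norm_nonneg _) (inv_le_one_of_one_le₀ hrpow)
    calc N * (‖vecAvg d ℓ k (U t)‖ * (C1 * (q / √R' * ‖(surfShift d).avg k (H t)‖)))
        ≤ N * (‖vecAvg d ℓ k (U t)‖ * (C1 * (q * (cJ * ‖J (H t)‖)))) := by
          gcongr
          exact div_le_self hq0 hsq
      _ = (N * C1 * cJ) * (‖vecAvg d ℓ k (U t)‖ * q * ‖J (H t)‖) := by ring
      _ ≤ _ := by
          gcongr
          have : 0 ≤ N ^ 2 * C1 * cJ + N * C1 * √ℓ + C2 := by positivity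
          linarith
  have main : ∀ᵐ s ∂(volume.restrict (Ioi (0 : ℝ))), ∃ δ : ℝ, 0 ≤ δ ∧ e' s = -(δ ^ 2 / 2) ∧
      x' s ≤ C * (δ * q * a * ‖J (H s)‖) + C * (‖vecAvg d ℓ k (U s)‖ * δ * q)
        - q ^ 2 * ‖J (H s)‖ ^ 2 ∧ ‖vecAvg d ℓ k (U s)‖ ^ 2 ≤ C * δ ^ 2 := by
    -- Testing with `k * k * u` gives the energy identity for `k * u`: evenness of `k` splits the
    -- two averages between the factors, and the boundary term cancels the derivative of the surface
    -- energy.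
    have g1 := hs.ae_momentum (v := fun s => Hel.avg k (Hel.avg k (u s)))
      (fun T hT => (Hel.avg k).comp_memLp' ((Hel.avg k).comp_memLp' (hs.u_mem T hT)))
      (hs.kinematic.mono fun s hs => (hs.avg k).avg k)
    -- Testing with `k * W h` gives the part of the derivative of `X` that contains the damping of
    -- `h`; the part where `∂_t` hits `h` is bounded through the normal trace of `k * u`.
    have g2 := hs.ae_momentum (v := fun s => Hel.avg k (W (h s)))
      (fun T hT => (Hel.avg k).comp_memLp' (W.comp_memLp' (hs.h_mem T hT)))
      (ae_of_all _ fun s => (Wtr (h s)).avg k)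
    filter_upwards [g1, g2, hs.ae_surfRep, hrep.U_ae, hs.m_eq, hs.kinematic]
      with s m1 m2 hH hU hm hkin
    have hH' : H s = h s := hH
    have hUs : vecAvg d ℓ k (U s) = Hel.field (Hel.avg k (u s)) := by
      rw [hU, Hel.field_avg, Hel.fieldL_apply]
    set v := Hel.avg k (u s) with hv
    set S := symGradInner v v with hS
    have hS0 : 0 ≤ S := symGradInner_self_nonneg v
    have hSsq : √S ^ 2 = S := Real.sq_sqrt hS0
    refine ⟨√S, Real.sqrt_nonneg _, ?_, ?_, ?_⟩
    · simp only [e']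
      rw [m1, ← symGradInner_avg_comm hk.even, hk.inner_multiplier hσ hr hg hm, hH',
        real_inner_comm, hSsq]
      ring
    · simp only [x']
      rw [F_inner, hH', m2, hUs, ← symGradInner_avg_comm hk.even, map_smul, real_inner_smul_right]
      have b1 := (abs_le.1 (abs_symGradInner_le v (W (h s)) (M := 2 * (C1 * (q * √R' *
        ‖(surfShift d).avg k (h s)‖))) fun i j => by
          rw [Hel.D, add_apply]
          refine (norm_add_le _ _).trans ?_
          linarith [(Wb (h s) i j).2, (Wb (h s) j i).2])).1
      have b2 := (abs_le.1 (abs_inner_field_le (Hel.field v) (W (h' s))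
        (fun j => (Wb (h' s) j j).1))).2
      have b3 := hk.norm_avg_le_J hσ hr hg (h s)
      have b4 := norm_normalTrace_le hℓ (hkin.avg k)
      have b5 := hk.le_inner_multiplier hσ hr hg hm
      rw [← hv, ← hS] at b4
      have c1 : N ^ 2 * (√S * (2 * (C1 * (q * √R' * ‖(surfShift d).avg k (h s)‖))))
          ≤ 2 * (C * (√S * q * a * ‖J (h s)‖)) := by
        calc _ ≤ N ^ 2 * (√S * (2 * (C1 * (q * √R' * (cJ * (R' ^ r)⁻¹ * ‖J (h s)‖))))) := by gcongr
          _ = 2 * ((N ^ 2 * C1 * cJ) * (√S * q * a * ‖J (h s)‖)) := by rw [ha]; ring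
          _ ≤ _ := by
            gcongr
            have : 0 ≤ N * C1 * √ℓ + N * C1 * cJ + C2 := by positivity
            linarith
      have c2 : N * (‖Hel.field v‖ * (C1 * (q / √R' * ‖(surfShift d).avg k (h' s)‖)))
          ≤ C * (‖Hel.field v‖ * √S * q) := by
        calc _ ≤ N * (‖Hel.field v‖ * (C1 * (q * (√ℓ * √S)))) := by
              gcongr
              exact div_le_self hq0 hsq
          _ = (N * C1 * √ℓ) * (‖Hel.field v‖ * √S * q) := by ring
          _ ≤ _ := by
            gcongr
            have : 0 ≤ N ^ 2 * C1 * cJ + N * C1 * cJ + C2 := by positivity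
            linarith
      have c3 : q ^ 2 * ‖J (h s)‖ ^ 2 ≤ (R' ^ 2)⁻¹ *
          inner ℝ (m s) ((surfShift d).avg k ((surfShift d).avg (-lap k) (h s))) := by
        calc _ = (R' ^ 2)⁻¹ * (R ^ 2 * ‖J (h s)‖ ^ 2) := by simp only [q]; field_simp
          _ ≤ _ := by gcongr
      rw [Hel.fieldL_apply]
      linarith
    · rw [hUs, hSsq]
      refine (hK R k hk.pos hk.bandLimited (fun ξ hξ => hk.le_norm ?_) (u s)).trans ?_
      · rw [hk.khat_eq] at hξ
        simpa using hξ
      · gcongr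
        have : 0 ≤ 1 + N ^ 2 * C1 * cJ + N * C1 * √ℓ + N * C1 * cJ := by positivity
        linarith
  set L : ℝ → ℝ := fun t => E t + ε * X t
  have hLpos : ∀ t, (‖vecAvg d ℓ k (U t)‖ ^ 2 + ‖J (H t)‖ ^ 2) / 4 ≤ L t ∧
      L t ≤ ‖vecAvg d ℓ k (U t)‖ ^ 2 + ‖J (H t)‖ ^ 2 := by
    intro t
    -- Only the comparison of `L` with the energy is wanted here, at every time, so `x'` and `δ` are
    -- dummy values that satisfy the hypotheses.
    have := lyapunov_pointwise (x' := -(q ^ 2 * ‖J (H t)‖ ^ 2)) (δ := ‖vecAvg d ℓ k (U t)‖) hC1'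
      (norm_nonneg _) (norm_nonneg _) (norm_nonneg _) hq0 hq1 hs0 hs1 hsa (by
        have : 0 ≤ C * (‖vecAvg d ℓ k (U t)‖ * q * a * ‖J (H t)‖)
          + C * (‖vecAvg d ℓ k (U t)‖ * ‖vecAvg d ℓ k (U t)‖ * q) := by positivity
        linarith) (hXbound t) (by nlinarith [sq_nonneg ‖vecAvg d ℓ k (U t)‖])
    exact this.2
  have hLdiss : ∀ᵐ s ∂(volume.restrict (Ioi (0 : ℝ))),
      e' s + ε * x' s ≤ -(1 / (32 * C ^ 3) * rate r R * L s) := by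
    filter_upwards [main] with s hmain
    obtain ⟨δ, d0, d1, d2, d3⟩ := hmain
    rw [d1]
    exact (lyapunov_pointwise hC1' (norm_nonneg _) (norm_nonneg _) d0 hq0 hq1 hs0 hs1 hsa d2
      (hXbound s) d3).1
  have hH_cont : ContinuousOn H (Ici 0) := hs.continuousOn_surfRep
  have hL_cont : ContinuousOn L (Ici 0) := by
    have q1 : ContinuousOn (fun t => vecAvg d ℓ k (U t)) (Ici 0) :=
      (vecAvg d ℓ k).continuous.comp_continuousOn hrep.U_cont
    have q2 : ContinuousOn (fun t => J (H t)) (Ici 0) := J.continuous.comp_continuousOn hH_cont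
    have q3 : ContinuousOn (fun t => Hel.fieldL d ℓ (W (H t))) (Ici 0) :=
      ((Hel.fieldL d ℓ).comp W).continuous.comp_continuousOn hH_cont
    exact (((q1.norm.pow 2).add (q2.norm.pow 2)).div_const 2).add
      (continuousOn_const.mul (q1.inner q3))
  have hL_int : ∀ t, 0 ≤ t → IntervalIntegrable (fun s => e' s + ε * x' s) volume 0 t ∧
      L t = L 0 + ∫ s in (0 : ℝ)..t, (e' s + ε * x' s) := by
    intro t ht
    obtain ⟨i1, n1⟩ := F_en t ht
    obtain ⟨i2, n2⟩ := hs.norm_sq_map_surfRep J ht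
    obtain ⟨i3, n3⟩ := hX ht
    refine ⟨(i1.add i2).add (i3.const_mul ε), ?_⟩
    rw [intervalIntegral.integral_add (i1.add i2) (i3.const_mul ε), intervalIntegral.integral_add i1 i2,
      intervalIntegral.integral_const_mul]
    simp only [L, E, X, H0, hrep.U_zero]
    have n2' : ‖J (H t)‖ ^ 2 = ‖J h₀‖ ^ 2 + 2 * ∫ s in (0 : ℝ)..t, inner ℝ (J (h' s)) (J (H s)) := n2
    rw [n1, n2', n3]
    ring
  have hrate : 0 ≤ rate r R := mul_nonneg hs0 (sq_nonneg _)
  have hfin := decay_of_dissipation (c := 1 / (32 * C ^ 3) * rate r R) (by positivity) hL_cont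
    (fun t _ => le_trans (by positivity) (hLpos t).1) hL_int hLdiss ht hn
  have h1 := (hLpos t).1
  have h2 := (hLpos 0).2
  rw [H0, hrep.U_zero] at h2
  have h3 : 0 < (1 + 1 / (32 * C ^ 3) * rate r R * t / n) ^ n := by positivity
  -- The factor `4` arises from `L t ≥ (‖v‖² + ‖J h‖²) / 4` at the final time against `L 0 ≤ ‖v‖² +
  -- ‖J h‖²` initially.
  rw [le_div_iff₀ h3] at hfin ⊢
  have := mul_le_mul_of_nonneg_right h1 h3.le
  linarith

end Band

/-! ### Frequency weighted norms and sums over bands -/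

section Spectral

variable {d : ℕ} {ℓ : ℝ}

theorem lintegral_enorm_sq {X E : Type*} [MeasurableSpace X] {μ : Measure X} [NormedAddCommGroup E]
    (w : Lp E 2 μ) : ∫⁻ z, ‖w z‖ₑ ^ 2 ∂μ = ‖w‖ₑ ^ 2 := by
  rw [Lp.enorm_def, eLpNorm_eq_lintegral_rpow_enorm_toReal (by norm_num) (by norm_num)]
  simp only [ENNReal.toReal_ofNat, one_div]
  rw [← ENNReal.rpow_natCast, ← ENNReal.rpow_mul]
  simp

theorem enorm_sq_eq_ofReal {E : Type*} [NormedAddCommGroup E] (x : E) :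
    ‖x‖ₑ ^ 2 = ENNReal.ofReal (‖x‖ ^ 2) := by
  rw [ENNReal.ofReal_pow (norm_nonneg _), ofReal_norm]

/-- The `L²(Ω)` norm of a vector field, squared, weighted in horizontal frequency. -/
def specSq (W : Cross d → ℝ≥0∞) (V : VecL2 d ℓ) : ℝ≥0∞ :=
  ∑ j, ∫⁻ y in Ioo 0 ℓ, ∫⁻ ξ, W ξ * ‖hat (fun x => V (x, y) j) ξ‖ₑ ^ 2

theorem specSq_eq_comp (W : Cross d → ℝ≥0∞) (V : VecL2 d ℓ) :
    specSq W V = ∑ j, ∫⁻ y in Ioo 0 ℓ, ∫⁻ ξ, W ξ * ‖hat (fun x => comp j V (x, y)) ξ‖ₑ ^ 2 := by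
  refine Finset.sum_congr rfl fun j _ => lintegral_congr_ae ?_
  filter_upwards [ae_slice (coeFn_comp j V)] with y hy
  rw [hat_congr hy]

theorem enorm_sq_eq_sum_comp (V : VecL2 d ℓ) : ‖V‖ₑ ^ 2 = ∑ j, ‖comp j V‖ₑ ^ 2 := by
  simp only [enorm_sq_eq_ofReal]
  rw [norm_sq_eq_sum_comp, ENNReal.ofReal_sum_of_nonneg fun _ _ => by positivity]

theorem specSq_one (V : VecL2 d ℓ) : specSq (fun _ => 1) V = ‖V‖ₑ ^ 2 := by
  rw [specSq_eq_comp, enorm_sq_eq_sum_comp]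
  simp only [one_mul, enorm_sq_eq_slices]

theorem enorm_sq_vecAvg (k : SchwartzMap (Cross d) ℝ) (V : VecL2 d ℓ) :
    ‖vecAvg d ℓ k V‖ₑ ^ 2 = specSq (fun ξ => ‖khat k ξ‖ₑ ^ 2) V := by
  rw [specSq_eq_comp, enorm_sq_eq_sum_comp]
  simp only [comp_vecAvg, enorm_sq_avg]

theorem aemeasurable_slice_avg (k : SchwartzMap (Cross d) ℝ) (w : ScalL2 d ℓ) :
    AEMeasurable (fun y => ∫⁻ ξ, ‖khat k ξ‖ₑ ^ 2 * ‖hat (fun x => w (x, y)) ξ‖ₑ ^ 2)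
      (volume.restrict (Ioo 0 ℓ)) := by
  refine (aemeasurable_slice_norm ((slabShift d ℓ).avg k w)).congr ?_
  filter_upwards [hat_slice_avg k w] with y hy
  refine lintegral_congr_ae ?_
  filter_upwards [hy] with ξ h
  rw [h, enorm_mul, mul_pow]

/-- Tonelli: all terms are nonnegative, so the sum over bands moves inside and becomes a single
frequency weight. -/
theorem tsum_mul_enorm_sq_vecAvg {ι : Type*} [Countable ι] (k : ι → SchwartzMap (Cross d) ℝ)
    (a : ι → ℝ≥0∞) (V : VecL2 d ℓ) :
    ∑' i, a i * ‖vecAvg d ℓ (k i) V‖ₑ ^ 2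
      = specSq (fun ξ => ∑' i, a i * ‖khat (k i) ξ‖ₑ ^ 2) V := by
  simp only [enorm_sq_vecAvg, specSq_eq_comp, Finset.mul_sum]
  rw [Summable.tsum_finsetSum fun _ _ => ENNReal.summable]
  refine Finset.sum_congr rfl fun j _ => ?_
  have m1 : ∀ i y, AEMeasurable fun ξ : Cross d => ‖khat (k i) ξ‖ₑ ^ 2
      * ‖hat (fun x => comp j V (x, y)) ξ‖ₑ ^ 2 := fun i y =>
    ((khat (k i)).continuous.enorm.measurable.pow_const 2).aemeasurable.mul
      ((aemeasurable_hat _).enorm.pow_const 2)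
  have m2 := fun i => aemeasurable_slice_avg (k i) (comp j V)
  calc _ = ∑' i, ∫⁻ y in Ioo 0 ℓ, a i * ∫⁻ ξ, ‖khat (k i) ξ‖ₑ ^ 2
          * ‖hat (fun x => comp j V (x, y)) ξ‖ₑ ^ 2 :=
        tsum_congr fun i => (lintegral_const_mul'' _ (m2 i)).symm
    _ = ∫⁻ y in Ioo 0 ℓ, ∑' i, a i * ∫⁻ ξ, ‖khat (k i) ξ‖ₑ ^ 2
          * ‖hat (fun x => comp j V (x, y)) ξ‖ₑ ^ 2 :=
        (lintegral_tsum fun i => (m2 i).const_mul _).symm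
    _ = _ := by
        refine lintegral_congr fun y => ?_
        calc _ = ∑' i, ∫⁻ ξ, a i * (‖khat (k i) ξ‖ₑ ^ 2
                * ‖hat (fun x => comp j V (x, y)) ξ‖ₑ ^ 2) :=
              tsum_congr fun i => (lintegral_const_mul'' _ (m1 i y)).symm
          _ = ∫⁻ ξ, ∑' i, a i * (‖khat (k i) ξ‖ₑ ^ 2
                * ‖hat (fun x => comp j V (x, y)) ξ‖ₑ ^ 2) :=
              (lintegral_tsum fun i => (m1 i y).const_mul _).symm
          _ = _ := by simp only [← mul_assoc, ENNReal.tsum_mul_right]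

theorem specSq_le {W W' : Cross d → ℝ≥0∞} {C : ℝ≥0∞} (hC : C ≠ ⊤) (h : ∀ᵐ ξ, W ξ ≤ C * W' ξ)
    (V : VecL2 d ℓ) : specSq W V ≤ C * specSq W' V := by
  unfold specSq
  rw [Finset.mul_sum]
  refine Finset.sum_le_sum fun j _ => ?_
  rw [← lintegral_const_mul' _ _ hC]
  refine lintegral_mono fun y => ?_
  rw [← lintegral_const_mul' _ _ hC]
  refine lintegral_mono_ae (h.mono fun ξ hξ => ?_)
  rw [← mul_assoc]
  gcongr

variable {R : ℝ} {k : SchwartzMap (Cross d) ℝ} {φ : Cross d → ℝ}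

theorem IsBandKernel.enorm_sq_J (hk : IsBandKernel R k φ) {g σ r : ℝ} (hg : 0 < g) (hσ : 0 < σ)
    (hr : 0 ≤ r) (f : SurfL2 d) : ‖hk.J g hσ hr f‖ₑ ^ 2
      = ∫⁻ ξ, ‖khat k ξ‖ₑ ^ 2 * (ENNReal.ofReal (symbol g σ r ξ) * ‖hat f ξ‖ₑ ^ 2) := by
  rw [← lintegral_enorm_sq]
  refine lintegral_congr_ae ?_
  filter_upwards [hk.coeFn_J (g := g) hσ hr f] with ξ hξ
  rw [hξ, hat_coe, hk.khat_eq, enorm_mul, Complex.ofReal_mul, enorm_mul, mul_pow, mul_pow,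
    enorm_sq_eq_ofReal ((√(symbol g σ r ξ) : ℝ) : ℂ), Complex.norm_real, Real.norm_eq_abs, sq_abs,
    Real.sq_sqrt (symbol_nonneg hg hσ r ξ)]
  ring

theorem tsum_mul_enorm_sq_J {ι : Type*} [Countable ι] {R : ι → ℝ} {k : ι → SchwartzMap (Cross d) ℝ}
    {φ : ι → Cross d → ℝ} (hk : ∀ i, IsBandKernel (R i) (k i) (φ i)) {g σ r : ℝ} (hg : 0 < g)
    (hσ : 0 < σ) (hr : 0 ≤ r) (a : ι → ℝ≥0∞) (f : SurfL2 d) :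
    ∑' i, a i * ‖(hk i).J g hσ hr f‖ₑ ^ 2 = ∫⁻ ξ, (∑' i, a i * ‖khat (k i) ξ‖ₑ ^ 2)
      * (ENNReal.ofReal (symbol g σ r ξ) * ‖hat f ξ‖ₑ ^ 2) := by
  have m1 : ∀ i, AEMeasurable fun ξ : Cross d => ‖khat (k i) ξ‖ₑ ^ 2
      * (ENNReal.ofReal (symbol g σ r ξ) * ‖hat f ξ‖ₑ ^ 2) := fun i =>
    ((khat (k i)).continuous.enorm.measurable.pow_const 2).aemeasurable.mul
      ((continuous_symbol g σ hr).measurable.ennreal_ofReal.aemeasurable.mul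
        ((aemeasurable_hat _).enorm.pow_const 2))
  calc _ = ∑' i, ∫⁻ ξ, a i * (‖khat (k i) ξ‖ₑ ^ 2
          * (ENNReal.ofReal (symbol g σ r ξ) * ‖hat f ξ‖ₑ ^ 2)) :=
        tsum_congr fun i => by rw [(hk i).enorm_sq_J hg, lintegral_const_mul'' _ (m1 i)]
    _ = ∫⁻ ξ, ∑' i, a i * (‖khat (k i) ξ‖ₑ ^ 2
          * (ENNReal.ofReal (symbol g σ r ξ) * ‖hat f ξ‖ₑ ^ 2)) :=
        (lintegral_tsum fun i => (m1 i).const_mul _).symm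
    _ = _ := by simp only [← mul_assoc, ENNReal.tsum_mul_right]

end Spectral

/-! ### Overlap of dyadic bands and weights -/

section Dyadic

variable {d : ℕ}

theorem tsum_le_of_support_near {f : ℤ → ℝ≥0∞} {B : ℝ≥0∞} (hB : ∀ i, f i ≤ B)
    (h : ∀ i j, f i ≠ 0 → f j ≠ 0 → |i - j| ≤ 1) : ∑' i, f i ≤ 3 * B := by
  by_cases h0 : ∃ i, f i ≠ 0
  · obtain ⟨i, hi⟩ := h0
    rw [tsum_eq_sum (s := Finset.Icc (i - 1) (i + 1)) fun j hj => ?_]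
    · refine (Finset.sum_le_card_nsmul _ _ B fun j _ => hB j).trans_eq ?_
      rw [Int.card_Icc, show i + 1 + 1 - (i - 1) = 3 by ring, nsmul_eq_mul]
      rfl
    · by_contra h1
      refine hj (Finset.mem_Icc.2 ?_)
      have := abs_le.1 (h i j hi h1)
      constructor <;> linarith [this.1, this.2]
  · push Not at h0
    simp [h0]

/-- If `i ≥ j + 2`, the first bound would give `x ≥ 8 · 4^j`, contradicting `x ≤ (9/2) · 4^j`. -/
theorem near_of_dyadic {x : ℝ} {i j : ℤ} (hx : 0 < x) (hi : ((2 : ℝ) ^ i) ^ 2 / 2 ≤ x)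
    (hj : x ≤ 9 / 2 * ((2 : ℝ) ^ j) ^ 2) : i - j ≤ 1 := by
  by_contra! h
  have h1 : (2 : ℝ) ^ (j + 2) ≤ 2 ^ i := zpow_le_zpow_right₀ (by norm_num) (by linarith)
  rw [zpow_add₀ two_ne_zero] at h1
  have h2 : (0 : ℝ) < 2 ^ j := by positivity
  have h3 : ((2 : ℝ) ^ j * 2 ^ (2 : ℤ)) ^ 2 ≤ (2 ^ i) ^ 2 := by gcongr
  norm_num at h3
  nlinarith [mul_pos h2 h2]

variable {k : ℤ → SchwartzMap (Cross d) ℝ} {φ : ℤ → Cross d → ℝ}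

theorem one_le_tsum_khat (hk : ∀ j : ℤ, IsBandKernel ((2 : ℝ) ^ j) (k j) (φ j)) {ξ : Cross d}
    (hξ : ξ ≠ 0) : 1 ≤ ∑' j, ‖khat (k j) ξ‖ₑ ^ 2 := by
  obtain ⟨j, hj⟩ := exists_mem_Ico_zpow (norm_pos_iff.2 hξ) (one_lt_two (α := ℝ))
  refine le_trans ?_ (ENNReal.le_tsum j)
  have h1 : φ j ξ = 1 := (hk j).eq_one ξ hj.1 (by
    have := hj.2.le
    rwa [zpow_add_one₀ two_ne_zero, mul_comm] at this)
  rw [(hk j).khat_eq, h1]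
  simp

/-- At a given frequency at most three consecutive bands are active, and their symbols are at most
`1`. -/
theorem tsum_mul_khat_le (hk : ∀ j : ℤ, IsBandKernel ((2 : ℝ) ^ j) (k j) (φ j)) {ξ : Cross d}
    (hξ : ξ ≠ 0) {a : ℤ → ℝ≥0∞} {B : ℝ≥0∞}
    (h : ∀ j, ((2 : ℝ) ^ j) ^ 2 / 2 ≤ ‖ξ‖ ^ 2 → ‖ξ‖ ^ 2 ≤ 9 / 2 * ((2 : ℝ) ^ j) ^ 2 → a j ≤ B) :
    ∑' j, a j * ‖khat (k j) ξ‖ₑ ^ 2 ≤ 3 * B := by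
  have h1 : ∀ j, a j * ‖khat (k j) ξ‖ₑ ^ 2 ≠ 0 → φ j ξ ≠ 0 := fun j hj h0 => hj (by
    rw [(hk j).khat_eq, h0]; simp)
  have hp : 0 < ‖ξ‖ ^ 2 := by have := norm_pos_iff.2 hξ; positivity
  refine tsum_le_of_support_near (fun j => ?_) fun i j hi hj => ?_
  · by_cases h0 : φ j ξ = 0
    · rw [(hk j).khat_eq, h0]; simp
    · obtain ⟨s1, s2⟩ := (hk j).supp ξ h0
      have h2 : ‖khat (k j) ξ‖ₑ ^ 2 ≤ 1 := by
        rw [enorm_sq_eq_ofReal, (hk j).khat_eq, Complex.norm_real, Real.norm_eq_abs, sq_abs,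
          ENNReal.ofReal_le_one]
        exact pow_le_one₀ ((hk j).nonneg ξ) ((hk j).le_one ξ)
      calc _ ≤ B * 1 := mul_le_mul' (h j s1 s2) h2
        _ = B := mul_one B
  · obtain ⟨i1, i2⟩ := (hk i).supp ξ (h1 i hi)
    obtain ⟨j1, j2⟩ := (hk j).supp ξ (h1 j hj)
    have e1 := near_of_dyadic hp i1 j2
    have e2 := near_of_dyadic hp j1 i2
    exact abs_le.2 ⟨by linarith, e1⟩

theorem rate_eq_of_le_one {r R : ℝ} (hR : R ≤ 1) : rate r R = R ^ 2 := by
  simp [rate, max_eq_left hR]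

/-- For `R ≥ 1` the rate is exactly `R^(-(1-2r)₊)`: there is no loss when `r ≥ 1/2`. -/
theorem rate_rpow_le {r R lam : ℝ} (hR : 1 ≤ R) :
    rate r R ^ (-lam) ≤ (R ^ 2) ^ (lam * max 0 (1 / 2 - r)) := by
  have hR0 : 0 < R := by linarith
  have h1 : rate r R = R ^ (-(2 * max 0 (1 / 2 - r))) := by
    rw [rate, max_eq_right hR, div_self hR0.ne', one_pow, mul_one]
    rcases le_total (1 / 2) r with h | h
    · rw [max_eq_left (by linarith), min_eq_left (Real.one_le_rpow hR (by linarith))]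
      simp
    · rw [max_eq_right (by linarith), min_eq_right (Real.rpow_le_one_of_one_le_of_nonpos hR (by linarith))]
      congr 1; ring
  rw [h1, ← Real.rpow_natCast R 2, ← Real.rpow_mul hR0.le, ← Real.rpow_mul hR0.le]
  exact (congrArg (R ^ ·) (by push_cast; ring)).le

theorem rate_pos {r R : ℝ} (hR : 0 < R) : 0 < rate r R := by
  unfold rate
  have : 0 < max 1 R := lt_max_of_lt_left one_pos
  positivity

theorem rate_le_one {r R : ℝ} (hR : 0 < R) : rate r R ≤ 1 := by
  unfold rate
  have h0 : 0 < max 1 R := lt_max_of_lt_left one_pos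
  refine mul_le_one₀ (min_le_left _ _) (by positivity) (pow_le_one₀ (by positivity) ?_)
  exact (div_le_one h0).2 (le_max_right _ _)

/-- The base is at least `1`, so the exponent `n` may be lowered to `lam`; it is also at least
`min(1, c/n) ρ (1 + t)`, because `ρ ≤ 1`. The price for a rate uniform in time is the weight
`ρ^(-lam)`. -/
theorem one_div_pow_le {c ρ lam t : ℝ} {n : ℕ} (hc : 0 < c) (hρ : 0 < ρ) (hρ1 : ρ ≤ 1) (hlam : 0 ≤ lam)
    (hn : lam ≤ n) (hn0 : 0 < n) (ht : 0 ≤ t) :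
    1 / (1 + c * ρ * t / n) ^ n ≤ (min 1 (c / n)) ^ (-lam) * ρ ^ (-lam) * (1 + t) ^ (-lam) := by
  have hn' : (0 : ℝ) < n := by exact_mod_cast hn0
  set q := min 1 (c / n)
  have hq : 0 < q := lt_min one_pos (by positivity)
  set x := 1 + c * ρ * t / n
  have hx1 : 1 ≤ x := by
    have : 0 ≤ c * ρ * t / n := by positivity
    linarith
  have h1 : q * ρ * (1 + t) ≤ x := by
    have e1 : q * ρ ≤ 1 := mul_le_one₀ (min_le_left _ _) hρ.le hρ1
    have e2 : q * (ρ * t) ≤ c / n * (ρ * t) := by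
      gcongr
      exact min_le_right _ _
    have e3 : c / n * (ρ * t) = c * ρ * t / n := by ring
    nlinarith
  have h2 : x ^ (n : ℝ) = x ^ n := Real.rpow_natCast x n
  rw [← Real.mul_rpow hq.le hρ.le, ← Real.mul_rpow (by positivity) (by positivity), one_div, ← h2,
    ← Real.rpow_neg (by linarith)]
  calc x ^ (-(n : ℝ)) ≤ x ^ (-lam) := Real.rpow_le_rpow_of_exponent_le hx1 (by linarith)
    _ ≤ _ := Real.rpow_le_rpow_of_nonpos (by positivity) h1 (by linarith)

/-- Low frequencies: the inverse decay rate is controlled by the Riesz weight. -/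
theorem low_weight_le {r lam x : ℝ} {j : ℤ} (hj : j < 0) (hlam : 0 ≤ lam) (hx : 0 < x)
    (h : x ^ 2 ≤ 9 / 2 * ((2 : ℝ) ^ j) ^ 2) :
    rate r ((2 : ℝ) ^ j) ^ (-lam) ≤ (2 / 9) ^ (-lam) * x ^ (-2 * lam) := by
  have h1 : (2 : ℝ) ^ j ≤ 1 := zpow_le_one_of_nonpos₀ (by norm_num) hj.le
  rw [rate_eq_of_le_one h1, show x ^ (-2 * lam) = (x ^ 2) ^ (-lam) by
    rw [← Real.rpow_natCast x 2, ← Real.rpow_mul hx.le]; congr 1; push_cast; ring,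
    ← Real.mul_rpow (by norm_num) (by positivity)]
  exact Real.rpow_le_rpow_of_nonpos (by positivity) (by linarith) (by linarith)

/-- High frequencies: the inverse decay rate is controlled by a Sobolev weight. -/
theorem high_weight_le {r lam x : ℝ} {j : ℤ} (hj : 0 ≤ j) (hlam : 0 ≤ lam)
    (h : ((2 : ℝ) ^ j) ^ 2 / 2 ≤ x ^ 2) :
    rate r ((2 : ℝ) ^ j) ^ (-lam) ≤
      2 ^ (lam * max 0 (1 / 2 - r)) * (1 + x ^ 2) ^ (lam * max 0 (1 / 2 - r)) := by
  refine (rate_rpow_le (one_le_zpow₀ (by norm_num) hj)).trans ?_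
  rw [← Real.mul_rpow (by norm_num) (by positivity)]
  exact Real.rpow_le_rpow (by positivity) (by linarith) (mul_nonneg hlam (le_max_left _ _))

theorem symbol_le {g σ r : ℝ} (hg : 0 < g) (hσ : 0 < σ) (hr : 0 ≤ r) (ξ : Cross d) :
    symbol g σ r ξ ≤ (g + σ * (2 * Real.pi) ^ (2 * r)) * (1 + ‖ξ‖ ^ 2) ^ r := by
  unfold symbol
  have h1 : ‖ξ‖ ^ (2 * r) ≤ (1 + ‖ξ‖ ^ 2) ^ r := by
    rw [Real.rpow_mul (norm_nonneg _), Real.rpow_ofNat]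
    exact Real.rpow_le_rpow (by positivity) (by linarith) hr
  have h2 : 1 ≤ (1 + ‖ξ‖ ^ 2) ^ r := Real.one_le_rpow (by nlinarith [sq_nonneg ‖ξ‖]) hr
  rw [Real.mul_rpow (by positivity) (norm_nonneg _), add_mul, ← mul_assoc σ]
  gcongr
  nlinarith

end Dyadic

/-! ### Summation over the bands -/

section Summation

variable {d : ℕ} {ℓ : ℝ}

theorem ae_ne_zero (hd : 1 ≤ d) : ∀ᵐ ξ : Cross d, ξ ≠ 0 := by
  have : Nonempty (Fin d) := ⟨⟨0, hd⟩⟩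
  exact compl_mem_ae_iff.2 (measure_singleton 0)

theorem rieszSq_eq (hd : 1 ≤ d) (lam : ℝ) (f : Cross d → ℝ) :
    rieszSq lam f = ∫⁻ ξ, ENNReal.ofReal (‖ξ‖ ^ (-2 * lam)) * ‖hat f ξ‖ₑ ^ 2 := by
  rw [rieszSq, Measure.restrict_eq_self_of_ae_mem (s := {0}ᶜ) (ae_ne_zero hd)]

theorem vecRieszSq_eq (hd : 1 ≤ d) (lam : ℝ) (V : VecL2 d ℓ) :
    vecRieszSq lam V = specSq (fun ξ => ENNReal.ofReal (‖ξ‖ ^ (-2 * lam))) V := by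
  simp only [vecRieszSq, rieszSq_eq hd, specSq]

variable {k : ℤ → SchwartzMap (Cross d) ℝ} {φ : ℤ → Cross d → ℝ}

/-- Off the origin, a null set as `d ≥ 1`, some band symbol equals `1`, so the squared symbols sum
to at least `1`. -/
theorem energy_le_tsum (hd : 1 ≤ d) (hk : ∀ j : ℤ, IsBandKernel ((2 : ℝ) ^ j) (k j) (φ j))
    {g σ r : ℝ} (hg : 0 < g) (hσ : 0 < σ) (hr : 0 ≤ r) (V : VecL2 d ℓ) (f : SurfL2 d) :
    energy (symbol g σ r) V f
      ≤ ∑' j, (‖vecAvg d ℓ (k j) V‖ₑ ^ 2 + ‖(hk j).J g hσ hr f‖ₑ ^ 2) := by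
  have h0 : ∀ᵐ ξ : Cross d, 1 ≤ ∑' j, ‖khat (k j) ξ‖ₑ ^ 2 :=
    (ae_ne_zero hd).mono fun ξ hξ => one_le_tsum_khat hk hξ
  have h1 := tsum_mul_enorm_sq_vecAvg k (fun _ => 1) V
  have h2 := tsum_mul_enorm_sq_J hk hg hσ hr (fun _ => 1) f
  simp only [one_mul] at h1 h2
  rw [ENNReal.tsum_add, h1, h2, energy, lintegral_enorm_sq, ← specSq_one]
  refine add_le_add (ENNReal.half_le_self.trans ?_) (ENNReal.half_le_self.trans ?_)
  · rw [← one_mul (specSq (fun ξ => ∑' j, ‖khat (k j) ξ‖ₑ ^ 2) V)]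
    refine specSq_le (by simp) ?_ V
    simpa only [one_mul] using h0
  · refine lintegral_mono_ae (h0.mono fun ξ hξ => ?_)
    exact le_mul_of_one_le_left' hξ

theorem tsum_vecAvg_lt_top (hd : 1 ≤ d) (hk : ∀ j : ℤ, IsBandKernel ((2 : ℝ) ^ j) (k j) (φ j))
    {a : ℤ → ℝ≥0∞} {C : ℝ≥0∞} (hC : C ≠ ⊤) {W : Cross d → ℝ≥0∞} {V : VecL2 d ℓ}
    (hV : specSq W V < ⊤)
    (h : ∀ j ξ, ξ ≠ 0 → ((2 : ℝ) ^ j) ^ 2 / 2 ≤ ‖ξ‖ ^ 2 → ‖ξ‖ ^ 2 ≤ 9 / 2 * ((2 : ℝ) ^ j) ^ 2 →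
      a j ≤ C * W ξ) :
    ∑' j, a j * ‖vecAvg d ℓ (k j) V‖ₑ ^ 2 < ⊤ := by
  rw [tsum_mul_enorm_sq_vecAvg]
  have h3 : 3 * C ≠ ⊤ := by finiteness
  refine (specSq_le h3 ?_ V).trans_lt (ENNReal.mul_lt_top h3.lt_top hV)
  filter_upwards [ae_ne_zero hd] with ξ hξ
  rw [mul_assoc]
  exact tsum_mul_khat_le hk hξ fun j => h j ξ hξ

theorem tsum_J_lt_top (hd : 1 ≤ d) (hk : ∀ j : ℤ, IsBandKernel ((2 : ℝ) ^ j) (k j) (φ j))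
    {g σ r : ℝ} (hg : 0 < g) (hσ : 0 < σ) (hr : 0 ≤ r)
    {a : ℤ → ℝ≥0∞} {C : ℝ≥0∞} (hC : C ≠ ⊤) {W : Cross d → ℝ≥0∞} {f : SurfL2 d}
    (hf : ∫⁻ ξ, W ξ * ‖hat f ξ‖ₑ ^ 2 < ⊤)
    (h : ∀ j ξ, ξ ≠ 0 → ((2 : ℝ) ^ j) ^ 2 / 2 ≤ ‖ξ‖ ^ 2 → ‖ξ‖ ^ 2 ≤ 9 / 2 * ((2 : ℝ) ^ j) ^ 2 →
      a j * ENNReal.ofReal (symbol g σ r ξ) ≤ C * W ξ) :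
    ∑' j, a j * ‖(hk j).J g hσ hr f‖ₑ ^ 2 < ⊤ := by
  rw [tsum_mul_enorm_sq_J hk hg]
  have h3 : 3 * C ≠ ⊤ := by finiteness
  refine lt_of_le_of_lt ?_ (ENNReal.mul_lt_top h3.lt_top hf)
  rw [← lintegral_const_mul' _ _ h3]
  refine lintegral_mono_ae ?_
  filter_upwards [ae_ne_zero hd] with ξ hξ
  rw [← mul_assoc, ← mul_assoc, mul_assoc 3]
  refine mul_le_mul_left ?_ _
  rw [← ENNReal.tsum_mul_right]
  refine le_of_eq_of_le (tsum_congr fun j => ?_) (tsum_mul_khat_le hk hξ fun j => h j ξ hξ)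
  ring

/-- The weight is split at `j = 0`. For `j < 0` it is dominated by the Riesz weight and `μ` is
bounded; for `j ≥ 0` it is dominated by a Sobolev weight of order `θ`, and `μ` adds the order `r`
for the surface. -/
theorem tsum_weighted_lt_top (hd : 1 ≤ d)
    (hk : ∀ j : ℤ, IsBandKernel ((2 : ℝ) ^ j) (k j) (φ j))
    {g σ r lam : ℝ} (hg : 0 < g) (hσ : 0 < σ) (hr : 0 ≤ r) (hlam : 0 ≤ lam) {V : VecL2 d ℓ}
    {f : SurfL2 d} (hIV : vecRieszSq lam V < ⊤) (hIf : rieszSq lam f < ⊤)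
    (hV : vecSobolevSq (lam * max 0 (1 / 2 - r)) V < ⊤)
    (hf : sobolevSq (lam * max 0 (1 / 2 - r) + r) f < ⊤) :
    ∑' j, ENNReal.ofReal (rate r ((2 : ℝ) ^ j) ^ (-lam))
      * (‖vecAvg d ℓ (k j) V‖ₑ ^ 2 + ‖(hk j).J g hσ hr f‖ₑ ^ 2) < ⊤ := by
  set w : ℤ → ℝ≥0∞ := fun j => ENNReal.ofReal (rate r ((2 : ℝ) ^ j) ^ (-lam))
  set θ := lam * max 0 (1 / 2 - r)
  set C₀ := g + σ * (2 * Real.pi) ^ (2 * r)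
  have hC₀ : 0 < C₀ := by positivity
  rw [vecRieszSq_eq hd] at hIV
  rw [rieszSq_eq hd] at hIf
  let lo : ℤ → ℝ≥0∞ := fun j => if j < 0 then w j else 0
  let hi : ℤ → ℝ≥0∞ := fun j => if j < 0 then 0 else w j
  have hw : ∀ j, w j = lo j + hi j := fun j => by
    simp only [lo, hi]; split_ifs <;> simp
  have t1 : ∑' j, lo j * ‖vecAvg d ℓ (k j) V‖ₑ ^ 2 < ⊤ := by
    refine tsum_vecAvg_lt_top hd hk (C := ENNReal.ofReal ((2 / 9) ^ (-lam))) (by finiteness) hIV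
      fun j ξ hξ _ s2 => ?_
    simp only [lo]
    split_ifs with hj
    · rw [← ENNReal.ofReal_mul (by positivity)]
      exact ENNReal.ofReal_le_ofReal (low_weight_le hj hlam (norm_pos_iff.2 hξ) s2)
    · exact zero_le
  have t2 : ∑' j, hi j * ‖vecAvg d ℓ (k j) V‖ₑ ^ 2 < ⊤ := by
    refine tsum_vecAvg_lt_top hd hk (C := ENNReal.ofReal (2 ^ θ)) (by finiteness) hV
      fun j ξ hξ s1 _ => ?_
    simp only [hi]
    split_ifs with hj
    · exact zero_le
    · rw [← ENNReal.ofReal_mul (by positivity)]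
      exact ENNReal.ofReal_le_ofReal (high_weight_le (not_lt.1 hj) hlam s1)
  have t3 : ∑' j, lo j * ‖(hk j).J g hσ hr f‖ₑ ^ 2 < ⊤ := by
    refine tsum_J_lt_top hd hk hg hσ hr
      (C := ENNReal.ofReal ((2 / 9) ^ (-lam) * (C₀ * (11 / 2) ^ r))) (by finiteness) hIf
      fun j ξ hξ _ s2 => ?_
    simp only [lo]
    split_ifs with hj
    · rw [← ENNReal.ofReal_mul (Real.rpow_nonneg (rate_pos (by positivity)).le _),
        ← ENNReal.ofReal_mul (by positivity)]
      refine ENNReal.ofReal_le_ofReal ?_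
      have e1 : (2 : ℝ) ^ j ≤ 1 := zpow_le_one_of_nonpos₀ (by norm_num) hj.le
      have e2 : ‖ξ‖ ^ 2 ≤ 9 / 2 := s2.trans (by
        have : ((2 : ℝ) ^ j) ^ 2 ≤ 1 := pow_le_one₀ (by positivity) e1
        linarith)
      -- Bands with `j < 0` reach at most `‖ξ‖² = 9/2`, and `1 + 9/2 = 11/2`.
      have e3 : symbol g σ r ξ ≤ C₀ * (11 / 2) ^ r := (symbol_le hg hσ hr ξ).trans (by
        have : (1 + ‖ξ‖ ^ 2) ^ r ≤ (11 / 2) ^ r :=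
          Real.rpow_le_rpow (by positivity) (by linarith) hr
        gcongr)
      calc _ ≤ ((2 / 9) ^ (-lam) * ‖ξ‖ ^ (-2 * lam)) * (C₀ * (11 / 2) ^ r) :=
            mul_le_mul (low_weight_le hj hlam (norm_pos_iff.2 hξ) s2) e3 (symbol_nonneg hg hσ r ξ)
              (by positivity)
        _ = _ := by ring
    · simp
  have t4 : ∑' j, hi j * ‖(hk j).J g hσ hr f‖ₑ ^ 2 < ⊤ := by
    refine tsum_J_lt_top hd hk hg hσ hr (C := ENNReal.ofReal (2 ^ θ * C₀)) (by finiteness) hf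
      fun j ξ hξ s1 _ => ?_
    simp only [hi]
    split_ifs with hj
    · simp
    · rw [← ENNReal.ofReal_mul (Real.rpow_nonneg (rate_pos (by positivity)).le _),
        ← ENNReal.ofReal_mul (by positivity), Real.rpow_add (by positivity)]
      refine ENNReal.ofReal_le_ofReal ?_
      calc _ ≤ (2 ^ θ * (1 + ‖ξ‖ ^ 2) ^ θ) * (C₀ * (1 + ‖ξ‖ ^ 2) ^ r) :=
            mul_le_mul (high_weight_le (not_lt.1 hj) hlam s1) (symbol_le hg hσ hr ξ)
              (symbol_nonneg hg hσ r ξ) (by positivity)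
        _ = _ := by ring
  have e : ∀ j, w j * (‖vecAvg d ℓ (k j) V‖ₑ ^ 2 + ‖(hk j).J g hσ hr f‖ₑ ^ 2)
      = (lo j * ‖vecAvg d ℓ (k j) V‖ₑ ^ 2 + hi j * ‖vecAvg d ℓ (k j) V‖ₑ ^ 2)
        + (lo j * ‖(hk j).J g hσ hr f‖ₑ ^ 2 + hi j * ‖(hk j).J g hσ hr f‖ₑ ^ 2) := fun j => by
    rw [hw]; ring
  change ∑' j, w j * _ < ⊤
  simp only [e, ENNReal.tsum_add]
  exact ENNReal.add_lt_top.2 ⟨ENNReal.add_lt_top.2 ⟨t1, t2⟩, ENNReal.add_lt_top.2 ⟨t3, t4⟩⟩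

theorem exists_energy_decay (hd : 1 ≤ d) {g σ r lam : ℝ} (hℓ : 0 < ℓ) (hg : 0 < g) (hσ : 0 < σ)
    (hr : 0 ≤ r) (hlam : 0 ≤ lam) {u₀ : VecL2 d ℓ} {h₀ : SurfL2 d}
    (hIu : vecRieszSq lam u₀ < ⊤) (hIh : rieszSq lam h₀ < ⊤)
    (hu : vecSobolevSq (lam * max 0 (1 / 2 - r)) u₀ < ⊤)
    (hh : sobolevSq (lam * max 0 (1 / 2 - r) + r) h₀ < ⊤) :
    ∃ K : ℝ, 0 < K ∧ ∀ (u : ℝ → Hel d ℓ) (h : ℝ → SurfL2 d) (u' : ℝ → (Hel d ℓ →L[ℝ] ℝ))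
      (h' m : ℝ → SurfL2 d) (f : ℝ → Hel d ℓ) (U : ℝ → VecL2 d ℓ),
      IsWeakSolutionWith d ℓ (symbol g σ r) u₀ h₀ u h u' h' m →
      IsRepresented (Hel.fieldL d ℓ) u₀ u u' f U → ∀ t : ℝ, 0 ≤ t →
        energy (symbol g σ r) (U t) (surfRep h₀ h' t) ≤ ENNReal.ofReal (K * (1 + t) ^ (-lam)) := by
  obtain ⟨c, hc, hband⟩ := exists_band_decay d hℓ hg hσ hr
  choose k φ hk using fun j : ℤ => exists_isBandKernel d (R := (2 : ℝ) ^ j) (by positivity)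
  have hS := tsum_weighted_lt_top hd hk hg hσ hr hlam hIu hIh hu hh
  set S := ∑' j, ENNReal.ofReal (rate r ((2 : ℝ) ^ j) ^ (-lam))
      * (‖vecAvg d ℓ (k j) u₀‖ₑ ^ 2 + ‖(hk j).J g hσ hr h₀‖ₑ ^ 2)
  obtain ⟨s, hs0, hsS⟩ : ∃ s : ℝ, 0 ≤ s ∧ S = ENNReal.ofReal s :=
    ⟨S.toReal, ENNReal.toReal_nonneg, (ENNReal.ofReal_toReal hS.ne).symm⟩
  -- The added `1` keeps `n` positive when `lam = 0`.
  let n := ⌈lam⌉₊ + 1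
  have hn : lam ≤ n := (Nat.le_ceil lam).trans (by simp [n])
  have hn0 : 0 < n := Nat.succ_pos _
  set q := 4 * (min 1 (c / n)) ^ (-lam)
  have hq : 0 < q := by
    have : 0 < min 1 (c / n) := lt_min one_pos (by positivity)
    positivity
  -- The added `1` keeps the constant positive for zero data. All of `q`, `s`, `n` depend only on
  -- the parameters and the initial data, so they precede the solution.
  refine ⟨q * s + 1, by positivity, fun u h u' h' m f U hs hrep t ht => ?_⟩
  refine (energy_le_tsum hd hk hg hσ hr _ _).trans ?_
  have key : ∀ j, ‖vecAvg d ℓ (k j) (U t)‖ₑ ^ 2 + ‖(hk j).J g hσ hr (surfRep h₀ h' t)‖ₑ ^ 2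
      ≤ ENNReal.ofReal (q * (1 + t) ^ (-lam)) * (ENNReal.ofReal (rate r ((2 : ℝ) ^ j) ^ (-lam))
        * (‖vecAvg d ℓ (k j) u₀‖ₑ ^ 2 + ‖(hk j).J g hσ hr h₀‖ₑ ^ 2)) := fun j => by
    have b1 := hband _ _ _ (hk j) u₀ h₀ u h u' h' m f U hs hrep t ht n hn0
    have hρ : 0 < rate r ((2 : ℝ) ^ j) := rate_pos (by positivity)
    have b2 := one_div_pow_le hc hρ (rate_le_one (by positivity)) hlam hn hn0 ht
    simp only [enorm_sq_eq_ofReal]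
    rw [← ENNReal.ofReal_add (by positivity) (by positivity),
      ← ENNReal.ofReal_add (by positivity) (by positivity), ← ENNReal.ofReal_mul (by positivity),
      ← ENNReal.ofReal_mul (by positivity)]
    refine ENNReal.ofReal_le_ofReal (b1.trans ?_)
    rw [div_eq_mul_one_div]
    refine (mul_le_mul_of_nonneg_left b2 (by positivity)).trans_eq ?_
    simp only [q]
    ring
  refine (ENNReal.tsum_le_tsum key).trans ?_
  rw [ENNReal.tsum_mul_left]
  change _ * S ≤ _
  rw [hsS, ← ENNReal.ofReal_mul (by positivity)]
  refine ENNReal.ofReal_le_ofReal ?_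
  have : 0 ≤ (1 + t) ^ (-lam) := by positivity
  nlinarith

end Summation

end FracBoundaryNS

end

theorem theorem5p1 (d : ℕ) (hd : 1 ≤ d) (ℓ g σ r lam : ℝ) (hℓ : 0 < ℓ) (hg : 0 < g) (hσ : 0 < σ)
    (hr0 : 0 ≤ r) (hr1 : r ≤ 1) (hlam : 0 ≤ lam)
    (u₀ : FracBoundaryNS.VecL2 d ℓ) (h₀ : FracBoundaryNS.SurfL2 d)
    (hIu : FracBoundaryNS.vecRieszSq lam u₀ < ⊤) (hIh : FracBoundaryNS.rieszSq lam h₀ < ⊤)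
    (hhigh : 1 / 2 ≤ r → FracBoundaryNS.sobolevSq r h₀ < ⊤)
    (hlow : r < 1 / 2 → FracBoundaryNS.vecSobolevSq (lam * (1 / 2 - r)) u₀ < ⊤ ∧
      FracBoundaryNS.sobolevSq (lam / 2 + r * (1 - lam)) h₀ < ⊤) :
    ∃ K : ℝ, 0 < K ∧ ∀ (u : ℝ → FracBoundaryNS.Hel d ℓ) (h : ℝ → FracBoundaryNS.SurfL2 d),
      FracBoundaryNS.IsWeakSolution d ℓ (FracBoundaryNS.symbol g σ r) u₀ h₀ u h →
      ∃ (U : ℝ → FracBoundaryNS.VecL2 d ℓ) (H : ℝ → FracBoundaryNS.SurfL2 d),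
        (∀ᵐ t ∂(volume.restrict (Ioi (0 : ℝ))), U t = FracBoundaryNS.Hel.field (u t) ∧ H t = h t) ∧
        ContinuousOn U (Ici 0) ∧ ContinuousOn H (Ici 0) ∧ U 0 = u₀ ∧ H 0 = h₀ ∧
        ∀ t : ℝ, 0 ≤ t → FracBoundaryNS.energy (FracBoundaryNS.symbol g σ r) (U t) (H t) ≤
          ENNReal.ofReal (K * (1 + t) ^ (-lam)) := by
  -- The two regimes of `r` are unified by the order `λ(1/2 - r)₊`. Below `1/2`, `λ(1/2 - r) + r =
  -- λ/2 + r(1 - λ)`; from `1/2` on, the velocity condition has order zero and is just `u₀ ∈ L²`.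
  have hreg : FracBoundaryNS.vecSobolevSq (lam * max 0 (1 / 2 - r)) u₀ < ⊤ ∧
      FracBoundaryNS.sobolevSq (lam * max 0 (1 / 2 - r) + r) h₀ < ⊤ := by
    rcases lt_or_ge r (1 / 2) with h | h
    · rw [max_eq_right (by linarith), show lam * (1 / 2 - r) + r = lam / 2 + r * (1 - lam) by ring]
      exact hlow h
    · rw [max_eq_left (by linarith), mul_zero, zero_add]
      refine ⟨?_, hhigh h⟩
      have e : FracBoundaryNS.vecSobolevSq 0 u₀ = FracBoundaryNS.specSq (fun _ => 1) u₀ := by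
        simp [FracBoundaryNS.vecSobolevSq, FracBoundaryNS.sobolevSq, FracBoundaryNS.specSq]
      rw [e, FracBoundaryNS.specSq_one]
      finiteness
  obtain ⟨K, hK, hdecay⟩ :=
    FracBoundaryNS.exists_energy_decay hd hℓ hg hσ hr0 hlam hIu hIh hreg.1 hreg.2
  refine ⟨K, hK, fun u h ⟨u', h', m, hs⟩ => ?_⟩
  obtain ⟨f, U, hrep⟩ := FracBoundaryNS.exists_isRepresented FracBoundaryNS.Hel.injective_fieldL
    hs.u_mem hs.u'_mem hs.u₀_mem hs.u_deriv
  refine ⟨U, FracBoundaryNS.surfRep h₀ h', ?_, hrep.U_cont, hs.continuousOn_surfRep, hrep.U_zero,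
    by simp [FracBoundaryNS.surfRep], fun t ht => hdecay u h u' h' m f U hs hrep t ht⟩
  filter_upwards [hrep.U_ae, hs.ae_surfRep] with t h1 h2 using ⟨h1, h2⟩
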